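/- \textbf{Setting.} Let $\mathfrak g$ be a finite-dimensional real Lie algebra of compact type (negative definite Killing form $K$), and let $\mathfrak g=\mathfrak m\oplus\mathfrak h$, $\mathfrak m\neq 0$, be a Hermitian symmetric Lie algebra: $[\mathfrak h,\mathfrak h]\subseteq\mathfrak h$, $[\mathfrak h,\mathfrak m]\subseteq\mathfrak m$, $[\mathfrak m,\mathfrak m]\subseteq\mathfrak h$, with an element $A\in\mathfrak h$ whose centralizer in $\mathfrak g$ is $\mathfrak h$ and for which $J=\mathrm{ad}(A)$ satisfies $J^2=-1$ on $\mathfrak m$. Use the inner product $-K$ on $\mathfrak g$ and put $a=|A|^2=\dim\mathfrak m$. Let $G$ be the adjoint group (the identity component of $\mathrm{Aut}(\mathfrak g)$), $H\subset G$ the stabilizer of $A$, and identify the Hermitian symmetric space $M=G/H$ with the orbit $\mathrm{Ad}(G)A\subset\mathfrak g$. The flat space $\mathrm{Aff}(G,H)=(G\rtimes\mathfrak g)/G$ is identified with $\mathfrak g$. Let $I\subseteq\mathbb R$ be an open interval; fields are functions of $(x,t)\in\mathbb R\times I$, and all fields are smooth. Let $n\ge 0$. \textbf{The three hierarchies.}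 \begin{itemize} \item For $q$ with values in $\mathfrak m$, let $\mathcal H=D_x-\mathrm{ad}(q)D_x^{-1}\mathrm{ad}(q)$ and $\mathcal R=\mathcal HJ^{-1}$. The $+m$ isospectral flow is $\frac1a q_t=\mathcal R^m(Jq)$. \item For $\chi$ with values in $M$, let $J_\chi=\mathrm{ad}(\chi)$, $\nabla_x=-J_\chi^2D_x$ (the Levi-Civita derivative of $M$), $\nabla^{\mathfrak h}_x=(1+J_\chi^2)D_x$, and $\mathcal R_\chi=-J_\chi\big(\nabla_x-\mathrm{ad}(\chi_x)(\nabla_x^{\mathfrak h})^{-1}\mathrm{ad}(\chi_x)\big)$. The $+n$ map equation is $\chi_t=\mathcal R_\chi^n(\chi_x)$. \item For $T$ with values in $a^{-1/2}\,\mathrm{Ad}(G)A$, let $\nabla_x^{\mathfrak h}=(1+a\,\mathrm{ad}(T)^2)D_x$ and $\mathcal R_T=\mathrm{ad}(T)^{-1}\big(D_x-a\,\mathrm{ad}(T_x)(\nabla_x^{\mathfrak h})^{-1}\mathrm{ad}(T_x)\big)$, where $\mathrm{ad}(T)^{-1}$ is extended by $0$ to $\ker\mathrm{ad}(T)$. The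 $+k$ spin model is $T_t=\mathcal R_T^k(T_x)$, $|T|=1$. \end{itemize} Here $D_x^{-1}F$ denotes the local primitive of $F$ (its value at $x$ depends on finitely many $x$-derivatives of $q$ at $x$) that vanishes for $q=0$. Likewise $(\nabla_x^{\mathfrak h})^{-1}F$ denotes the local solution $P$ of $\nabla_x^{\mathfrak h}P=F$ that lies in $\ker\mathrm{ad}(\chi)$ (respectively $\ker\mathrm{ad}(T)$) and vanishes on constant curves. \textbf{Hasimoto variables.} A parallel frame for $\chi:\mathbb R\times I\to M$ is a smooth $\psi:\mathbb R\times I\to G$ with $\mathrm{Ad}(\psi)A=\chi$ and $\psi^{-1}\partial_x\psi\in\mathfrak m$; then $q=\psi^{-1}\partial_x\psi$ is a Hasimoto variable of $\chi$. It is unaffected by replacing $\chi,\psi$ by $g(t)\chi,\ g(t)\psi$ with $g:I\to G$, and replacing $\psi$ by $\psi h(t)$ with $h:I\to H$ replaces $q$ by $\mathrm{Ad}(h(t)^{-1})q$. \textbf{Theorem.} \begin{enumerate} \item All the inverses $D_x^{-1}$ and $(\nabla^{\mathfrak h}_x)^{-1}$ that occur in $\mathcal R^k(Jq)$, $\mathcal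 R_\chi^k(\chi_x)$ and $\mathcal R_T^k(T_x)$, $k\ge 0$, exist and are unique. \item Every smooth $\chi:\mathbb R\times I\to M$ has a parallel frame and a Hasimoto variable, and every smooth $q:\mathbb R\times I\to\mathfrak m$ is the Hasimoto variable of some $\chi$. \item If $q$ is a Hasimoto variable of $\chi$, then the following are equivalent: (a) for some smooth $g:I\to G$ the map $g(t)\chi$ solves the $+n$ map equation; (b) for some smooth $h:I\to H$ the function $\mathrm{Ad}(h(t)^{-1})q$ solves the $+(n+1)$ isospectral flow after rescaling time, $t\mapsto a t$. In particular every solution $\chi$ has a Hasimoto variable that solves the $+(n+1)$ flow, and every solution $q$ is the Hasimoto variable of a solution $\chi$. \item If, for each $t$, $q$ and all its $x$-derivatives and $\partial_t\psi$ tend to $0$ as $x\to-\infty$, then $\chi$ solves the $+n$ map equation if and only if $q(x,at)$ solves the $+(n+1)$ isospectral flow. \item $\chi$ solves the $+n$ map equation if and only if $T(x,t)=a^{-1/2}\chi(x,a^{n/2}t)$ solves the $+n$ spin model. \end{enumerate} -/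

import Mathlib

open Set Filter Topology
open scoped ContDiff

namespace HermSym

/-- A real Lie algebra is of compact (semisimple) type: its Killing form is negative definite. -/
class IsCompactType (𝔤 : Type*) [LieRing 𝔤] [LieAlgebra ℝ 𝔤] : Prop where
  killing_neg : ∀ x : 𝔤, x ≠ 0 → killingForm ℝ 𝔤 x x < 0

noncomputable section Norm

variable (𝔤 : Type*) [LieRing 𝔤] [LieAlgebra ℝ 𝔤] [IsCompactType 𝔤]

/-- The `ad`-invariant inner product `⟨a, b⟩ = - Kill(a, b)`. -/
@[reducible] def killingCore : InnerProductSpace.Core ℝ 𝔤 where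
  inner a b := -killingForm ℝ 𝔤 a b
  conj_inner_symm a b := by
    simp [LieModule.traceForm_comm ℝ 𝔤 𝔤 a b]
  re_inner_nonneg a := by
    by_cases h : a = 0
    · simp [h]
    · have := IsCompactType.killing_neg a h
      simpa using this.le
  add_left a b c := by simp; ring
  smul_left a b r := by simp
  definite a h := by
    by_contra hne
    have := IsCompactType.killing_neg a hne
    linarith

instance (priority := 50) killingNormedAddCommGroup : NormedAddCommGroup 𝔤 :=
  @InnerProductSpace.Core.toNormedAddCommGroup ℝ 𝔤 _ _ _ (killingCore 𝔤)

instance (priority := 50) killingInnerProductSpace : InnerProductSpace ℝ 𝔤 :=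
  @InnerProductSpace.ofCore ℝ 𝔤 _ _ _ (killingCore 𝔤).toCore

end Norm

section Algebra

variable {𝔤 : Type*} [LieRing 𝔤] [LieAlgebra ℝ 𝔤]

/-- A Hermitian symmetric Lie algebra `𝔤 = 𝔪 ⊕ 𝔥` with Hermitian structure `A ∈ 𝔥`. -/
structure IsHermitianSymmetric (𝔥 : LieSubalgebra ℝ 𝔤) (𝔪 : Submodule ℝ 𝔤) (A : 𝔤) : Prop where
  isCompl : IsCompl 𝔥.toSubmodule 𝔪
  lie_h_m : ∀ a ∈ 𝔥, ∀ y ∈ 𝔪, ⁅a, y⁆ ∈ 𝔪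
  lie_m_m : ∀ y ∈ 𝔪, ∀ z ∈ 𝔪, ⁅y, z⁆ ∈ 𝔥
  mem : A ∈ 𝔥
  centralizer : ∀ y : 𝔤, ⁅A, y⁆ = 0 ↔ y ∈ 𝔥
  sq : ∀ y ∈ 𝔪, ⁅A, ⁅A, y⁆⁆ = -y

end Algebra

/-- The automorphism group `Aut 𝔤`, with composition as multiplication. -/
instance autGroup (𝔤 : Type*) [LieRing 𝔤] [LieAlgebra ℝ 𝔤] : Group (𝔤 ≃ₗ⁅ℝ⁆ 𝔤) where
  __ := (inferInstance : One (𝔤 ≃ₗ⁅ℝ⁆ 𝔤))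
  mul φ₁ φ₂ := φ₂.trans φ₁
  inv φ := φ.symm
  mul_assoc _ _ _ := rfl
  one_mul _ := rfl
  mul_one _ := rfl
  inv_mul_cancel φ := by
    apply LieEquiv.ext
    intro y
    exact φ.symm_apply_apply y

section Group

variable (𝔤 : Type*) [LieRing 𝔤] [LieAlgebra ℝ 𝔤] [FiniteDimensional ℝ 𝔤] [IsCompactType 𝔤]

/-- The adjoint group `G = Ad(G)` of `𝔤`: the identity (path) component of `Aut 𝔤`. -/
def adjointGroup : Subgroup (𝔤 ≃ₗ⁅ℝ⁆ 𝔤) where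
  carrier := {φ | ∃ p : ℝ → (𝔤 ≃ₗ⁅ℝ⁆ 𝔤), (∀ y : 𝔤, Continuous fun s => p s y) ∧ p 0 = 1 ∧ p 1 = φ}
  one_mem' := ⟨fun _ => 1, fun _ => continuous_const, rfl, rfl⟩
  mul_mem' := by
    rintro φ₁ φ₂ ⟨p, hp, hp0, hp1⟩ ⟨r, hr, hr0, hr1⟩
    refine ⟨fun s => if s ≤ 1 / 2 then r (2 * s) else p (2 * s - 1) * φ₂, fun y => ?_, ?_, ?_⟩
    · have h : (fun s : ℝ => (if s ≤ 1 / 2 then r (2 * s) else p (2 * s - 1) * φ₂) y)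
          = fun s : ℝ => if s ≤ 1 / 2 then r (2 * s) y else p (2 * s - 1) (φ₂ y) := by
        funext s
        split_ifs <;> rfl
      rw [h]
      refine Continuous.if_le ((hr y).comp (by fun_prop)) ((hp (φ₂ y)).comp (by fun_prop))
        continuous_id continuous_const ?_
      intro s hs
      subst hs
      norm_num [hr1, hp0]
    · norm_num [hr0]
    · norm_num [hp1]
  inv_mem' := by
    rintro φ ⟨p, hp, hp0, hp1⟩
    refine ⟨fun s => φ⁻¹ * p (1 - s), fun y => ?_, by simp [hp1], by simp [hp0]⟩
    have hc : Continuous (fun z : 𝔤 => (φ⁻¹ : 𝔤 ≃ₗ⁅ℝ⁆ 𝔤) z) :=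
      LinearMap.continuous_of_finiteDimensional
        (((φ⁻¹ : 𝔤 ≃ₗ⁅ℝ⁆ 𝔤) : 𝔤 →ₗ⁅ℝ⁆ 𝔤) : 𝔤 →ₗ[ℝ] 𝔤)
    exact hc.comp ((hp y).comp (by fun_prop))

variable {𝔤}

/-- The subgroup `H ⊆ G` that stabilizes `A` in the adjoint representation. -/
def isotropyGroup (A : 𝔤) : Subgroup (𝔤 ≃ₗ⁅ℝ⁆ 𝔤) where
  carrier := {φ | φ ∈ adjointGroup 𝔤 ∧ φ A = A}
  one_mem' := ⟨one_mem _, rfl⟩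
  mul_mem' := by
    rintro φ₁ φ₂ ⟨h₁, e₁⟩ ⟨h₂, e₂⟩
    refine ⟨mul_mem h₁ h₂, ?_⟩
    change φ₁ (φ₂ A) = A
    rw [e₂, e₁]
  inv_mem' := by
    rintro φ ⟨h, e⟩
    refine ⟨inv_mem h, ?_⟩
    change φ.symm A = A
    conv_lhs => rw [← e]
    exact φ.symm_apply_apply A

/-- The Hermitian symmetric space `M = G/H`, embedded isometrically in `𝔤` as the adjoint
orbit `Ad(G)A`. -/
def symmetricSpace (A : 𝔤) : Set 𝔤 := {v | ∃ φ ∈ adjointGroup 𝔤, φ A = v}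

end Group

noncomputable section Functionals

variable {𝔤 : Type*} [LieRing 𝔤] [LieAlgebra ℝ 𝔤] [IsCompactType 𝔤]

/-- Smooth curves `ℝ → 𝔤` with values in `N`. -/
def smoothCurves (N : Set 𝔤) : Set (ℝ → 𝔤) := {γ | ContDiff ℝ ∞ γ ∧ ∀ x, γ x ∈ N}

/-- Expressions `F(γ)(x)` formed from a curve `γ`. -/
abbrev CurveFun (𝔤 : Type*) := (ℝ → 𝔤) → ℝ → 𝔤

/-- `F(γ)(x)` depends only on finitely many derivatives of `γ` at `x`, for smooth curves in `N`. -/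
def IsLocal (N : Set 𝔤) (F : CurveFun 𝔤) : Prop :=
  ∃ k : ℕ, ∀ γ ∈ smoothCurves N, ∀ γ' ∈ smoothCurves N, ∀ x : ℝ,
    (∀ i ≤ k, iteratedDeriv i γ x = iteratedDeriv i γ' x) → F γ x = F γ' x

/-! ### Isospectral flows for the Hasimoto variable -/

/-- `P = Dₓ⁻¹ F`: the primitive of `F` that is itself a local expression and vanishes for `q = 0`.
These conditions determine `P(q)` for all smooth `𝔪`-valued `q`. -/
def IsPrimitive (𝔪 : Submodule ℝ 𝔤) (F P : CurveFun 𝔤) : Prop :=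
  IsLocal (𝔪 : Set 𝔤) P ∧ (∀ q ∈ smoothCurves (𝔪 : Set 𝔤), ∀ x, HasDerivAt (P q) (F q x) x) ∧
    ∀ x, P (fun _ => 0) x = 0

open Classical in
/-- The operator `Dₓ⁻¹`. -/
def Dinv (𝔪 : Submodule ℝ 𝔤) (F : CurveFun 𝔤) : CurveFun 𝔤 :=
  if h : ∃ P, IsPrimitive 𝔪 F P then h.choose else 0

/-- `Jq = [A, q]` as an expression in `q`. -/
def Jq (A : 𝔤) : CurveFun 𝔤 := fun q x => ⁅A, q x⁆

/-- `J⁻¹ = -J = -ad(A)` on `𝔪`. -/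
def Jinv (A : 𝔤) (F : CurveFun 𝔤) : CurveFun 𝔤 := fun q x => -⁅A, F q x⁆

/-- `ad(q)`. -/
def adq (F : CurveFun 𝔤) : CurveFun 𝔤 := fun q x => ⁅q x, F q x⁆

/-- `ℋ = Dₓ - ad(q) Dₓ⁻¹ ad(q)`. -/
def Hop (𝔪 : Submodule ℝ 𝔤) (F : CurveFun 𝔤) : CurveFun 𝔤 :=
  fun q x => deriv (F q) x - adq (Dinv 𝔪 (adq F)) q x

/-- `ℛ = ℋ J⁻¹`. -/
def Rop (𝔪 : Submodule ℝ 𝔤) (A : 𝔤) (F : CurveFun 𝔤) : CurveFun 𝔤 := Hop 𝔪 (Jinv A F)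

/-! ### Operators along curves in an adjoint orbit -/

/-- `ad(γ)`. -/
def adCurve (F : CurveFun 𝔤) : CurveFun 𝔤 := fun γ x => ⁅γ x, F γ x⁆

/-- `ad(γₓ)`. -/
def adCurveX (F : CurveFun 𝔤) : CurveFun 𝔤 := fun γ x => ⁅deriv γ x, F γ x⁆

/-- `P = (∇^𝔥ₓ)⁻¹ F` where `∇^𝔥ₓ = (1 + c ad(γ)²) Dₓ`, for curves `γ` in `N`: the local expression
`P` in the kernel of `ad(γ)` with `∇^𝔥ₓ P = F` that vanishes on constant curves. These conditions
determine `P(γ)` for all smooth curves `γ` in the orbits considered below. -/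
def IsHPrimitive (N : Set 𝔤) (c : ℝ) (F P : CurveFun 𝔤) : Prop :=
  IsLocal N P ∧
    (∀ γ ∈ smoothCurves N, Differentiable ℝ (P γ) ∧ ∀ x, ⁅γ x, P γ x⁆ = 0 ∧
      deriv (P γ) x + c • ⁅γ x, ⁅γ x, deriv (P γ) x⁆⁆ = F γ x) ∧
    ∀ v ∈ N, ∀ x, P (fun _ => v) x = 0

open Classical in
/-- The operator `(∇^𝔥ₓ)⁻¹`. -/
def Hinv (N : Set 𝔤) (c : ℝ) (F : CurveFun 𝔤) : CurveFun 𝔤 :=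
  if h : ∃ P, IsHPrimitive N c F P then h.choose else 0

/-- The derivative `γₓ` as an expression in `γ`. -/
def curveX : CurveFun 𝔤 := fun γ x => deriv γ x

end Functionals

noncomputable section Flows

variable {𝔤 : Type*} [LieRing 𝔤] [LieAlgebra ℝ 𝔤] [FiniteDimensional ℝ 𝔤] [IsCompactType 𝔤]

/-- `J_χ = ad(χ)` on `T_χ M`. -/
def Jmap (F : CurveFun 𝔤) : CurveFun 𝔤 := adCurve F

/-- The covariant derivative `∇ₓ = -J_χ² Dₓ` of `M` along a curve (orthogonal projection of `Dₓ`
to `T_χ M`). -/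
def covDeriv (F : CurveFun 𝔤) : CurveFun 𝔤 := fun γ x => -⁅γ x, ⁅γ x, deriv (F γ) x⁆⁆

/-- `𝓜_χ = ad(χₓ) (∇^𝔥ₓ)⁻¹ ad(χₓ)`. -/
def Mop (A : 𝔤) (F : CurveFun 𝔤) : CurveFun 𝔤 :=
  adCurveX (Hinv (symmetricSpace A) 1 (adCurveX F))

/-- `ℛ_χ = -J_χ (∇ₓ - 𝓜_χ)`. -/
def Rmap (A : 𝔤) (F : CurveFun 𝔤) : CurveFun 𝔤 := -Jmap (covDeriv F - Mop A F)

/-- The squared norm `-Kill(A, A) = dim 𝔪` of `A`. -/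
def normSq (𝔪 : Submodule ℝ 𝔤) : ℝ := Module.finrank ℝ 𝔪

/-- The vectors `(dim 𝔪)^{-1/2} Ad(ψ)A`, `ψ ∈ G`, in which spin vectors take their values. -/
def spinSpace (𝔪 : Submodule ℝ 𝔤) (A : 𝔤) : Set 𝔤 :=
  {v | √(normSq 𝔪) • v ∈ symmetricSpace A}

/-- `ad(T)⁻¹`: the inverse of `ad(T)` on the range of `ad(T)`, where `ad(T)² = -1/dim 𝔪`, extended
by zero to the kernel of `ad(T)`. -/
def adInvT (𝔪 : Submodule ℝ 𝔤) (F : CurveFun 𝔤) : CurveFun 𝔤 := -(normSq 𝔪 • adCurve F)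

/-- `ℛ_T = ad(T)⁻¹ (Dₓ - dim 𝔪 · ad(Tₓ) (∇^𝔥ₓ)⁻¹ ad(Tₓ))`, with `∇^𝔥ₓ = (1 + dim 𝔪 · ad(T)²) Dₓ`. -/
def Rspin (𝔪 : Submodule ℝ 𝔤) (A : 𝔤) (F : CurveFun 𝔤) : CurveFun 𝔤 :=
  adInvT 𝔪 ((fun γ x => deriv (F γ) x) -
    normSq 𝔪 • adCurveX (Hinv (spinSpace 𝔪 A) (normSq 𝔪) (adCurveX F)))

/-- `f(x, t)` is smooth on `ℝ × I` with values in `N`. -/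
def IsSmoothField (N : Set 𝔤) (I : Set ℝ) (f : ℝ → ℝ → 𝔤) : Prop :=
  ContDiffOn ℝ ∞ (fun p : ℝ × ℝ => f p.1 p.2) (univ ×ˢ I) ∧ ∀ x, ∀ t ∈ I, f x t ∈ N

/-- `q` solves the `+m` isospectral flow `(1 / dim 𝔪) qₜ = ℛᵐ(Jq)` on `ℝ × I`. -/
def IsospectralFlow (𝔪 : Submodule ℝ 𝔤) (A : 𝔤) (m : ℕ) (I : Set ℝ) (q : ℝ → ℝ → 𝔤) : Prop :=
  IsSmoothField (𝔪 : Set 𝔤) I q ∧ ∀ x, ∀ t ∈ I,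
    (1 / normSq 𝔪) • deriv (fun s => q x s) t = ((Rop 𝔪 A)^[m] (Jq A)) (fun y => q y t) x

/-- `χ` solves the `+n` map equation `χₜ = ℛ_χⁿ(χₓ)` in `M` on `ℝ × I`. -/
def MapFlow (A : 𝔤) (n : ℕ) (I : Set ℝ) (χ : ℝ → ℝ → 𝔤) : Prop :=
  IsSmoothField (symmetricSpace A) I χ ∧ ∀ x, ∀ t ∈ I,
    deriv (fun s => χ x s) t = ((Rmap A)^[n] curveX) (fun y => χ y t) x

/-- `T` solves the `+k` spin model `Tₜ = ℛ_Tᵏ(Tₓ)`, `|T| = 1`, on `ℝ × I`. -/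
def SpinFlow (𝔪 : Submodule ℝ 𝔤) (A : 𝔤) (k : ℕ) (I : Set ℝ) (T : ℝ → ℝ → 𝔤) : Prop :=
  IsSmoothField (spinSpace 𝔪 A) I T ∧ (∀ x, ∀ t ∈ I, ‖T x t‖ = 1) ∧ ∀ x, ∀ t ∈ I,
    deriv (fun s => T x s) t = ((Rspin 𝔪 A)^[k] curveX) (fun y => T y t) x

/-- `ψ : ℝ × I → G` is a parallel frame for the map `χ = Ad(ψ)A`, with Hasimoto variable
`q = ψ⁻¹ ∂ₓψ ∈ 𝔪`. -/
structure IsParallelFrame (𝔪 : Submodule ℝ 𝔤) (A : 𝔤) (I : Set ℝ)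
    (ψ : ℝ → ℝ → (𝔤 ≃ₗ⁅ℝ⁆ 𝔤)) (χ q : ℝ → ℝ → 𝔤) : Prop where
  mem : ∀ x, ∀ t ∈ I, ψ x t ∈ adjointGroup 𝔤
  smooth : ∀ y : 𝔤, ContDiffOn ℝ ∞ (fun p : ℝ × ℝ => ψ p.1 p.2 y) (univ ×ˢ I)
  map_eq : ∀ x, ∀ t ∈ I, χ x t = ψ x t A
  q_mem : ∀ x, ∀ t ∈ I, q x t ∈ 𝔪
  deriv_eq : ∀ x, ∀ t ∈ I, ∀ y : 𝔤, deriv (fun s => ψ s t y) x = ψ x t ⁅q x t, y⁆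

/-- `g : I → K` is smooth, for a subgroup `K` of `Aut 𝔤`. -/
def IsSmoothPath (K : Subgroup (𝔤 ≃ₗ⁅ℝ⁆ 𝔤)) (I : Set ℝ) (g : ℝ → (𝔤 ≃ₗ⁅ℝ⁆ 𝔤)) : Prop :=
  (∀ t ∈ I, g t ∈ K) ∧ ∀ y : 𝔤, ContDiffOn ℝ ∞ (fun t => g t y) I

/-- Rescaling of time, `f(x, t) ↦ f(x, c t)`. -/
def timeScale (c : ℝ) (f : ℝ → ℝ → 𝔤) : ℝ → ℝ → 𝔤 := fun x t => f x (c * t)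

end Flows

end HermSym

open HermSym

/-! The formal series `S = ∑ₙ Sₙ λ⁻ⁿ` with `S₀ = A` that solves the Lax equation
`Sₓ + [q, S] = λ [A, S]` and satisfies the cubic identity `(ad S)³ = -ad S`, which the adjoint
action preserves, is local in `q`: the equation gives the part of `Sₙ₊₁` outside the centralizer
of `A` as a derivative of `Sₙ`, and the cubic identity gives the part in the centralizer
algebraically. The centralizer parts are the primitives `Dₓ⁻¹` in the recursion, so `ℛⁿ(Jq)` is
read off from `Sₙ₊₁`. A parallel frame `ψ` gauges the equation to `Sₓ = λ [χ, S]` with `S₀ = χ`,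
which generates the map equations in the same way, and scaling by `√(dim 𝔪)` turns these into
the spin models. With `p = ψ⁻¹ψₜ`, the `n`-th map equation says that `[A, p + Sₙ₊₁] = 0`. By the
zero curvature equation `qₜ = pₓ + [q, p]`, that is the `(n + 1)`-st isospectral flow up to a
bracket of `q` with a function of `t` in `𝔥`, which a time-dependent gauge transformation
removes and which is zero under decay. -/

namespace HermSym

section ContinuousPaths

variable {P F : Type*} [NormedAddCommGroup F]

/-- The path `s ↦ f (s, p)` over the unit interval, as an element of a Banach space of continuous
maps, with the junk value `0` if it is not continuous. Smooth dependence of the path on `p` is what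
makes the solutions of linear equations depend smoothly on parameters. -/
noncomputable def pathOf (f : ℝ × P → F) (p : P) : C(unitInterval, F) :=
  ContinuousMap.mkD (fun s : unitInterval => f (s, p)) 0

variable [NormedAddCommGroup P] {f : ℝ × P → F} {W : Set (ℝ × P)} {U : Set P}

lemma pathOf_apply (hf : ContinuousOn f W) (hW : ∀ p ∈ U, ∀ s : unitInterval, ((s : ℝ), p) ∈ W)
    {p : P} (hp : p ∈ U) (s : unitInterval) : pathOf f p s = f (s, p) :=
  ContinuousMap.mkD_apply_of_continuous (hf.comp_continuous (by fun_prop) fun s => hW p hp s)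

lemma continuousOn_pathOf (hf : ContinuousOn f W)
    (hW : ∀ p ∈ U, ∀ s : unitInterval, ((s : ℝ), p) ∈ W) : ContinuousOn (pathOf f) U := by
  rw [continuousOn_iff_continuous_domRestrict]
  let g : C(U × unitInterval, F) := ⟨fun z => f ((z.2 : ℝ), (z.1 : P)),
    hf.comp_continuous (by fun_prop) fun z => hW _ z.1.2 z.2⟩
  convert g.curry.continuous using 1
  ext p s
  exact pathOf_apply hf hW p.2 s

variable [NormedSpace ℝ P] [FiniteDimensional ℝ P] [NormedSpace ℝ F]

/-- A path of operators as an operator with values in paths: the shape in which the derivative of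
`pathOf f` appears. -/
noncomputable def pathFlip (g : C(unitInterval, P →L[ℝ] F)) : P →L[ℝ] C(unitInterval, F) :=
  LinearMap.toContinuousLinearMap
    { toFun := fun v => ⟨fun s => g s v, by fun_prop⟩
      map_add' := fun _ _ => by ext; simp
      map_smul' := fun _ _ => by ext; simp }

@[simp] lemma pathFlip_apply (g : C(unitInterval, P →L[ℝ] F)) (v : P) (s : unitInterval) :
    pathFlip g v s = g s v := rfl

lemma hasFDerivAt_pathOf (hU : IsOpen U) (hWo : IsOpen W) (hf : ContDiffOn ℝ 1 f W)
    (hW : ∀ p ∈ U, ∀ s : unitInterval, ((s : ℝ), p) ∈ W) {p : P} (hp : p ∈ U) :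
    HasFDerivAt (pathOf f)
      (pathFlip (pathOf (fun z => (fderiv ℝ f z).comp (.inr ℝ ℝ P)) p)) p := by
  set f' : ℝ × P → P →L[ℝ] F := fun z => (fderiv ℝ f z).comp (.inr ℝ ℝ P)
  have hf' : ContinuousOn f' W :=
    (hf.continuousOn_fderiv_of_isOpen hWo le_rfl).clm_comp continuousOn_const
  rw [hasFDerivAt_iff_isLittleO, Asymptotics.isLittleO_iff]
  intro ε hε
  have hclose := ((continuousOn_pathOf hf' hW).continuousAt (hU.mem_nhds hp)).eventually
    (Metric.closedBall_mem_nhds _ hε)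
  obtain ⟨δ, hδ, hball⟩ := Metric.mem_nhds_iff.1 (hclose.and (hU.mem_nhds hp))
  have hBU : ∀ x ∈ Metric.ball p δ, x ∈ U := fun x hx => (hball hx).2
  filter_upwards [Metric.ball_mem_nhds p hδ] with p' hp'
  rw [ContinuousMap.norm_le _ (by positivity)]
  intro s
  have hderiv : ∀ x ∈ Metric.ball p δ,
      HasFDerivWithinAt (fun x => f (s, x)) (f' (s, x)) (Metric.ball p δ) x := fun x hx =>
    (((hf.contDiffAt (hWo.mem_nhds (hW x (hBU x hx) s))).differentiableAt
      one_ne_zero).hasFDerivAt.comp x (hasFDerivAt_prodMk_right (s : ℝ) x)).hasFDerivWithinAt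
  have hbound : ∀ x ∈ Metric.ball p δ, ‖f' (s, x) - f' (s, p)‖ ≤ ε := by
    intro x hx
    have hle := (ContinuousMap.norm_coe_le_norm _ s).trans (mem_closedBall_iff_norm.1 (hball hx).1)
    rwa [ContinuousMap.sub_apply, pathOf_apply hf' hW (hBU x hx), pathOf_apply hf' hW hp] at hle
  have hmvt := (convex_ball p δ).norm_image_sub_le_of_norm_hasFDerivWithin_le' hderiv hbound
    (Metric.mem_ball_self hδ) hp'
  rwa [ContinuousMap.sub_apply, ContinuousMap.sub_apply, pathFlip_apply,
    pathOf_apply hf.continuousOn hW (hBU p' hp'), pathOf_apply hf.continuousOn hW hp,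
    pathOf_apply hf' hW hp]

lemma contDiffOn_pathOf (hU : IsOpen U) (hWo : IsOpen W)
    (hW : ∀ p ∈ U, ∀ s : unitInterval, ((s : ℝ), p) ∈ W) (hf : ContDiffOn ℝ ∞ f W) :
    ContDiffOn ℝ ∞ (pathOf f) U := by
  rw [contDiffOn_infty]
  intro n
  induction n generalizing f with
  | zero => exact contDiffOn_zero.2 (continuousOn_pathOf hf.continuousOn hW)
  | succ n ih =>
    have hderiv := fun p hp => hasFDerivAt_pathOf hU hWo (hf.of_le (by simp)) hW (p := p) hp
    have hf' : ContDiffOn ℝ ∞ (fderiv ℝ f) W := hf.fderiv_of_isOpen hWo le_rfl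
    push_cast
    rw [contDiffOn_succ_iff_fderiv_apply hU.uniqueDiffOn]
    refine ⟨fun p hp => (hderiv p hp).differentiableAt.differentiableWithinAt, by simp,
      fun v => (ih (hf'.clm_apply (contDiffOn_const (c := (0, v))))).congr fun p hp => ?_⟩
    rw [fderivWithin_of_isOpen hU hp, (hderiv p hp).fderiv]
    ext s
    rw [pathFlip_apply, pathOf_apply (hf'.clm_comp contDiffOn_const).continuousOn hW hp,
      pathOf_apply (hf'.clm_apply contDiffOn_const).continuousOn hW hp]
    rfl

end ContinuousPaths

section Volterra

open MeasureTheory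

variable {R : Type*} [NormedRing R]

lemma continuous_IccExtend_path (f : C(unitInterval, R)) :
    Continuous (IccExtend (zero_le_one' ℝ) f) := f.continuous.Icc_extend'

variable [NormedAlgebra ℝ R]

variable (R) in
/-- The Volterra operator `f ↦ (s ↦ ∫₀ˢ f)` on continuous paths; a path is extended by constants
beyond the unit interval to be integrated. -/
noncomputable def volterra : C(unitInterval, R) →L[ℝ] C(unitInterval, R) :=
  LinearMap.mkContinuous
    { toFun := fun f => ⟨fun s => ∫ r in (0 : ℝ)..s, IccExtend (zero_le_one' ℝ) f r,
        (intervalIntegral.continuous_primitive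
          (fun a b => (continuous_IccExtend_path f).intervalIntegrable a b) 0).comp
          continuous_subtype_val⟩
      map_add' := fun f g => by
        ext s
        exact intervalIntegral.integral_add
          ((continuous_IccExtend_path f).intervalIntegrable _ _)
          ((continuous_IccExtend_path g).intervalIntegrable _ _)
      map_smul' := fun c f => by
        ext s
        exact intervalIntegral.integral_smul (μ := volume) c
          (IccExtend (zero_le_one' ℝ) f) } 1
    (fun f => by
      rw [one_mul, ContinuousMap.norm_le _ (norm_nonneg _)]
      intro s
      refine (intervalIntegral.norm_integral_le_of_norm_le_const (C := ‖f‖)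
        fun r _ => f.norm_coe_le_norm _).trans ?_
      rw [sub_zero, abs_of_nonneg s.2.1]
      exact mul_le_of_le_one_right (norm_nonneg _) s.2.2)

/-- The operator `y ↦ (s ↦ ∫₀ˢ α y)`, whose fixed points up to an initial value are the solutions of
`y' = α y`. -/
noncomputable def volterraMul (α : C(unitInterval, R)) :
    C(unitInterval, R) →L[ℝ] C(unitInterval, R) :=
  (volterra R).comp (ContinuousLinearMap.mul ℝ C(unitInterval, R) α)

lemma volterraMul_apply (α f : C(unitInterval, R)) (s : unitInterval) :
    volterraMul α f s = ∫ r in (0 : ℝ)..s, IccExtend (zero_le_one' ℝ) (α * f) r := rfl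

lemma norm_volterraMul_pow_apply_le (α f : C(unitInterval, R)) (n : ℕ) (s : unitInterval) :
    ‖(volterraMul α ^ n) f s‖ ≤ ‖α‖ ^ n * (s : ℝ) ^ n / n.factorial * ‖f‖ := by
  induction n generalizing s with
  | zero => simpa using f.norm_coe_le_norm s
  | succ n ih =>
    rw [pow_succ', mul_apply_eq_comp, volterraMul_apply]
    refine (intervalIntegral.norm_integral_le_of_norm_le s.2.1
      (g := fun r => ‖α‖ ^ (n + 1) / n.factorial * ‖f‖ * r ^ n) (ae_of_all _ fun r hr => ?_)
      (by apply Continuous.intervalIntegrable; fun_prop)).trans (le_of_eq ?_)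
    · have hr' : r ∈ Icc (0 : ℝ) 1 := ⟨hr.1.le, hr.2.trans s.2.2⟩
      rw [IccExtend_of_mem _ _ hr', ContinuousMap.mul_apply]
      refine (norm_mul_le _ _).trans ((mul_le_mul (α.norm_coe_le_norm _) (ih ⟨r, hr'⟩)
        (norm_nonneg _) (norm_nonneg _)).trans (le_of_eq ?_))
      ring
    · rw [intervalIntegral.integral_const_mul, integral_pow, Nat.factorial_succ]
      push_cast
      field_simp
      ring

lemma exists_norm_volterraMul_pow_lt_one (α : C(unitInterval, R)) :
    ∃ n : ℕ, ‖volterraMul α ^ n‖ < 1 := by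
  obtain ⟨n, hn⟩ := ((FloorSemiring.tendsto_pow_div_factorial_atTop ‖α‖).eventually
    (gt_mem_nhds (zero_lt_one' ℝ))).exists
  refine ⟨n, lt_of_le_of_lt (ContinuousLinearMap.opNorm_le_bound _ (by positivity)
    (M := ‖α‖ ^ n / n.factorial) fun f => ?_) hn⟩
  rw [ContinuousMap.norm_le _ (by positivity)]
  intro s
  refine (norm_volterraMul_pow_apply_le α f n s).trans ?_
  gcongr
  exact mul_le_of_le_one_right (by positivity) (pow_le_one₀ s.2.1 s.2.2)

variable [CompleteSpace R]

lemma isUnit_one_sub_volterraMul (α : C(unitInterval, R)) : IsUnit (1 - volterraMul α) := by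
  obtain ⟨n, hn⟩ := exists_norm_volterraMul_pow_lt_one α
  have hpow : IsUnit (1 - volterraMul α ^ n) :=
    isUnit_one_sub_of_norm_lt_one (R := C(unitInterval, R) →L[ℝ] C(unitInterval, R)) hn
  have hfactor : IsUnit ((1 - volterraMul α) * ∑ i ∈ Finset.range n, volterraMul α ^ i) :=
    (mul_neg_geom_sum (volterraMul α) n).symm ▸ hpow
  have hcomm : Commute (1 - volterraMul α) (∑ i ∈ Finset.range n, volterraMul α ^ i) :=
    (mul_neg_geom_sum (volterraMul α) n).trans (geom_sum_mul_neg (volterraMul α) n).symm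
  exact (hcomm.isUnit_mul_iff.1 hfactor).1

/-- The solution of `y' = α y`, `y 0 = 1` over the unit interval (the path-ordered exponential of
`α`), obtained by inverting `1 - volterraMul α`. -/
noncomputable def pathExp (α : C(unitInterval, R)) : C(unitInterval, R) :=
  Ring.inverse (1 - volterraMul α) 1

lemma contDiff_pathExp : ContDiff ℝ ∞ (pathExp (R := R)) := by
  have hlin : ContDiff ℝ ∞ (fun α : C(unitInterval, R) => 1 - volterraMul α) := by
    unfold volterraMul
    fun_prop
  have hinv : ContDiff ℝ ∞ (fun α : C(unitInterval, R) => Ring.inverse (1 - volterraMul α)) := by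
    rw [contDiff_iff_contDiffAt]
    intro α
    have hα := contDiffAt_ringInverse ℝ (n := ∞) (R := C(unitInterval, R) →L[ℝ] C(unitInterval, R))
      (isUnit_one_sub_volterraMul α).unit
    exact hα.comp α hlin.contDiffAt
  exact hinv.clm_apply contDiff_const

lemma eq_pathExp_iff (α y : C(unitInterval, R)) :
    y = pathExp α ↔ y = 1 + volterraMul α y := by
  obtain ⟨u, hu⟩ := isUnit_one_sub_volterraMul α
  have hsub : y - volterraMul α y = (u : _ →L[ℝ] _) y := by rw [hu]; rfl
  rw [pathExp, ← hu, Ring.inverse_unit, ← sub_eq_iff_eq_add, hsub]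
  constructor
  · rintro rfl
    rw [← mul_apply_eq_comp, u.mul_inv, one_apply_eq_self]
  · intro h
    rw [← h, ← mul_apply_eq_comp, u.inv_mul, one_apply_eq_self]

lemma pathExp_apply (α : C(unitInterval, R)) (s : unitInterval) :
    pathExp α s = 1 + ∫ r in (0 : ℝ)..s, IccExtend (zero_le_one' ℝ) (α * pathExp α) r :=
  DFunLike.congr_fun ((eq_pathExp_iff α _).1 rfl) s

lemma pathExp_zero : pathExp (0 : C(unitInterval, R)) = 1 :=
  ((eq_pathExp_iff 0 1).2 (by simp [volterraMul])).symm

lemma pathExp_eq_pathExp_mul {α β : C(unitInterval, R)} {c : unitInterval}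
    (h : ∀ s : unitInterval, β s = (c : ℝ) • α (c * s)) (s : unitInterval) :
    pathExp β s = pathExp α (c * s) := by
  let z : C(unitInterval, R) := ⟨fun s => pathExp α (c * s), by fun_prop⟩
  suffices z = pathExp β from (DFunLike.congr_fun this s).symm
  rw [eq_pathExp_iff]
  ext s
  change pathExp α (c * s) = 1 + volterraMul β z s
  rw [pathExp_apply, volterraMul_apply]
  congr 1
  have hsubst := intervalIntegral.smul_integral_comp_mul_left (a := 0) (b := s)
    (IccExtend (zero_le_one' ℝ) (α * pathExp α)) (c : ℝ)
  rw [mul_zero] at hsubst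
  rw [Icc.coe_mul, ← hsubst, ← intervalIntegral.integral_smul]
  refine intervalIntegral.integral_congr fun r hr => ?_
  rw [uIcc_of_le s.2.1] at hr
  have hr' : r ∈ Icc (0 : ℝ) 1 := ⟨hr.1, hr.2.trans s.2.2⟩
  have hcr : (c : ℝ) * r ∈ Icc (0 : ℝ) 1 := (c * ⟨r, hr'⟩ : unitInterval).2
  rw [IccExtend_of_mem _ _ hr', IccExtend_of_mem _ _ hcr, ContinuousMap.mul_apply,
    ContinuousMap.mul_apply, h, smul_mul_assoc]
  rfl

end Volterra

section LinearODE

open MeasureTheory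

variable {R : Type*} [NormedRing R] [NormedAlgebra ℝ R]
  {T : Type*}

/-- The coefficient `a` along the ray from `(x₀, t)` to `p = (x, t)`, scaled so that `uₓ = a u`
becomes an equation over the unit interval. -/
noncomputable def rayPath (x₀ : ℝ) (a : ℝ × T → R) : ℝ × T → C(unitInterval, R) :=
  pathOf fun z : ℝ × (ℝ × T) => (z.2.1 - x₀) • a (x₀ + z.1 * (z.2.1 - x₀), z.2.2)

/-- The solution `u` of `uₓ = a u`, `u (x₀, t) = 1`, with `t` a parameter. -/
noncomputable def fundamentalSolution (x₀ : ℝ) (a : ℝ × T → R) (p : ℝ × T) : R :=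
  pathExp (rayPath x₀ a p) 1

lemma ray_mem {x₀ : ℝ} {U : Set (ℝ × T)} (hU : ∀ t, StarConvex ℝ x₀ {x | (x, t) ∈ U}) {p : ℝ × T}
    (hp : p ∈ U) (s : unitInterval) : (x₀ + s * (p.1 - x₀), p.2) ∈ U :=
  (hU p.2).add_smul_sub_mem (y := p.1) hp s.2.1 s.2.2

lemma fundamentalSolution_base [CompleteSpace R] (x₀ : ℝ) (a : ℝ × T → R) (t : T) :
    fundamentalSolution x₀ a (x₀, t) = 1 := by
  have hzero : rayPath x₀ a (x₀, t) = 0 := by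
    ext s
    simp [rayPath, pathOf, ContinuousMap.mkD_apply_of_continuous continuous_const]
  rw [fundamentalSolution, hzero, pathExp_zero, ContinuousMap.one_apply]

variable [NormedAddCommGroup T]

lemma rayPath_apply {x₀ : ℝ} {U : Set (ℝ × T)} (hU : ∀ t, StarConvex ℝ x₀ {x | (x, t) ∈ U})
    {a : ℝ × T → R} (ha : ContinuousOn a U) {p : ℝ × T} (hp : p ∈ U) (s : unitInterval) :
    rayPath x₀ a p s = (p.1 - x₀) • a (x₀ + s * (p.1 - x₀), p.2) := by
  refine pathOf_apply (W := (fun z : ℝ × (ℝ × T) => (x₀ + z.1 * (z.2.1 - x₀), z.2.2)) ⁻¹' U)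
    ?_ (fun p hp s => ray_mem hU hp s) hp s
  exact (by fun_prop : Continuous fun z : ℝ × (ℝ × T) => z.2.1 - x₀).continuousOn.smul
    (ha.comp (by fun_prop) fun _ h => h)

variable [CompleteSpace R] {x₀ : ℝ} {a : ℝ × T → R} {U : Set (ℝ × T)}

lemma pathExp_rayPath (hU : ∀ t, StarConvex ℝ x₀ {x | (x, t) ∈ U}) (ha : ContinuousOn a U)
    {p : ℝ × T} (hp : p ∈ U) (s : unitInterval) :
    pathExp (rayPath x₀ a p) s = fundamentalSolution x₀ a (x₀ + s * (p.1 - x₀), p.2) := by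
  rw [fundamentalSolution, pathExp_eq_pathExp_mul (α := rayPath x₀ a p) (c := s) _ 1, mul_one]
  intro r
  rw [rayPath_apply hU ha (ray_mem hU hp s), rayPath_apply hU ha hp, smul_smul, Icc.coe_mul]
  congr 3 <;> ring

lemma fundamentalSolution_eq_integral (hU : ∀ t, StarConvex ℝ x₀ {x | (x, t) ∈ U})
    (ha : ContinuousOn a U) {x : ℝ} {t : T} (hp : (x, t) ∈ U) :
    fundamentalSolution x₀ a (x, t) =
      1 + ∫ r in x₀..x, a (r, t) * fundamentalSolution x₀ a (r, t) := by
  rw [fundamentalSolution, pathExp_apply]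
  congr 1
  have hsubst := intervalIntegral.smul_integral_comp_add_mul (a := 0) (b := 1)
    (fun r => a (r, t) * fundamentalSolution x₀ a (r, t)) (x - x₀) x₀
  rw [mul_zero, add_zero, mul_one, add_sub_cancel] at hsubst
  rw [← hsubst, ← intervalIntegral.integral_smul]
  refine intervalIntegral.integral_congr fun r hr => ?_
  rw [Icc.coe_one, uIcc_of_le zero_le_one] at hr
  rw [IccExtend_of_mem _ _ hr, ContinuousMap.mul_apply, rayPath_apply hU ha hp,
    pathExp_rayPath hU ha hp, smul_mul_assoc]
  simp only [mul_comm r]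

variable [NormedSpace ℝ T] [FiniteDimensional ℝ T]

lemma contDiffOn_fundamentalSolution (hUo : IsOpen U)
    (hU : ∀ t, StarConvex ℝ x₀ {x | (x, t) ∈ U}) (ha : ContDiffOn ℝ ∞ a U) :
    ContDiffOn ℝ ∞ (fundamentalSolution x₀ a) U := by
  let ray : ℝ × (ℝ × T) → ℝ × T := fun z => (x₀ + z.1 * (z.2.1 - x₀), z.2.2)
  have hray : ContDiff ℝ ∞ ray := by fun_prop
  have hspeed : ContDiff ℝ ∞ (fun z : ℝ × (ℝ × T) => z.2.1 - x₀) := by fun_prop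
  have hpath : ContDiffOn ℝ ∞ (rayPath x₀ a) U :=
    contDiffOn_pathOf hUo (hUo.preimage hray.continuous) (fun p hp s => ray_mem hU hp s)
      (hspeed.contDiffOn.smul (ha.comp hray.contDiffOn fun _ h => h))
  exact (ContinuousMap.evalCLM ℝ (1 : unitInterval)).contDiff.comp_contDiffOn
    (contDiff_pathExp.comp_contDiffOn hpath)

lemma hasDerivAt_fundamentalSolution (hUo : IsOpen U)
    (hU : ∀ t, StarConvex ℝ x₀ {x | (x, t) ∈ U}) (ha : ContDiffOn ℝ ∞ a U) {x : ℝ} {t : T}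
    (hp : (x, t) ∈ U) : HasDerivAt (fun y => fundamentalSolution x₀ a (y, t))
      (a (x, t) * fundamentalSolution x₀ a (x, t)) x := by
  have hV : IsOpen {y : ℝ | (y, t) ∈ U} := hUo.preimage (by fun_prop)
  have hcont : ContinuousOn (fun y => a (y, t) * fundamentalSolution x₀ a (y, t))
      {y | (y, t) ∈ U} :=
    (ha.continuousOn.mul (contDiffOn_fundamentalSolution hUo hU ha).continuousOn).comp
      (f := fun y : ℝ => (y, t)) (by fun_prop) fun _ h => h
  have hsub : uIcc x₀ x ⊆ {y : ℝ | (y, t) ∈ U} := by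
    rw [← segment_eq_uIcc]
    exact (hU t).segment_subset hp
  refine ((intervalIntegral.integral_hasDerivAt_right (hcont.mono hsub).intervalIntegrable
    (hcont.stronglyMeasurableAtFilter hV x hp)
    (hcont.continuousAt (hV.mem_nhds hp))).const_add 1).congr_of_eventuallyEq ?_
  filter_upwards [hV.mem_nhds hp] with y hy using
    fundamentalSolution_eq_integral hU ha.continuousOn hy

end LinearODE

section CubicRing

variable {R : Type*} [Ring R]

/-- The polynomial `ℓ³ + ℓ`, whose roots among the operators `ad(B)` are those that define a complex
structure on a complement of the centralizer of `B`. -/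
def cubic (ℓ : R) : R := ℓ * ℓ * ℓ + ℓ

/-- The derivative of `cubic` at `ℓ` in the direction `N`. -/
def cubicDeriv (ℓ N : R) : R := N * ℓ * ℓ + ℓ * N * ℓ + ℓ * ℓ * N + N

lemma cubicDeriv_zero (ℓ : R) : cubicDeriv ℓ 0 = 0 := by simp [cubicDeriv]

lemma cubicDeriv_add (ℓ M N : R) : cubicDeriv ℓ (M + N) = cubicDeriv ℓ M + cubicDeriv ℓ N := by
  unfold cubicDeriv; noncomm_ring

lemma cubicDeriv_mul_of_forall_commute {z : R} (hz : ∀ a, Commute z a) (ℓ N : R) :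
    cubicDeriv ℓ (z * N) = z * cubicDeriv ℓ N := by
  simp only [cubicDeriv, mul_add, mul_assoc]
  rw [← (hz ℓ).left_comm, ← (hz ℓ).left_comm, ← (hz ℓ).left_comm]

lemma cubicDeriv_lie (ℓ Z : R) : cubicDeriv ℓ ⁅Z, ℓ⁆ = ⁅Z, cubic ℓ⁆ := by
  simp only [cubicDeriv, cubic, Ring.lie_def]; noncomm_ring

lemma cubicDeriv_self_lie (ℓ Z : R) : cubicDeriv ℓ ⁅ℓ, Z⁆ = ⁅cubic ℓ, Z⁆ := by
  simp only [cubicDeriv, cubic, Ring.lie_def]; noncomm_ring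

lemma lie_lie_of_commute {ℓ C : R} (h : Commute ℓ C) (Z : R) : ⁅⁅ℓ, Z⁆, C⁆ = ⁅ℓ, ⁅Z, C⁆⁆ := by
  have hleft : ℓ * (C * Z) = C * (ℓ * Z) := h.left_comm Z
  have hright : Z * C * ℓ = Z * ℓ * C := by rw [mul_assoc, ← h.eq, mul_assoc]
  simp only [Ring.lie_def, mul_sub, sub_mul]
  rw [hleft, hright]
  noncomm_ring

lemma cubic_add (ℓ N : R) : cubic (ℓ + N) =
    cubic ℓ + cubicDeriv ℓ N + (N * N * ℓ + N * ℓ * N + ℓ * N * N + N * N * N) := by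
  unfold cubicDeriv cubic; noncomm_ring

lemma map_cubic {S : Type*} [Ring S] (f : R →+* S) (ℓ : R) : f (cubic ℓ) = cubic (f ℓ) := by
  simp [cubic]

lemma map_cubicDeriv {S : Type*} [Ring S] (f : R →+* S) (ℓ N : R) :
    f (cubicDeriv ℓ N) = cubicDeriv (f ℓ) (f N) := by
  simp [cubicDeriv]

variable [Algebra ℝ R]

/-- The factor that inverts `cubicDeriv ℓ` on the commutant of a root `ℓ` of `cubic`: there
`cubicDeriv ℓ` is multiplication by `1 + 3ℓ²`, whose inverse is `1 + (3/2)ℓ²` because `ℓ⁴ = -ℓ²`. -/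
noncomputable def cubicWeight (ℓ : R) : R := 1 + (3 / 2 : ℝ) • (ℓ * ℓ)

lemma commute_cubicWeight (ℓ : R) : Commute ℓ (cubicWeight ℓ) := by
  simp [commute_iff_eq, cubicWeight, mul_add, add_mul, mul_assoc]

lemma cubicWeight_mul_lie (ℓ Y : R) : cubicWeight ℓ * ⁅ℓ, Y⁆ = ⁅ℓ, cubicWeight ℓ * Y⁆ := by
  rw [Ring.lie_def, Ring.lie_def, mul_sub, ← mul_assoc, ← mul_assoc, ← mul_assoc,
    (commute_cubicWeight ℓ).eq]

lemma map_cubicWeight {S : Type*} [Ring S] [Algebra ℝ S] (f : R →ₐ[ℝ] S) (ℓ : R) :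
    f (cubicWeight ℓ) = cubicWeight (f ℓ) := by
  simp [cubicWeight]

lemma cubicWeight_mul_cubicDeriv {ℓ : R} (hℓ : cubic ℓ = 0) {N : R} (hN : Commute ℓ N) :
    cubicWeight ℓ * cubicDeriv ℓ N = N := by
  have hcube : ℓ * ℓ * ℓ = -ℓ := eq_neg_of_add_eq_zero_left hℓ
  have hderiv : cubicDeriv ℓ N = (3 : ℝ) • (ℓ * ℓ * N) + N := by
    have hmid : ℓ * N * ℓ = ℓ * ℓ * N := by rw [mul_assoc, ← hN.eq, mul_assoc]
    rw [cubicDeriv, ← hN.eq, hmid]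
    module
  have hquartic : ℓ * ℓ * (ℓ * ℓ * N) = -(ℓ * ℓ * N) := by
    rw [show ℓ * ℓ * (ℓ * ℓ * N) = ℓ * ℓ * ℓ * (ℓ * N) by noncomm_ring, hcube]
    noncomm_ring
  rw [hderiv, cubicWeight, add_mul, one_mul, smul_mul_assoc, mul_add, mul_smul_comm, hquartic]
  module

lemma lie_eq_zero_of_lie_lie_eq_zero {ℓ : R} (hℓ : cubic ℓ = 0) {Z : R} (hZ : ⁅ℓ, ⁅ℓ, Z⁆⁆ = 0) :
    ⁅ℓ, Z⁆ = 0 := by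
  have hderiv : cubicDeriv ℓ ⁅ℓ, Z⁆ = 0 := by
    rw [cubicDeriv_self_lie, hℓ, Ring.lie_def, zero_mul, mul_zero, sub_zero]
  rw [← cubicWeight_mul_cubicDeriv hℓ (commute_iff_lie_eq.2 hZ), hderiv, mul_zero]

end CubicRing

section Series

open PowerSeries

variable {R : Type*} [Ring R] {n : ℕ} {E : PowerSeries R}

lemma coeff_X_pow_mul_self (n : ℕ) (E : PowerSeries R) :
    coeff n (X ^ n * E) = constantCoeff E := by
  simpa using coeff_X_pow_mul E n 0

lemma coeff_cubicDeriv_of_X_pow_dvd (hE : X ^ n ∣ E) (S : PowerSeries R) :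
    coeff n (cubicDeriv S E) = cubicDeriv (constantCoeff S) (coeff n E) := by
  obtain ⟨E, rfl⟩ := hE
  rw [cubicDeriv_mul_of_forall_commute fun a => (commute_X_pow a n).symm, coeff_X_pow_mul_self,
    coeff_X_pow_mul_self, map_cubicDeriv]

lemma coeff_cubic_add_of_X_pow_dvd (hn : n ≠ 0) (hE : X ^ n ∣ E) (S : PowerSeries R) :
    coeff n (cubic (S + E)) = coeff n (cubic S) + cubicDeriv (constantCoeff S) (coeff n E) := by
  rw [cubic_add, map_add, map_add, coeff_cubicDeriv_of_X_pow_dvd hE, add_eq_left]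
  obtain ⟨E, rfl⟩ := hE
  have hS : S * X ^ n = X ^ n * S := (commute_X_pow S n).eq
  have hquadratic : X ^ n * E * (X ^ n * E) * S + X ^ n * E * S * (X ^ n * E) +
      S * (X ^ n * E) * (X ^ n * E) + X ^ n * E * (X ^ n * E) * (X ^ n * E) =
      X ^ n * (E * (X ^ n * E) * S + E * S * (X ^ n * E) + S * E * (X ^ n * E) +
        E * (X ^ n * E) * (X ^ n * E)) := by
    rw [← mul_assoc S, hS]
    noncomm_ring
  rw [hquadratic, coeff_X_pow_mul_self]
  simp [hn]

/-- If `S' + [Q, S] = λ[ℓ, S] + E` for a series `S` in `X = λ⁻¹`, then `(S³ + S)' + [Q, S³ + S]`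
is `λ[ℓ, S³ + S]` up to the derivative of `S³ + S` in the direction `E`. -/
lemma coeff_cubicDeriv_of_lax {S S' E : PowerSeries R} {Q ℓ : R}
    (h : X * (S' + ⁅C Q, S⁆) = ⁅C ℓ, S⁆ + X * E) (n : ℕ) :
    coeff n (cubicDeriv S S') + ⁅Q, coeff n (cubic S)⁆ =
      ⁅ℓ, coeff (n + 1) (cubic S)⁆ + coeff n (cubicDeriv S E) := by
  have hX : ∀ N : PowerSeries R, cubicDeriv S (X * N) = X * cubicDeriv S N :=
    cubicDeriv_mul_of_forall_commute (fun a => (commute_X a).symm) S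
  have hcubic := congrArg (cubicDeriv S) h
  rw [hX, cubicDeriv_add, cubicDeriv_add, hX, cubicDeriv_lie, cubicDeriv_lie] at hcubic
  have hcoeff := congrArg (coeff (n + 1)) hcubic
  rw [map_add, coeff_succ_X_mul, coeff_succ_X_mul] at hcoeff
  simpa [Ring.lie_def] using hcoeff

end Series

section Killing

open scoped RealInnerProductSpace

variable {𝔤 : Type*} [LieRing 𝔤] [LieAlgebra ℝ 𝔤] [IsCompactType 𝔤]

lemma inner_eq_neg_killingForm (x y : 𝔤) : ⟪x, y⟫ = -killingForm ℝ 𝔤 x y := rfl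

lemma inner_lie_left (x y z : 𝔤) : ⟪⁅x, y⁆, z⟫ = -⟪y, ⁅x, z⁆⟫ := by
  rw [inner_eq_neg_killingForm, inner_eq_neg_killingForm, ← lie_skew x y, map_neg,
    LinearMap.neg_apply, LieModule.traceForm_apply_lie_apply]

lemma inner_lieEquiv (φ : 𝔤 ≃ₗ⁅ℝ⁆ 𝔤) (x y : 𝔤) : ⟪φ x, φ y⟫ = ⟪x, y⟫ := by
  rw [inner_eq_neg_killingForm, inner_eq_neg_killingForm, LieAlgebra.killingForm_of_equiv_apply]

variable [FiniteDimensional ℝ 𝔤]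

/-- The adjoint representation as a continuous bilinear map, so that smoothness and derivatives of
`ad` along curves come from the calculus of continuous linear maps. -/
noncomputable def adCLM : 𝔤 →L[ℝ] 𝔤 →L[ℝ] 𝔤 :=
  LinearMap.toContinuousLinearMap
    ((LinearMap.toContinuousLinearMap : (𝔤 →ₗ[ℝ] 𝔤) ≃ₗ[ℝ] (𝔤 →L[ℝ] 𝔤)).toLinearMap ∘ₗ
      (LieAlgebra.ad ℝ 𝔤 : 𝔤 →ₗ[ℝ] Module.End ℝ 𝔤))

@[simp] lemma adCLM_apply (x y : 𝔤) : adCLM x y = ⁅x, y⁆ := rfl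

lemma adCLM_lie (x y : 𝔤) : adCLM ⁅x, y⁆ = ⁅adCLM x, adCLM y⁆ := by
  ext z
  simp [Ring.lie_def]

lemma cubic_adCLM_eq_zero {B : 𝔤} (hB : ∀ y : 𝔤, ⁅B, ⁅B, ⁅B, y⁆⁆⁆ = -⁅B, y⁆) :
    cubic (adCLM B) = 0 := by
  ext y
  exact (congrArg (· + ⁅B, y⁆) (hB y)).trans (neg_add_cancel _)

/-- A Lie algebra automorphism as a continuous linear map. -/
noncomputable def autCLM (φ : 𝔤 ≃ₗ⁅ℝ⁆ 𝔤) : 𝔤 →L[ℝ] 𝔤 :=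
  LinearMap.toContinuousLinearMap ((φ : 𝔤 →ₗ⁅ℝ⁆ 𝔤) : 𝔤 →ₗ[ℝ] 𝔤)

@[simp] lemma autCLM_apply (φ : 𝔤 ≃ₗ⁅ℝ⁆ 𝔤) (y : 𝔤) : autCLM φ y = φ y := rfl

/-- Conjugation of endomorphisms by an automorphism. -/
noncomputable def conjCLM (φ : 𝔤 ≃ₗ⁅ℝ⁆ 𝔤) : (𝔤 →L[ℝ] 𝔤) →ₐ[ℝ] (𝔤 →L[ℝ] 𝔤) where
  toFun C := autCLM φ * C * autCLM φ.symm
  map_one' := by ext; simp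
  map_mul' C D := by ext; simp
  map_zero' := by simp
  map_add' C D := by noncomm_ring
  commutes' r := by ext; simp

@[simp] lemma conjCLM_apply (φ : 𝔤 ≃ₗ⁅ℝ⁆ 𝔤) (C : 𝔤 →L[ℝ] 𝔤) (y : 𝔤) :
    conjCLM φ C y = φ (C (φ.symm y)) := rfl

lemma conjCLM_adCLM (φ : 𝔤 ≃ₗ⁅ℝ⁆ 𝔤) (x : 𝔤) : conjCLM φ (adCLM x) = adCLM (φ x) := by
  ext y
  rw [conjCLM_apply, adCLM_apply, adCLM_apply, LieEquiv.map_lie, LieEquiv.apply_symm_apply]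

/-- The trace of a continuous endomorphism. -/
noncomputable def traceCLM : (𝔤 →L[ℝ] 𝔤) →L[ℝ] ℝ :=
  LinearMap.toContinuousLinearMap (LinearMap.trace ℝ 𝔤 ∘ₗ
    (LinearMap.toContinuousLinearMap : (𝔤 →ₗ[ℝ] 𝔤) ≃ₗ[ℝ] _).symm.toLinearMap)

lemma traceCLM_mul_comm (C D : 𝔤 →L[ℝ] 𝔤) : traceCLM (C * D) = traceCLM (D * C) :=
  LinearMap.trace_mul_comm ℝ (C : 𝔤 →ₗ[ℝ] 𝔤) (D : 𝔤 →ₗ[ℝ] 𝔤)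

lemma inner_eq_neg_traceCLM (x y : 𝔤) : ⟪x, y⟫ = -traceCLM (adCLM x * adCLM y) := rfl

/-- The adjoint of `ad` for the inner product `-Kill` on `𝔤` and the form `-tr(C D)` on
endomorphisms. It is a left inverse of `ad`, since `ad` is isometric for these forms. -/
noncomputable def adAdjoint : (𝔤 →L[ℝ] 𝔤) →L[ℝ] 𝔤 :=
  ∑ i, ((-traceCLM) ∘L ((ContinuousLinearMap.mul ℝ (𝔤 →L[ℝ] 𝔤)).flip
    (adCLM (stdOrthonormalBasis ℝ 𝔤 i)))).smulRight (stdOrthonormalBasis ℝ 𝔤 i)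

lemma inner_adAdjoint (C : 𝔤 →L[ℝ] 𝔤) (y : 𝔤) : ⟪adAdjoint C, y⟫ = -traceCLM (C * adCLM y) := by
  conv_rhs => rw [← (stdOrthonormalBasis ℝ 𝔤).sum_repr' y]
  simp [adAdjoint, sum_inner, inner_smul_left, Finset.mul_sum, mul_comm]

lemma adAdjoint_adCLM (x : 𝔤) : adAdjoint (adCLM x) = x :=
  ext_inner_right ℝ fun y => by rw [inner_adAdjoint, inner_eq_neg_traceCLM]

lemma adCLM_injective : Function.Injective (adCLM : 𝔤 → 𝔤 →L[ℝ] 𝔤) :=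
  Function.LeftInverse.injective adAdjoint_adCLM

lemma lie_adAdjoint (x : 𝔤) (C : 𝔤 →L[ℝ] 𝔤) : ⁅x, adAdjoint C⁆ = adAdjoint ⁅adCLM x, C⁆ := by
  refine ext_inner_right ℝ fun y => ?_
  rw [inner_lie_left, inner_adAdjoint, inner_adAdjoint, adCLM_lie, Ring.lie_def, Ring.lie_def,
    mul_sub, sub_mul, map_sub, map_sub, mul_assoc (adCLM x), traceCLM_mul_comm (adCLM x),
    mul_assoc C, mul_assoc C]
  ring

lemma traceCLM_conjCLM (φ : 𝔤 ≃ₗ⁅ℝ⁆ 𝔤) (C : 𝔤 →L[ℝ] 𝔤) :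
    traceCLM (conjCLM φ C) = traceCLM C := by
  have hφ : autCLM φ.symm * autCLM φ = 1 := by ext; simp
  change traceCLM (autCLM φ * C * autCLM φ.symm) = _
  rw [traceCLM_mul_comm, ← mul_assoc, hφ, one_mul]

lemma adAdjoint_conjCLM (φ : 𝔤 ≃ₗ⁅ℝ⁆ 𝔤) (C : 𝔤 →L[ℝ] 𝔤) :
    adAdjoint (conjCLM φ C) = φ (adAdjoint C) := by
  refine ext_inner_right ℝ fun y => ?_
  rw [← φ.apply_symm_apply y, inner_lieEquiv, inner_adAdjoint, inner_adAdjoint, ← conjCLM_adCLM,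
    ← map_mul, traceCLM_conjCLM]

end Killing

section Jets

variable {𝔤 : Type*} [LieRing 𝔤] [LieAlgebra ℝ 𝔤] [IsCompactType 𝔤]
  {E : Type*} [NormedAddCommGroup E] [NormedSpace ℝ E]
  {E' : Type*} [NormedAddCommGroup E'] [NormedSpace ℝ E']
  {E'' : Type*} [NormedAddCommGroup E''] [NormedSpace ℝ E'']
  {N : Set 𝔤} {F : (ℝ → 𝔤) → ℝ → E} {F' : (ℝ → 𝔤) → ℝ → E'} {γ : ℝ → 𝔤}

/-- `F(γ)(x)` is a smooth function of finitely many derivatives of `γ` at `x`, for smooth curves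
in `N`. -/
def IsJet (N : Set 𝔤) (F : (ℝ → 𝔤) → ℝ → E) : Prop :=
  ∃ k : ℕ, ∃ f : (Fin k → 𝔤) → E, ContDiff ℝ ∞ f ∧
    ∀ γ ∈ smoothCurves N, ∀ x, F γ x = f (fun i => iteratedDeriv i γ x)

lemma IsJet.congr {F₁ F₂ : (ℝ → 𝔤) → ℝ → E} (hF₁ : IsJet N F₁)
    (hF : ∀ γ ∈ smoothCurves N, ∀ x, F₂ γ x = F₁ γ x) : IsJet N F₂ := by
  obtain ⟨k, f, hf, hFf⟩ := hF₁
  exact ⟨k, f, hf, fun γ hγ x => (hF γ hγ x).trans (hFf γ hγ x)⟩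

lemma IsJet.comp₂ {g : E → E' → E''} (hg : ContDiff ℝ ∞ (fun z : E × E' => g z.1 z.2))
    (hF : IsJet N F) (hF' : IsJet N F') : IsJet N (fun γ x => g (F γ x) (F' γ x)) := by
  obtain ⟨k, f, hf, hFf⟩ := hF
  obtain ⟨k', f', hf', hFf'⟩ := hF'
  refine ⟨max k k', fun v => g (f fun i => v (i.castLE (le_max_left _ _)))
    (f' fun i => v (i.castLE (le_max_right _ _))), ?_, fun γ hγ x => ?_⟩
  · exact hg.comp ((hf.comp (by fun_prop)).prodMk (hf'.comp (by fun_prop)))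
  · simp [hFf γ hγ x, hFf' γ hγ x]

lemma isJet_const (c : E) : IsJet N (fun _ _ => c) :=
  ⟨0, fun _ => c, contDiff_const, fun _ _ _ => rfl⟩

lemma isJet_self : IsJet N (fun γ x => γ x) :=
  ⟨1, fun v => v 0, by fun_prop, fun γ _ x => by simp⟩

lemma IsJet.comp {g : E → E'} (hg : ContDiff ℝ ∞ g) (hF : IsJet N F) :
    IsJet N (fun γ x => g (F γ x)) :=
  hF.comp₂ (g := fun z (_ : E) => g z) (hg.comp contDiff_fst) hF

lemma IsJet.add {F₁ F₂ : (ℝ → 𝔤) → ℝ → E} (hF₁ : IsJet N F₁) (hF₂ : IsJet N F₂) :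
    IsJet N (fun γ x => F₁ γ x + F₂ γ x) := hF₁.comp₂ contDiff_add hF₂

lemma IsJet.sub {F₁ F₂ : (ℝ → 𝔤) → ℝ → E} (hF₁ : IsJet N F₁) (hF₂ : IsJet N F₂) :
    IsJet N (fun γ x => F₁ γ x - F₂ γ x) := hF₁.comp₂ (contDiff_fst.sub contDiff_snd) hF₂

lemma IsJet.neg (hF : IsJet N F) : IsJet N (fun γ x => -F γ x) := hF.comp contDiff_neg

lemma IsJet.sum {ι : Type*} (s : Finset ι) {F : ι → (ℝ → 𝔤) → ℝ → E}
    (hF : ∀ i ∈ s, IsJet N (F i)) : IsJet N (fun γ x => ∑ i ∈ s, F i γ x) := by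
  classical
  induction s using Finset.induction_on with
  | empty => simpa using isJet_const (0 : E)
  | insert i s hi ih =>
    simp only [Finset.sum_insert hi]
    exact (hF i (by simp)).add (ih fun j hj => hF j (by simp [hj]))

lemma IsJet.contDiff (hF : IsJet N F) (hγ : γ ∈ smoothCurves N) : ContDiff ℝ ∞ (F γ) := by
  obtain ⟨k, f, hf, hFf⟩ := hF
  rw [show F γ = fun x => f (fun i : Fin k => iteratedDeriv i γ x) from funext (hFf γ hγ)]
  refine hf.comp (contDiff_pi.2 fun i => contDiff_infty.2 fun n => ?_)
  rw [iteratedDeriv_eq_iterate]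
  exact ContDiff.iterate_deriv' n i (hγ.1.of_le (by exact_mod_cast le_top))

lemma IsJet.differentiable (hF : IsJet N F) (hγ : γ ∈ smoothCurves N) :
    Differentiable ℝ (F γ) :=
  (hF.contDiff hγ).differentiable (by simp)

lemma hasDerivAt_iteratedDeriv {γ : ℝ → E} (hγ : ContDiff ℝ ∞ γ) (i : ℕ) (x : ℝ) :
    HasDerivAt (iteratedDeriv i γ) (iteratedDeriv (i + 1) γ x) x := by
  rw [iteratedDeriv_succ]
  exact (hγ.differentiable_iteratedDeriv i (by exact_mod_cast WithTop.coe_lt_top _) x).hasDerivAt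

lemma IsJet.deriv (hF : IsJet N F) : IsJet N (fun γ x => deriv (F γ) x) := by
  obtain ⟨k, f, hf, hFf⟩ := hF
  refine ⟨k + 1, fun v => fderiv ℝ f (fun i => v i.castSucc) (fun i => v i.succ), ?_,
    fun γ hγ x => ?_⟩
  · exact ((hf.fderiv_right (m := ∞) (by simp)).comp (by fun_prop)).clm_apply (by fun_prop)
  · have hFγ : F γ = fun x => f (fun i : Fin k => iteratedDeriv i γ x) := funext (hFf γ hγ)
    have hjet : HasDerivAt (fun x => fun i : Fin k => iteratedDeriv i γ x)
        (fun i : Fin k => iteratedDeriv (i + 1) γ x) x :=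
      hasDerivAt_pi.2 fun i => hasDerivAt_iteratedDeriv hγ.1 i x
    have hfderiv :=
      (hf.differentiable (by simp) (fun i : Fin k => iteratedDeriv i γ x)).hasFDerivAt
    exact (congrArg (_root_.deriv · x) hFγ).trans (hfderiv.comp_hasDerivAt x hjet).deriv

end Jets

section Locality

variable {𝔤 : Type*} [LieRing 𝔤] [LieAlgebra ℝ 𝔤] [IsCompactType 𝔤] {E E' E'' : Type*}
  {N : Set 𝔤} {𝔪 : Submodule ℝ 𝔤} {γ : ℝ → 𝔤}

/-- The condition `IsLocal` for functionals with values in an arbitrary type. -/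
def DependsOnJet (N : Set 𝔤) (F : (ℝ → 𝔤) → ℝ → E) : Prop :=
  ∃ k : ℕ, ∀ γ ∈ smoothCurves N, ∀ γ' ∈ smoothCurves N, ∀ x : ℝ,
    (∀ i ≤ k, iteratedDeriv i γ x = iteratedDeriv i γ' x) → F γ x = F γ' x

lemma IsJet.dependsOnJet [NormedAddCommGroup E] [NormedSpace ℝ E] {F : (ℝ → 𝔤) → ℝ → E}
    (hF : IsJet N F) : DependsOnJet N F := by
  obtain ⟨k, f, -, hFf⟩ := hF
  refine ⟨k, fun γ hγ γ' hγ' x hx => ?_⟩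
  rw [hFf γ hγ, hFf γ' hγ']
  exact congrArg f (funext fun i => hx i i.2.le)

lemma DependsOnJet.comp₂ {F : (ℝ → 𝔤) → ℝ → E} {F' : (ℝ → 𝔤) → ℝ → E'} (g : E → E' → E'')
    (hF : DependsOnJet N F) (hF' : DependsOnJet N F') :
    DependsOnJet N (fun γ x => g (F γ x) (F' γ x)) := by
  obtain ⟨k, hk⟩ := hF
  obtain ⟨k', hk'⟩ := hF'
  refine ⟨max k k', fun γ hγ γ' hγ' x hx => ?_⟩
  exact congrArg₂ g (hk γ hγ γ' hγ' x fun i hi => hx i (hi.trans (le_max_left _ _)))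
    (hk' γ hγ γ' hγ' x fun i hi => hx i (hi.trans (le_max_right _ _)))

lemma DependsOnJet.eq_of_eventuallyEq {F : (ℝ → 𝔤) → ℝ → E} (hF : DependsOnJet N F)
    {γ' : ℝ → 𝔤} (hγ : γ ∈ smoothCurves N) (hγ' : γ' ∈ smoothCurves N) {x : ℝ}
    (h : γ =ᶠ[𝓝 x] γ') : F γ x = F γ' x := by
  obtain ⟨k, hk⟩ := hF
  exact hk γ hγ γ' hγ' x fun i _ => h.iteratedDeriv_eq i

lemma exists_contDiff_eventuallyEq_one_eventuallyEq_zero (x : ℝ) :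
    ∃ (y : ℝ) (b : ℝ → ℝ), ContDiff ℝ ∞ b ∧ (b =ᶠ[𝓝 x] fun _ => 1) ∧ b =ᶠ[𝓝 y] fun _ => 0 := by
  let b : ContDiffBump x := ⟨1, 2, by norm_num, by norm_num⟩
  have hfar : {y | 2 < dist y x} ∈ 𝓝 (x + 3) :=
    (isOpen_lt continuous_const (by fun_prop)).mem_nhds (by simp; norm_num)
  refine ⟨x + 3, b, b.contDiff, b.eventuallyEq_one, ?_⟩
  filter_upwards [hfar] with y hy using b.zero_of_le_dist hy.le

variable [Zero E] {F : (ℝ → 𝔤) → ℝ → E}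

/-- A local functional takes the same value at `x` on `γ` and on a curve that agrees with `γ` near
`x` but is constant near another point `y`, where the functional is known to vanish. -/
lemma DependsOnJet.eq_zero_of_forall_const (hF : DependsOnJet N F)
    (hprop : ∀ γ ∈ smoothCurves N, ∀ x y, F γ y = 0 → F γ x = 0)
    (hconst : ∀ v ∈ N, ∀ x, F (fun _ => v) x = 0) (hγ : γ ∈ smoothCurves N) (x : ℝ) :
    F γ x = 0 := by
  obtain ⟨y, b, hb, hbx, hby⟩ := exists_contDiff_eventuallyEq_one_eventuallyEq_zero x
  have hγ' : (fun z => γ (x + b z * (z - x))) ∈ smoothCurves N :=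
    ⟨hγ.1.comp (by fun_prop), fun _ => hγ.2 _⟩
  have hx : γ =ᶠ[𝓝 x] fun z => γ (x + b z * (z - x)) := by
    filter_upwards [hbx] with z hz
    rw [hz, one_mul, add_sub_cancel]
  have hy : (fun z => γ (x + b z * (z - x))) =ᶠ[𝓝 y] fun _ => γ x := by
    filter_upwards [hby] with z hz
    rw [hz, zero_mul, add_zero]
  rw [hF.eq_of_eventuallyEq hγ hγ' hx]
  refine hprop _ hγ' x y ?_
  rw [hF.eq_of_eventuallyEq hγ' ⟨contDiff_const, fun _ => hγ.2 x⟩ hy, hconst _ (hγ.2 x)]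

lemma DependsOnJet.eq_zero_of_zero (hF : DependsOnJet (𝔪 : Set 𝔤) F)
    (hprop : ∀ γ ∈ smoothCurves (𝔪 : Set 𝔤), ∀ x y, F γ y = 0 → F γ x = 0)
    (hzero : ∀ x, F (fun _ => 0) x = 0) (hγ : γ ∈ smoothCurves (𝔪 : Set 𝔤)) (x : ℝ) :
    F γ x = 0 := by
  obtain ⟨y, b, hb, hbx, hby⟩ := exists_contDiff_eventuallyEq_one_eventuallyEq_zero x
  have hγ' : (fun z => b z • γ z) ∈ smoothCurves (𝔪 : Set 𝔤) :=
    ⟨hb.smul hγ.1, fun z => 𝔪.smul_mem _ (hγ.2 z)⟩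
  have hx : γ =ᶠ[𝓝 x] fun z => b z • γ z := by
    filter_upwards [hbx] with z hz
    rw [hz, one_smul]
  have hy : (fun z => b z • γ z) =ᶠ[𝓝 y] fun _ => 0 := by
    filter_upwards [hby] with z hz
    rw [hz, zero_smul]
  rw [hF.eq_of_eventuallyEq hγ hγ' hx]
  refine hprop _ hγ' x y ?_
  rw [hF.eq_of_eventuallyEq hγ' ⟨contDiff_const, fun _ => 𝔪.zero_mem⟩ hy, hzero]

end Locality

section Uniqueness

variable {𝔤 : Type*} [LieRing 𝔤] [LieAlgebra ℝ 𝔤] [IsCompactType 𝔤] {N : Set 𝔤}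
  {F F' P P' : CurveFun 𝔤}

lemma eq_of_forall_hasDerivAt_zero {E : Type*} [NormedAddCommGroup E] [NormedSpace ℝ E] {f : ℝ → E}
    (hf : ∀ x, HasDerivAt f 0 x) (x y : ℝ) : f x = f y :=
  is_const_of_deriv_eq_zero (fun x => (hf x).differentiableAt) (fun x => (hf x).deriv) x y

lemma IsPrimitive.eq {𝔪 : Submodule ℝ 𝔤} (hP : IsPrimitive 𝔪 F P) (hP' : IsPrimitive 𝔪 F' P')
    (hF : ∀ q ∈ smoothCurves (𝔪 : Set 𝔤), ∀ x, F' q x = F q x)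
    {q : ℝ → 𝔤} (hq : q ∈ smoothCurves (𝔪 : Set 𝔤)) : P' q = P q := by
  funext x
  rw [← sub_eq_zero]
  refine DependsOnJet.eq_zero_of_zero (F := fun γ x => P' γ x - P γ x)
    (DependsOnJet.comp₂ (F := P') (F' := P) (· - ·) hP'.1 hP.1) (fun γ hγ x y hy => ?_)
    (fun x => by rw [hP.2.2, hP'.2.2, sub_zero]) hq x
  rw [← hy]
  refine eq_of_forall_hasDerivAt_zero (f := fun x => P' γ x - P γ x) (fun z => ?_) x y
  simpa [hF γ hγ z] using (hP'.2.1 γ hγ z).fun_sub (hP.2.1 γ hγ z)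

lemma norm_eq_of_lie_eq_zero_of_deriv_eq_lie {γ f Y : ℝ → 𝔤} (hf : Differentiable ℝ f)
    (hker : ∀ x, ⁅γ x, f x⁆ = 0) (hderiv : ∀ x, deriv f x = ⁅γ x, Y x⁆) (x y : ℝ) :
    ‖f x‖ = ‖f y‖ := by
  have hsq : ∀ z, HasDerivAt (fun z => ‖f z‖ ^ 2) 0 z := by
    intro z
    have horth : inner ℝ (f z) (deriv f z) = 0 := by
      have hinv := inner_lie_left (γ z) (f z) (Y z)
      rwa [hker, inner_zero_left, eq_comm, neg_eq_zero, ← hderiv] at hinv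
    simpa [horth] using (hf z).hasDerivAt.norm_sq
  exact (sq_eq_sq₀ (norm_nonneg _) (norm_nonneg _)).1 (eq_of_forall_hasDerivAt_zero hsq x y)

lemma IsHPrimitive.eq {c : ℝ} (hP : IsHPrimitive N c F P) (hP' : IsHPrimitive N c F' P')
    (hF : ∀ γ ∈ smoothCurves N, ∀ x, F' γ x = F γ x) {γ : ℝ → 𝔤} (hγ : γ ∈ smoothCurves N) :
    P' γ = P γ := by
  funext x
  rw [← sub_eq_zero]
  refine DependsOnJet.eq_zero_of_forall_const (F := fun γ x => P' γ x - P γ x)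
    (DependsOnJet.comp₂ (F := P') (F' := P) (· - ·) hP'.1 hP.1) (fun γ hγ x y hy => ?_)
    (fun v hv x => by rw [hP.2.2 v hv, hP'.2.2 v hv, sub_zero]) hγ x
  obtain ⟨hd, he⟩ := hP.2.1 γ hγ
  obtain ⟨hd', he'⟩ := hP'.2.1 γ hγ
  rw [← norm_eq_zero, norm_eq_of_lie_eq_zero_of_deriv_eq_lie
    (Y := fun z => -c • ⁅γ z, deriv (P' γ) z - deriv (P γ) z⁆) (hd'.fun_sub hd)
    (fun z => by rw [lie_sub, (he z).1, (he' z).1, sub_zero]) (fun z => ?_) x y, hy, norm_zero]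
  have hdiff := sub_eq_zero.2 ((he' z).2.trans ((hF γ hγ z).trans (he z).2.symm))
  rw [deriv_fun_sub (hd' z) (hd z), lie_smul, lie_sub, lie_sub, ← sub_eq_zero, ← hdiff]
  module

end Uniqueness

section CentralizerProjection

variable {𝔤 : Type*} [LieRing 𝔤]

/-- The projection `1 + ad(B)²` to the centralizer of `B`, if `ad(B)³ = -ad(B)`. -/
def centProj (B y : 𝔤) : 𝔤 := y + ⁅B, ⁅B, y⁆⁆

lemma lie_centProj {B : 𝔤} (hB : ∀ y : 𝔤, ⁅B, ⁅B, ⁅B, y⁆⁆⁆ = -⁅B, y⁆) (y : 𝔤) :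
    ⁅B, centProj B y⁆ = 0 := by
  rw [centProj, lie_add, hB, add_neg_cancel]

lemma centProj_lie {B : 𝔤} (hB : ∀ y : 𝔤, ⁅B, ⁅B, ⁅B, y⁆⁆⁆ = -⁅B, y⁆) (y : 𝔤) :
    centProj B ⁅B, y⁆ = 0 := by
  rw [centProj, hB, add_neg_cancel]

lemma centProj_of_lie_eq_zero {B y : 𝔤} (h : ⁅B, y⁆ = 0) : centProj B y = y := by
  rw [centProj, h, lie_zero, add_zero]

lemma centProj_add (B y z : 𝔤) : centProj B (y + z) = centProj B y + centProj B z := by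
  simp only [centProj, lie_add]; abel

lemma centProj_neg (B y : 𝔤) : centProj B (-y) = -centProj B y := by
  rw [centProj, centProj, lie_neg, lie_neg, neg_add]

lemma centProj_zero (B : 𝔤) : centProj B 0 = 0 := by simp [centProj]

lemma centProj_map [LieAlgebra ℝ 𝔤] (φ : 𝔤 ≃ₗ⁅ℝ⁆ 𝔤) (B y : 𝔤) :
    centProj (φ B) (φ y) = φ (centProj B y) := by
  simp only [centProj, map_add, LieEquiv.map_lie]

end CentralizerProjection

section LaxSequence

variable {𝔤 : Type*} [LieRing 𝔤] [LieAlgebra ℝ 𝔤] [IsCompactType 𝔤] [FiniteDimensional ℝ 𝔤]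

/-- The generating series of `ad` of a sequence. -/
noncomputable def adSeries (s : ℕ → 𝔤) : PowerSeries (𝔤 →L[ℝ] 𝔤) := .mk fun i => adCLM (s i)

@[simp] lemma coeff_adSeries (s : ℕ → 𝔤) (n : ℕ) : (adSeries s).coeff n = adCLM (s n) := by
  simp [adSeries]

lemma map_conjCLM_adSeries (φ : 𝔤 ≃ₗ⁅ℝ⁆ 𝔤) (s : ℕ → 𝔤) :
    PowerSeries.map (conjCLM φ : (𝔤 →L[ℝ] 𝔤) →+* (𝔤 →L[ℝ] 𝔤)) (adSeries s) =
      adSeries fun i => φ (s i) := by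
  ext1 n
  simpa using conjCLM_adCLM φ (s n)

lemma coeff_cubic_adSeries_map (φ : 𝔤 ≃ₗ⁅ℝ⁆ 𝔤) (s : ℕ → 𝔤) (n : ℕ) :
    (cubic (adSeries fun i => φ (s i))).coeff n = conjCLM φ ((cubic (adSeries s)).coeff n) := by
  rw [← map_conjCLM_adSeries, ← map_cubic]
  exact PowerSeries.coeff_map _ n _

/-- The coefficients `Sₙ` of the formal solution `S = ∑ Sₙ λ⁻ⁿ`, `S₀ = B`, of the Lax equation
`Sₓ + [q, S] = λ[B, S]`. The equation prescribes `[B, Sₙ₊₁]`; the component of `Sₙ₊₁` in the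
centralizer of `B` is found without integration from the order `n + 1` of `ad(S)³ = -ad(S)`. -/
noncomputable def lax (q B : ℝ → 𝔤) : ℕ → ℝ → 𝔤
  | 0 => B
  | n + 1 => fun x => -⁅B x, deriv (lax q B n) x + ⁅q x, lax q B n x⁆⁆ -
      centProj (B x) (adAdjoint (cubicWeight (adCLM (B x)) *
        (cubic (adSeries fun i => if i ≤ n then lax q B i x else 0)).coeff (n + 1)))

lemma lax_zero (q B : ℝ → 𝔤) : lax q B 0 = B := by rw [lax]

/-- The sequence `S₀, …, Sₙ, 0, 0, …`. -/
noncomputable def laxTrunc (q B : ℝ → 𝔤) (n : ℕ) (x : ℝ) (i : ℕ) : 𝔤 :=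
  if i ≤ n then lax q B i x else 0

lemma lax_succ (q B : ℝ → 𝔤) (n : ℕ) (x : ℝ) : lax q B (n + 1) x =
    -⁅B x, deriv (lax q B n) x + ⁅q x, lax q B n x⁆⁆ -
      centProj (B x) (adAdjoint (cubicWeight (adCLM (B x)) *
        (cubic (adSeries (laxTrunc q B n x))).coeff (n + 1))) := by
  rw [lax]
  rfl

end LaxSequence

section LaxJets

variable {𝔤 : Type*} [LieRing 𝔤] [LieAlgebra ℝ 𝔤] [IsCompactType 𝔤] {N : Set 𝔤}

lemma IsJet.mul {F F' : (ℝ → 𝔤) → ℝ → (𝔤 →L[ℝ] 𝔤)} (hF : IsJet N F) (hF' : IsJet N F') :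
    IsJet N (fun γ x => F γ x * F' γ x) :=
  hF.comp₂ (g := fun y z => y * z) contDiff_mul hF'

variable [FiniteDimensional ℝ 𝔤]

lemma IsJet.lie {F F' : CurveFun 𝔤} (hF : IsJet N F) (hF' : IsJet N F') :
    IsJet N (fun γ x => ⁅F γ x, F' γ x⁆) :=
  hF.comp₂ (g := fun y z => ⁅y, z⁆)
    (show ContDiff ℝ ∞ (fun z : 𝔤 × 𝔤 => adCLM z.1 z.2) by fun_prop) hF'

lemma IsJet.centProj {F F' : CurveFun 𝔤} (hF : IsJet N F) (hF' : IsJet N F') :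
    IsJet N (fun γ x => centProj (F γ x) (F' γ x)) :=
  hF'.add (hF.lie (hF.lie hF'))

lemma IsJet.coeff_cubic_adSeries {s : (ℝ → 𝔤) → ℝ → ℕ → 𝔤}
    (hs : ∀ i, IsJet N (fun γ x => s γ x i)) (n : ℕ) :
    IsJet N (fun γ x => (cubic (adSeries (s γ x))).coeff n) := by
  have had : ∀ i, IsJet N (fun γ x => adCLM (s γ x i)) := fun i => (hs i).comp (by fun_prop)
  simp only [cubic, map_add, PowerSeries.coeff_mul, coeff_adSeries]
  refine (IsJet.sum _ fun p _ => ?_).add (had n)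
  exact (IsJet.sum _ fun r _ => (had _).mul (had _)).mul (had _)

lemma isJet_lax {Q B : CurveFun 𝔤} (hQ : IsJet N Q) (hB : IsJet N B) (n : ℕ) :
    IsJet N (fun γ => lax (Q γ) (B γ) n) := by
  induction n using Nat.strong_induction_on with
  | _ n ih =>
    cases n with
    | zero => simpa only [lax_zero] using hB
    | succ n =>
      have hn := ih n n.lt_succ_self
      have htrunc : ∀ i, IsJet N (fun γ x => laxTrunc (Q γ) (B γ) n x i) := by
        intro i
        unfold laxTrunc
        split_ifs with hi
        · exact ih i (Nat.lt_succ_of_le hi)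
        · exact isJet_const 0
      have hweight : IsJet N (fun γ x => cubicWeight (adCLM (B γ x))) :=
        hB.comp (g := fun b => cubicWeight (adCLM b)) (by unfold cubicWeight; fun_prop)
      have hcubic := (hweight.mul (IsJet.coeff_cubic_adSeries htrunc (n + 1))).comp
        (g := adAdjoint) (by fun_prop)
      refine IsJet.congr ?_ fun γ _ x => lax_succ (Q γ) (B γ) n x
      exact (hB.lie (hn.deriv.add (hQ.lie hn))).neg.sub (hB.centProj hcubic)

end LaxJets

section Equivariance

variable {𝔤 : Type*} [LieRing 𝔤] [LieAlgebra ℝ 𝔤] [IsCompactType 𝔤] [FiniteDimensional ℝ 𝔤]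

lemma hasDerivAt_clm_apply_of_forall {E F : Type*} [NormedAddCommGroup E] [NormedSpace ℝ E]
    [FiniteDimensional ℝ E] [NormedAddCommGroup F] [NormedSpace ℝ F] {L : ℝ → E →L[ℝ] F}
    {L' : E →L[ℝ] F} {x : ℝ} (hL : ∀ y, HasDerivAt (fun s => L s y) (L' y) x) {f : ℝ → E} {f' : E}
    (hf : HasDerivAt f f' x) : HasDerivAt (fun s => L s (f s)) (L' (f x) + L x f') x := by
  let b := Module.finBasis ℝ E
  have hexpand (M : E →L[ℝ] F) (y : E) : M y = ∑ i, b.repr y i • M (b i) := by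
    conv_lhs => rw [← b.sum_repr y]
    simp only [map_sum, map_smul]
  have hcoord (i) : HasDerivAt (fun s => b.repr (f s) i) (b.repr f' i) x :=
    (LinearMap.toContinuousLinearMap (b.coord i)).hasFDerivAt.comp_hasDerivAt x hf
  rw [funext fun s => hexpand (L s) (f s), hexpand L', hexpand (L x) f', ← Finset.sum_add_distrib]
  exact HasDerivAt.fun_sum fun i _ => (hcoord i).smul (hL (b i))

/-- `ψₓ = ψ ad(b)` along a curve of automorphisms. -/
def HasLogDeriv (ψ : ℝ → 𝔤 ≃ₗ⁅ℝ⁆ 𝔤) (b : ℝ → 𝔤) (s : Set ℝ) : Prop :=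
  ∀ x ∈ s, ∀ y, HasDerivAt (fun s => ψ s y) (ψ x ⁅b x, y⁆) x

lemma HasLogDeriv.hasDerivAt_apply {ψ : ℝ → 𝔤 ≃ₗ⁅ℝ⁆ 𝔤} {b : ℝ → 𝔤} {s : Set ℝ}
    (hψ : HasLogDeriv ψ b s) {x : ℝ} (hx : x ∈ s) {f : ℝ → 𝔤} {f' : 𝔤} (hf : HasDerivAt f f' x) :
    HasDerivAt (fun s => ψ s (f s)) (ψ x (f' + ⁅b x, f x⁆)) x := by
  rw [map_add, add_comm]
  exact hasDerivAt_clm_apply_of_forall (L := fun s => autCLM (ψ s))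
    (L' := autCLM (ψ x) * adCLM (b x)) (fun y => hψ x hx y) hf

/-- The Lax equation is covariant under gauge transformations, and so is the cubic identity. -/
lemma lax_gauge {ψ : ℝ → 𝔤 ≃ₗ⁅ℝ⁆ 𝔤} {b : ℝ → 𝔤} (hψ : HasLogDeriv ψ b univ)
    {q B q' B' : ℝ → 𝔤} (hq : ∀ x, q' x = ψ x (q x - b x)) (hB : ∀ x, B' x = ψ x (B x))
    (hdiff : ∀ n, Differentiable ℝ (lax q B n)) (n : ℕ) (x : ℝ) :
    lax q' B' n x = ψ x (lax q B n x) := by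
  induction n using Nat.strong_induction_on generalizing x with
  | _ n ih =>
    cases n with
    | zero => rw [lax_zero, lax_zero, hB]
    | succ n =>
      have hderiv : deriv (lax q' B' n) x + ⁅q' x, lax q' B' n x⁆ =
          ψ x (deriv (lax q B n) x + ⁅q x, lax q B n x⁆) := by
        rw [funext (ih n n.lt_succ_self),
          (hψ.hasDerivAt_apply (mem_univ x) (hdiff n x).hasDerivAt).deriv, hq, ← LieEquiv.map_lie,
          ← map_add, sub_lie, add_assoc, add_sub_cancel]
      have htrunc : laxTrunc q' B' n x = fun i => ψ x (laxTrunc q B n x i) := by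
        funext i
        unfold laxTrunc
        split_ifs with hi
        · exact ih i (Nat.lt_succ_of_le hi) x
        · exact (map_zero _).symm
      rw [lax_succ, lax_succ, hderiv, htrunc, hB, coeff_cubic_adSeries_map, ← conjCLM_adCLM,
        ← map_cubicWeight, ← map_mul, adAdjoint_conjCLM, centProj_map, ← LieEquiv.map_lie, map_sub,
        map_neg]

end Equivariance

namespace IsHermitianSymmetric

variable {𝔤 : Type*} [LieRing 𝔤] [LieAlgebra ℝ 𝔤] {𝔥 : LieSubalgebra ℝ 𝔤} {𝔪 : Submodule ℝ 𝔤}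
  {A : 𝔤}

lemma exists_add (hA : IsHermitianSymmetric 𝔥 𝔪 A) (y : 𝔤) : ∃ a ∈ 𝔥, ∃ z ∈ 𝔪, a + z = y :=
  Submodule.mem_sup.1 (hA.isCompl.sup_eq_top ▸ Submodule.mem_top)

lemma lie_mem (hA : IsHermitianSymmetric 𝔥 𝔪 A) (y : 𝔤) : ⁅A, y⁆ ∈ 𝔪 := by
  obtain ⟨a, ha, z, hz, rfl⟩ := hA.exists_add y
  rw [lie_add, (hA.centralizer a).2 ha, zero_add]
  exact hA.lie_h_m A hA.mem z hz

lemma cube (hA : IsHermitianSymmetric 𝔥 𝔪 A) (y : 𝔤) : ⁅A, ⁅A, ⁅A, y⁆⁆⁆ = -⁅A, y⁆ :=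
  hA.sq _ (hA.lie_mem y)

lemma centProj_of_mem (hA : IsHermitianSymmetric 𝔥 𝔪 A) {y : 𝔤} (hy : y ∈ 𝔪) :
    centProj A y = 0 := by
  rw [centProj, hA.sq y hy, add_neg_cancel]

end IsHermitianSymmetric

section ConstantLax

variable {𝔤 : Type*} [LieRing 𝔤] [LieAlgebra ℝ 𝔤] [FiniteDimensional ℝ 𝔤] [IsCompactType 𝔤]

lemma adSeries_eq_C {s : ℕ → 𝔤} (hs : ∀ i, s (i + 1) = 0) :
    adSeries s = PowerSeries.C (adCLM (s 0)) := by
  ext1 i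
  rw [coeff_adSeries, PowerSeries.coeff_C]
  cases i with
  | zero => rw [if_pos rfl]
  | succ i => rw [hs, map_zero, if_neg i.succ_ne_zero]

lemma coeff_succ_cubic_C {R : Type*} [Ring R] (ℓ : R) (n : ℕ) :
    (cubic (PowerSeries.C ℓ)).coeff (n + 1) = 0 := by
  rw [← map_cubic, PowerSeries.coeff_C, if_neg n.succ_ne_zero]

lemma lax_const (B : 𝔤) (n : ℕ) (x : ℝ) : lax (fun _ => 0) (fun _ => B) (n + 1) x = 0 := by
  induction n using Nat.strong_induction_on generalizing x with
  | _ n ih =>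
    have hderiv : deriv (lax (fun _ => 0) (fun _ => B) n) x = 0 := by
      cases n with
      | zero => rw [lax_zero, deriv_const]
      | succ n => rw [funext (ih n n.lt_succ_self), deriv_const]
    have htrunc (i) : laxTrunc (fun _ => 0) (fun _ => B) n x (i + 1) = 0 := by
      rw [laxTrunc]
      split_ifs with hi
      · exact ih i hi x
      · rfl
    rw [lax_succ, hderiv, adSeries_eq_C htrunc, coeff_succ_cubic_C]
    simp only [zero_lie, add_zero, lie_zero, neg_zero, mul_zero, map_zero, centProj_zero, sub_zero]

end ConstantLax

section Defects

variable {𝔤 : Type*} [LieRing 𝔤] [LieAlgebra ℝ 𝔤] [FiniteDimensional ℝ 𝔤] [IsCompactType 𝔤]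
  {𝔥 : LieSubalgebra ℝ 𝔤} {𝔪 : Submodule ℝ 𝔤} {A : 𝔤} {q : ℝ → 𝔤} {n : ℕ} {x : ℝ}

/-- The failure of the `n`-th coefficient of the Lax equation: the part of `∂ₓSₙ + [q, Sₙ]` in the
centralizer of `A`, which the choice of `Sₙ₊₁` cannot compensate. -/
noncomputable def laxDefect (A : 𝔤) (q : ℝ → 𝔤) (n : ℕ) (x : ℝ) : 𝔤 :=
  centProj A (deriv (lax q (fun _ => A) n) x + ⁅q x, lax q (fun _ => A) n x⁆)

/-- The coefficients of `ad(S)³ + ad(S)`. -/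
noncomputable def laxCubic (A : 𝔤) (q : ℝ → 𝔤) (n : ℕ) (x : ℝ) : 𝔤 →L[ℝ] 𝔤 :=
  (cubic (adSeries fun i => lax q (fun _ => A) i x)).coeff n

lemma lie_laxDefect (hA : IsHermitianSymmetric 𝔥 𝔪 A) : ⁅A, laxDefect A q n x⁆ = 0 :=
  lie_centProj hA.cube _

lemma commute_adCLM_of_lie_eq_zero {y z : 𝔤} (h : ⁅y, z⁆ = 0) : Commute (adCLM y) (adCLM z) := by
  rw [commute_iff_lie_eq, ← adCLM_lie, h, map_zero]

lemma deriv_lax_add_lie (hA : IsHermitianSymmetric 𝔥 𝔪 A) (q : ℝ → 𝔤) (n : ℕ) (x : ℝ) :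
    deriv (lax q (fun _ => A) n) x + ⁅q x, lax q (fun _ => A) n x⁆ =
      ⁅A, lax q (fun _ => A) (n + 1) x⁆ + laxDefect A q n x := by
  rw [lax_succ, lie_sub, lie_centProj hA.cube, sub_zero, lie_neg, laxDefect, centProj]
  abel

lemma laxDefect_zero (hA : IsHermitianSymmetric 𝔥 𝔪 A) (q : ℝ → 𝔤) (x : ℝ) :
    laxDefect A q 0 x = 0 := by
  rw [laxDefect, lax_zero, deriv_const, zero_add, ← lie_skew]
  exact hA.centProj_of_mem (𝔪.neg_mem (hA.lie_mem _))

lemma laxCubic_zero (hA : IsHermitianSymmetric 𝔥 𝔪 A) (q : ℝ → 𝔤) (x : ℝ) :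
    laxCubic A q 0 x = 0 := by
  rw [laxCubic, PowerSeries.coeff_zero_eq_constantCoeff_apply, map_cubic,
    ← PowerSeries.coeff_zero_eq_constantCoeff_apply, coeff_adSeries, lax_zero]
  exact cubic_adCLM_eq_zero hA.cube

lemma laxCubic_const (hA : IsHermitianSymmetric 𝔥 𝔪 A) (n : ℕ) (x : ℝ) :
    laxCubic A (fun _ => 0) n x = 0 := by
  rw [laxCubic, adSeries_eq_C (fun i => lax_const A i x), lax_zero, ← map_cubic,
    cubic_adCLM_eq_zero hA.cube, map_zero, map_zero]

lemma differentiable_lax (hq : q ∈ smoothCurves (𝔪 : Set 𝔤)) (n : ℕ) :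
    Differentiable ℝ (lax q (fun _ => A) n) :=
  (isJet_lax isJet_self (isJet_const A) n).differentiable hq

lemma isJet_laxCubic (N : Set 𝔤) (A : 𝔤) (n : ℕ) : IsJet N (fun q => laxCubic A q n) :=
  IsJet.coeff_cubic_adSeries (fun i => isJet_lax isJet_self (isJet_const A) i) n

end Defects

section CubicOfSolution

variable {𝔤 : Type*} [LieRing 𝔤] [LieAlgebra ℝ 𝔤] [FiniteDimensional ℝ 𝔤] [IsCompactType 𝔤]
  {𝔥 : LieSubalgebra ℝ 𝔤} {𝔪 : Submodule ℝ 𝔤} {A : 𝔤} {q : ℝ → 𝔤} {n : ℕ} {x : ℝ}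

lemma hasDerivAt_coeff_mul {R : Type*} [NormedRing R] [NormedAlgebra ℝ R] {U V : ℝ → PowerSeries R}
    {U' V' : PowerSeries R} (hU : ∀ i, HasDerivAt (fun x => (U x).coeff i) (U'.coeff i) x)
    (hV : ∀ i, HasDerivAt (fun x => (V x).coeff i) (V'.coeff i) x) (i : ℕ) :
    HasDerivAt (fun x => (U x * V x).coeff i) ((U' * V x + U x * V').coeff i) x := by
  simp only [map_add, PowerSeries.coeff_mul, ← Finset.sum_add_distrib]
  exact HasDerivAt.fun_sum fun p _ => (hU p.1).mul (hV p.2)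

lemma hasDerivAt_coeff_cubic {R : Type*} [NormedRing R] [NormedAlgebra ℝ R] {S : ℝ → PowerSeries R}
    {S' : PowerSeries R} (hS : ∀ i, HasDerivAt (fun x => (S x).coeff i) (S'.coeff i) x) (n : ℕ) :
    HasDerivAt (fun x => (cubic (S x)).coeff n) ((cubicDeriv (S x) S').coeff n) x := by
  have hsum := (hasDerivAt_coeff_mul (hasDerivAt_coeff_mul hS hS) hS n).fun_add (hS n)
  simp only [← map_add] at hsum
  have hexpand : cubicDeriv (S x) S' =
      (S' * S x + S x * S') * S x + S x * S x * S' + S' := by rw [cubicDeriv, add_mul]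
  rw [hexpand]
  exact hsum

lemma adSeries_lax_equation (hA : IsHermitianSymmetric 𝔥 𝔪 A) (q : ℝ → 𝔤) (x : ℝ) :
    PowerSeries.X * (adSeries (fun i => deriv (lax q (fun _ => A) i) x) +
      ⁅PowerSeries.C (adCLM (q x)), adSeries (fun i => lax q (fun _ => A) i x)⁆) =
    ⁅PowerSeries.C (adCLM A), adSeries (fun i => lax q (fun _ => A) i x)⁆ +
      PowerSeries.X * adSeries (fun i => laxDefect A q i x) := by
  simp only [Ring.lie_def]
  ext1 i
  cases i with
  | zero => simp [PowerSeries.coeff_zero_X_mul, lax_zero, coeff_adSeries,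
      -PowerSeries.coeff_zero_eq_constantCoeff]
  | succ i =>
    simp only [PowerSeries.coeff_succ_X_mul, map_add, map_sub, PowerSeries.coeff_C_mul,
      PowerSeries.coeff_mul_C, coeff_adSeries]
    rw [← Ring.lie_def, ← Ring.lie_def, ← adCLM_lie, ← adCLM_lie, ← map_add, ← map_add,
      deriv_lax_add_lie hA]

lemma hasDerivAt_laxCubic (hA : IsHermitianSymmetric 𝔥 𝔪 A) (hq : q ∈ smoothCurves (𝔪 : Set 𝔤))
    (hdefect : ∀ i < n, laxDefect A q i x = 0) :
    HasDerivAt (laxCubic A q n) (⁅adCLM A, laxCubic A q (n + 1) x⁆ +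
      cubicDeriv (adCLM A) (adCLM (laxDefect A q n x)) - ⁅adCLM (q x), laxCubic A q n x⁆) x := by
  have hderiv := hasDerivAt_coeff_cubic (x := x) (S := fun x => adSeries fun i =>
    lax q (fun _ => A) i x) (S' := adSeries fun i => deriv (lax q (fun _ => A) i) x) (fun i => by
      simp only [coeff_adSeries]
      exact adCLM.hasFDerivAt.comp_hasDerivAt x (differentiable_lax hq i x).hasDerivAt) n
  have hdvd : PowerSeries.X ^ n ∣ adSeries fun i => laxDefect A q i x := by
    rw [PowerSeries.X_pow_dvd_iff]
    intro i hi
    rw [coeff_adSeries, hdefect i hi, map_zero]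
  have hlax := coeff_cubicDeriv_of_lax (adSeries_lax_equation hA q x) n
  rw [coeff_cubicDeriv_of_X_pow_dvd hdvd, ← PowerSeries.coeff_zero_eq_constantCoeff_apply,
    coeff_adSeries, coeff_adSeries, lax_zero, ← eq_sub_iff_add_eq] at hlax
  rw [hlax] at hderiv
  exact hderiv

lemma commute_laxCubic_succ (hA : IsHermitianSymmetric 𝔥 𝔪 A)
    (hq : q ∈ smoothCurves (𝔪 : Set 𝔤)) (hdefect : ∀ i ≤ n, laxDefect A q i x = 0)
    (hcubic : ∀ x, laxCubic A q n x = 0) : Commute (adCLM A) (laxCubic A q (n + 1) x) := by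
  have hderiv := hasDerivAt_laxCubic hA hq (n := n) fun i hi => hdefect i hi.le
  rw [funext hcubic, hdefect n le_rfl] at hderiv
  rw [commute_iff_lie_eq]
  simpa [cubicDeriv_zero, Ring.lie_def] using hderiv.unique (hasDerivAt_const x 0)

lemma laxCubic_succ (q : ℝ → 𝔤) (n : ℕ) (x : ℝ) : laxCubic A q (n + 1) x =
    (cubic (adSeries (laxTrunc q (fun _ => A) n x))).coeff (n + 1) +
      cubicDeriv (adCLM A) (adCLM (lax q (fun _ => A) (n + 1) x)) := by
  set E := adSeries (fun i => if i ≤ n then 0 else lax q (fun _ => A) i x) with hE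
  have hsplit : adSeries (fun i => lax q (fun _ => A) i x) =
      adSeries (laxTrunc q (fun _ => A) n x) + E := by
    ext1 i
    rw [map_add, hE, coeff_adSeries, coeff_adSeries, coeff_adSeries, ← map_add, laxTrunc]
    split_ifs <;> simp
  have hdvd : PowerSeries.X ^ (n + 1) ∣ E := by
    rw [PowerSeries.X_pow_dvd_iff]
    intro i hi
    rw [hE, coeff_adSeries, if_pos (Nat.le_of_lt_succ hi), map_zero]
  rw [laxCubic, hsplit, coeff_cubic_add_of_X_pow_dvd n.succ_ne_zero hdvd,
    ← PowerSeries.coeff_zero_eq_constantCoeff_apply, hE, coeff_adSeries, coeff_adSeries,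
    if_neg (Nat.not_succ_le_self n), laxTrunc, if_pos n.zero_le, lax_zero]

/-- The centralizer part of `lax` is chosen so that it cancels the centralizer part of the left hand
side. -/
lemma adAdjoint_laxCubic_succ (hA : IsHermitianSymmetric 𝔥 𝔪 A)
    (hcomm : Commute (adCLM A) (laxCubic A q (n + 1) x)) :
    adAdjoint (cubicWeight (adCLM A) * laxCubic A q (n + 1) x) = 0 := by
  have hℓ := cubic_adCLM_eq_zero hA.cube
  set u := adAdjoint (cubicWeight (adCLM A) *
    (cubic (adSeries (laxTrunc q (fun _ => A) n x))).coeff (n + 1)) with hu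
  have hlax : cubicDeriv (adCLM A) (adCLM (lax q (fun _ => A) (n + 1) x)) =
      cubicDeriv (adCLM A) (adCLM (-centProj A u)) := by
    rw [lax_succ, ← lie_neg, sub_eq_add_neg, map_add, cubicDeriv_add, adCLM_lie,
      cubicDeriv_self_lie, hℓ, Ring.lie_def, zero_mul, mul_zero, sub_zero, zero_add]
  have hcent : ⁅A, -centProj A u⁆ = 0 := by rw [lie_neg, lie_centProj hA.cube, neg_zero]
  have hvalue : adAdjoint (cubicWeight (adCLM A) * laxCubic A q (n + 1) x) = u - centProj A u := by
    rw [laxCubic_succ, hlax, mul_add,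
      cubicWeight_mul_cubicDeriv hℓ (commute_adCLM_of_lie_eq_zero hcent), map_add,
      adAdjoint_adCLM, ← hu, sub_eq_add_neg]
  have hker : ⁅A, u⁆ = 0 := by
    have hlie : ⁅A, adAdjoint (cubicWeight (adCLM A) * laxCubic A q (n + 1) x)⁆ = 0 := by
      rw [lie_adAdjoint, ← cubicWeight_mul_lie, commute_iff_lie_eq.1 hcomm, mul_zero,
        map_zero]
    rwa [hvalue, lie_sub, lie_centProj hA.cube, sub_zero] at hlie
  rw [hvalue, centProj_of_lie_eq_zero hker, sub_self]

lemma exists_hasDerivAt_laxCubic_of_commute (hA : IsHermitianSymmetric 𝔥 𝔪 A)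
    (hq : q ∈ smoothCurves (𝔪 : Set 𝔤)) (hdefect : ∀ i < n, laxDefect A q i x = 0)
    (hcomm : Commute (adCLM A) (laxCubic A q n x)) :
    ∃ Y, HasDerivAt (laxCubic A q n)
      (⁅adCLM A, Y⁆ + cubicDeriv (adCLM A) (adCLM (laxDefect A q n x))) x := by
  refine ⟨laxCubic A q (n + 1) x - ⁅adCLM (-⁅A, q x⁆), laxCubic A q n x⁆, ?_⟩
  have hq_lie : adCLM (q x) = ⁅adCLM A, adCLM (-⁅A, q x⁆)⁆ := by
    rw [← adCLM_lie, lie_neg, hA.sq _ (hq.2 x), neg_neg]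
  convert hasDerivAt_laxCubic hA hq hdefect using 1
  rw [hq_lie, lie_lie_of_commute hcomm, Ring.lie_def (adCLM A), mul_sub, sub_mul,
    Ring.lie_def (adCLM A) (laxCubic A q (n + 1) x), Ring.lie_def (adCLM A) ⁅_, _⁆]
  abel

lemma centProj_adAdjoint_cubicWeight_mul (hA : IsHermitianSymmetric 𝔥 𝔪 A) (Y : 𝔤 →L[ℝ] 𝔤)
    {e : 𝔤} (he : ⁅A, e⁆ = 0) :
    centProj A (adAdjoint (cubicWeight (adCLM A) *
      (⁅adCLM A, Y⁆ + cubicDeriv (adCLM A) (adCLM e)))) = e := by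
  rw [mul_add, cubicWeight_mul_lie, cubicWeight_mul_cubicDeriv (cubic_adCLM_eq_zero hA.cube)
    (commute_adCLM_of_lie_eq_zero he), map_add, ← lie_adAdjoint, adAdjoint_adCLM, centProj_add,
    centProj_lie hA.cube, centProj_of_lie_eq_zero he, zero_add]

lemma hasDerivAt_laxCubic_zero (hA : IsHermitianSymmetric 𝔥 𝔪 A)
    (hq : q ∈ smoothCurves (𝔪 : Set 𝔤)) (hdefect : ∀ i ≤ n, laxDefect A q i x = 0)
    (hcomm : ∀ x, Commute (adCLM A) (laxCubic A q n x)) : HasDerivAt (laxCubic A q n) 0 x := by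
  obtain ⟨Y, hY⟩ :=
    exists_hasDerivAt_laxCubic_of_commute hA hq (fun i hi => hdefect i hi.le) (hcomm x)
  rw [hdefect n le_rfl, map_zero, cubicDeriv_zero, add_zero] at hY
  have hderiv := hY.const_mul (adCLM A)
  rw [funext fun x => (hcomm x).eq] at hderiv
  rwa [lie_eq_zero_of_lie_lie_eq_zero (cubic_adCLM_eq_zero hA.cube)
    (commute_iff_lie_eq.1 (hderiv.unique (hY.mul_const (adCLM A))))] at hY

lemma laxDefect_succ_eq_zero (hA : IsHermitianSymmetric 𝔥 𝔪 A)
    (hq : q ∈ smoothCurves (𝔪 : Set 𝔤)) (hdefect : ∀ i ≤ n, laxDefect A q i x = 0)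
    (hcomm : ∀ x, Commute (adCLM A) (laxCubic A q (n + 1) x)) : laxDefect A q (n + 1) x = 0 := by
  obtain ⟨Y, hY⟩ := exists_hasDerivAt_laxCubic_of_commute hA hq
    (fun i hi => hdefect i (Nat.le_of_lt_succ hi)) (hcomm x)
  have hderiv := (adAdjoint (𝔤 := 𝔤)).hasFDerivAt.comp_hasDerivAt x
    (hY.const_mul (cubicWeight (adCLM A)))
  rw [show adAdjoint ∘ _ = fun _ => (0 : 𝔤) from
    funext fun x => adAdjoint_laxCubic_succ hA (hcomm x)] at hderiv
  rw [← centProj_adAdjoint_cubicWeight_mul hA Y (lie_laxDefect hA),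
    hderiv.unique (hasDerivAt_const x 0), centProj_zero]

lemma laxDefect_and_laxCubic_eq_zero (hA : IsHermitianSymmetric 𝔥 𝔪 A) (n : ℕ) :
    ∀ q ∈ smoothCurves (𝔪 : Set 𝔤), ∀ x, laxDefect A q n x = 0 ∧ laxCubic A q n x = 0 := by
  induction n using Nat.strong_induction_on with
  | _ n ih =>
    cases n with
    | zero => exact fun q _ x => ⟨laxDefect_zero hA q x, laxCubic_zero hA q x⟩
    | succ n =>
      have hcomm (q) (hq : q ∈ smoothCurves (𝔪 : Set 𝔤)) (x) :
          Commute (adCLM A) (laxCubic A q (n + 1) x) :=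
        commute_laxCubic_succ hA hq (fun i hi => (ih i (Nat.lt_succ_of_le hi) q hq x).1)
          fun x => (ih n n.lt_succ_self q hq x).2
      have hdefect (q) (hq : q ∈ smoothCurves (𝔪 : Set 𝔤)) (x) : laxDefect A q (n + 1) x = 0 :=
        laxDefect_succ_eq_zero hA hq (fun i hi => (ih i (Nat.lt_succ_of_le hi) q hq x).1)
          (hcomm q hq)
      have hconst (q) (hq : q ∈ smoothCurves (𝔪 : Set 𝔤)) (x) :
          HasDerivAt (laxCubic A q (n + 1)) 0 x := by
        refine hasDerivAt_laxCubic_zero hA hq (fun i hi => ?_) (hcomm q hq)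
        rcases hi.lt_or_eq with hi | rfl
        · exact (ih i hi q hq x).1
        · exact hdefect q hq x
      refine fun q hq x => ⟨hdefect q hq x, ?_⟩
      exact DependsOnJet.eq_zero_of_zero (isJet_laxCubic _ A (n + 1)).dependsOnJet
        (fun q hq x y h => by rw [eq_of_forall_hasDerivAt_zero (hconst q hq) x y, h])
        (laxCubic_const hA (n + 1)) hq x

theorem lax_equation (hA : IsHermitianSymmetric 𝔥 𝔪 A) (hq : q ∈ smoothCurves (𝔪 : Set 𝔤)) (n : ℕ)
    (x : ℝ) : deriv (lax q (fun _ => A) n) x + ⁅q x, lax q (fun _ => A) n x⁆ =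
      ⁅A, lax q (fun _ => A) (n + 1) x⁆ := by
  rw [deriv_lax_add_lie hA, (laxDefect_and_laxCubic_eq_zero hA n q hq x).1, add_zero]

end CubicOfSolution

section IsospectralHierarchy

variable {𝔤 : Type*} [LieRing 𝔤] [LieAlgebra ℝ 𝔤] {𝔥 : LieSubalgebra ℝ 𝔤} {𝔪 : Submodule ℝ 𝔤}
  {A : 𝔤}

lemma IsHermitianSymmetric.centProj_lie_of_mem (hA : IsHermitianSymmetric 𝔥 𝔪 A) {y : 𝔤}
    (hy : y ∈ 𝔪) (z : 𝔤) : centProj A ⁅y, z⁆ = -⁅y, ⁅A, ⁅A, z⁆⁆⁆ := by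
  have hsplit : ⁅y, z⁆ = -⁅centProj A z, y⁆ + -⁅y, ⁅A, ⁅A, z⁆⁆⁆ := by
    rw [lie_skew, centProj, lie_add, add_neg_cancel_right]
  have hm : ⁅centProj A z, y⁆ ∈ 𝔪 :=
    hA.lie_h_m _ ((hA.centralizer _).1 (lie_centProj hA.cube z)) y hy
  have hh : ⁅A, ⁅y, ⁅A, ⁅A, z⁆⁆⁆⁆ = 0 := (hA.centralizer _).2 (hA.lie_m_m y hy _ (hA.lie_mem _))
  rw [hsplit, centProj_add, centProj_neg, centProj_neg, hA.centProj_of_mem hm,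
    centProj_of_lie_eq_zero hh, neg_zero, zero_add]

variable [IsCompactType 𝔤]

lemma Dinv_eq {F P : CurveFun 𝔤} (h : IsPrimitive 𝔪 F P) {q : ℝ → 𝔤}
    (hq : q ∈ smoothCurves (𝔪 : Set 𝔤)) : Dinv 𝔪 F q = P q := by
  have hex : ∃ P, IsPrimitive 𝔪 F P := ⟨P, h⟩
  rw [Dinv, dif_pos hex]
  exact IsPrimitive.eq h hex.choose_spec (fun _ _ _ => rfl) hq

variable [FiniteDimensional ℝ 𝔤] {q : ℝ → 𝔤}

lemma hasDerivAt_lie_lie_const (B : 𝔤) {f : ℝ → 𝔤} {f' : 𝔤} {x : ℝ} (h : HasDerivAt f f' x) :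
    HasDerivAt (fun x => ⁅B, ⁅B, f x⁆⁆) ⁅B, ⁅B, f'⁆⁆ x :=
  (adCLM B * adCLM B).hasFDerivAt.comp_hasDerivAt x h

lemma hasDerivAt_centProj_const (B : 𝔤) {f : ℝ → 𝔤} {f' : 𝔤} {x : ℝ} (h : HasDerivAt f f' x) :
    HasDerivAt (fun x => centProj B (f x)) (centProj B f') x :=
  h.add (hasDerivAt_lie_lie_const B h)

lemma centProj_deriv_lax (hA : IsHermitianSymmetric 𝔥 𝔪 A) (hq : q ∈ smoothCurves (𝔪 : Set 𝔤))
    (n : ℕ) (x : ℝ) :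
    centProj A (deriv (lax q (fun _ => A) n) x) = ⁅q x, ⁅A, ⁅A, lax q (fun _ => A) n x⁆⁆⁆ := by
  rw [eq_sub_iff_add_eq.2 (lax_equation hA hq n x), sub_eq_add_neg, centProj_add,
    centProj_lie hA.cube, zero_add, centProj_neg, hA.centProj_lie_of_mem (hq.2 x), neg_neg]

lemma isPrimitive_lax (hA : IsHermitianSymmetric 𝔥 𝔪 A) {F : CurveFun 𝔤} {n : ℕ}
    (hF : ∀ q ∈ smoothCurves (𝔪 : Set 𝔤), ∀ x, F q x = -⁅A, lax q (fun _ => A) (n + 1) x⁆) :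
    IsPrimitive 𝔪 (adq (Jinv A F)) (fun q x => centProj A (lax q (fun _ => A) (n + 1) x)) := by
  refine ⟨((isJet_const A).centProj (isJet_lax isJet_self (isJet_const A) (n + 1))).dependsOnJet,
    fun q hq x => ?_, fun x => ?_⟩
  · refine (hasDerivAt_centProj_const A
      (differentiable_lax hq (n + 1) x).hasDerivAt).congr_deriv ?_
    rw [centProj_deriv_lax hA hq, adq, Jinv, hF q hq x, lie_neg A, neg_neg]
  · change centProj A (lax (fun _ => 0) (fun _ => A) (n + 1) x) = 0
    rw [lax_const, centProj_zero]

theorem Rop_iterate (hA : IsHermitianSymmetric 𝔥 𝔪 A) (n : ℕ) :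
    ∀ q ∈ smoothCurves (𝔪 : Set 𝔤), ∀ x,
      ((Rop 𝔪 A)^[n] (Jq A)) q x = -⁅A, lax q (fun _ => A) (n + 1) x⁆ := by
  induction n with
  | zero =>
    intro q hq x
    rw [← lax_equation hA hq, lax_zero, deriv_const, zero_add, lie_skew]
    rfl
  | succ n ih =>
    intro q hq x
    rw [Function.iterate_succ_apply']
    set F := (Rop 𝔪 A)^[n] (Jq A)
    have hJinv : Jinv A F q = fun x => ⁅A, ⁅A, lax q (fun _ => A) (n + 1) x⁆⁆ := by
      funext x
      rw [Jinv, ih q hq x, lie_neg A, neg_neg]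
    have hcent := centProj_deriv_lax hA hq (n + 1) x
    rw [centProj, ← eq_sub_iff_add_eq'] at hcent
    rw [← lax_equation hA hq]
    change deriv (Jinv A F q) x - ⁅q x, Dinv 𝔪 (adq (Jinv A F)) q x⁆ = _
    rw [Dinv_eq (isPrimitive_lax hA ih) hq, hJinv,
      (hasDerivAt_lie_lie_const A (differentiable_lax hq (n + 1) x).hasDerivAt).deriv, hcent]
    simp only [centProj, lie_add]
    abel

end IsospectralHierarchy

section Calculus

variable {E F T : Type*} [NormedAddCommGroup E] [NormedSpace ℝ E] [NormedAddCommGroup F]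
  [NormedSpace ℝ F] [NormedAddCommGroup T] [NormedSpace ℝ T]

lemma hasDerivAt_slice_fst {f : ℝ × T → E} {x : ℝ} {t : T} (hf : DifferentiableAt ℝ f (x, t)) :
    HasDerivAt (fun s => f (s, t)) (fderiv ℝ f (x, t) (1, 0)) x :=
  hf.hasFDerivAt.comp_hasDerivAt x ((hasDerivAt_id x).prodMk (hasDerivAt_const x t))

lemma hasDerivAt_slice_snd {f : T × ℝ → E} {x : T} {t : ℝ} (hf : DifferentiableAt ℝ f (x, t)) :
    HasDerivAt (fun s => f (x, s)) (fderiv ℝ f (x, t) (0, 1)) t :=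
  hf.hasFDerivAt.comp_hasDerivAt t ((hasDerivAt_const t x).prodMk (hasDerivAt_id t))

lemma contDiffOn_fderiv_apply {f : F → E} {U : Set F} (hU : IsOpen U) (hf : ContDiffOn ℝ ∞ f U)
    (v : F) : ContDiffOn ℝ ∞ (fun p => fderiv ℝ f p v) U :=
  (hf.fderiv_of_isOpen hU (m := ∞) (by simp)).clm_apply contDiffOn_const

lemma fderiv_fderiv_comm {f : F → E} {p : F} (hf : ContDiffAt ℝ ∞ f p) (v w : F) :
    fderiv ℝ (fun p => fderiv ℝ f p v) p w = fderiv ℝ (fun p => fderiv ℝ f p w) p v := by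
  have hdf : DifferentiableAt ℝ (fderiv ℝ f) p :=
    (hf.fderiv_right (m := ∞) (by simp)).differentiableAt (by simp)
  have hsymm : IsSymmSndFDerivAt ℝ f p :=
    hf.isSymmSndFDerivAt (by rw [minSmoothness_of_isRCLikeNormedField]; exact ENat.LEInfty.out)
  have hswap : ∀ v w, fderiv ℝ (fun p => fderiv ℝ f p v) p w = fderiv ℝ (fderiv ℝ f) p w v := by
    intro v w
    rw [fderiv_clm_apply hdf (differentiableAt_const v)]
    simp
  rw [hswap, hswap, hsymm.eq]

lemma eq_of_hasDerivAt_zero {S : Set ℝ} (hS : IsOpen S) (hS' : IsPreconnected S) {f : ℝ → E}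
    (h : ∀ x ∈ S, HasDerivAt f 0 x) {x y : ℝ} (hx : x ∈ S) (hy : y ∈ S) : f x = f y :=
  hS.is_const_of_deriv_eq_zero hS'
    (fun x hx => (h x hx).differentiableAt.differentiableWithinAt) (fun x hx => (h x hx).deriv)
    hx hy

end Calculus

section Aut

variable {𝔤 : Type*} [LieRing 𝔤] [LieAlgebra ℝ 𝔤]

lemma aut_mul_apply (φ φ' : 𝔤 ≃ₗ⁅ℝ⁆ 𝔤) (y : 𝔤) : (φ * φ') y = φ (φ' y) := rfl

lemma aut_one_apply (y : 𝔤) : (1 : 𝔤 ≃ₗ⁅ℝ⁆ 𝔤) y = y := rfl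

lemma aut_apply_inv_apply (φ : 𝔤 ≃ₗ⁅ℝ⁆ 𝔤) (y : 𝔤) : φ (φ⁻¹ y) = y := φ.apply_symm_apply y

lemma aut_inv_apply_apply (φ : 𝔤 ≃ₗ⁅ℝ⁆ 𝔤) (y : 𝔤) : φ⁻¹ (φ y) = y := φ.symm_apply_apply y

variable [IsCompactType 𝔤]

open scoped RealInnerProductSpace

lemma inner_aut_inv_left (φ : 𝔤 ≃ₗ⁅ℝ⁆ 𝔤) (x y : 𝔤) : ⟪φ⁻¹ x, y⟫ = ⟪x, φ y⟫ := by
  rw [← inner_lieEquiv φ, aut_apply_inv_apply]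

lemma norm_lieEquiv (φ : 𝔤 ≃ₗ⁅ℝ⁆ 𝔤) (x : 𝔤) : ‖φ x‖ = ‖x‖ := by
  rw [← sq_eq_sq₀ (norm_nonneg _) (norm_nonneg _), ← real_inner_self_eq_norm_sq,
    ← real_inner_self_eq_norm_sq, inner_lieEquiv]

lemma eq_of_hasDerivAt_lie {S : Set ℝ} (hS : IsOpen S) (hS' : IsPreconnected S) {b f g : ℝ → 𝔤}
    (hf : ∀ x ∈ S, HasDerivAt f ⁅b x, f x⁆ x) (hg : ∀ x ∈ S, HasDerivAt g ⁅b x, g x⁆ x)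
    {x₀ : ℝ} (hx₀ : x₀ ∈ S) (h₀ : f x₀ = g x₀) {x : ℝ} (hx : x ∈ S) : f x = g x := by
  have hderiv : ∀ z ∈ S, HasDerivAt (fun z => ‖f z - g z‖ ^ 2) 0 z := by
    intro z hz
    convert ((hf z hz).fun_sub (hg z hz)).norm_sq using 1
    have hskew := inner_lie_left (b z) (f z - g z) (f z - g z)
    rw [real_inner_comm] at hskew
    rw [← lie_sub]
    linarith
  have hnorm := eq_of_hasDerivAt_zero hS hS' hderiv hx hx₀
  rwa [h₀, sub_self, norm_zero, zero_pow two_ne_zero, sq_eq_zero_iff, norm_eq_zero,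
    sub_eq_zero] at hnorm

variable [FiniteDimensional ℝ 𝔤]

section Smoothness

variable {P : Type*} [NormedAddCommGroup P] [NormedSpace ℝ P] {U : Set P}

lemma contDiffOn_of_inner {f : P → 𝔤} (h : ∀ z, ContDiffOn ℝ ∞ (fun p => ⟪f p, z⟫) U) :
    ContDiffOn ℝ ∞ f U := by
  have hsum : f = fun p => ∑ i, ⟪stdOrthonormalBasis ℝ 𝔤 i, f p⟫ • stdOrthonormalBasis ℝ 𝔤 i :=
    funext fun p => ((stdOrthonormalBasis ℝ 𝔤).sum_repr' (f p)).symm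
  rw [hsum]
  exact ContDiffOn.sum fun i _ =>
    ((h _).congr fun p _ => real_inner_comm _ _).smul contDiffOn_const

lemma hasDerivAt_of_inner {f : ℝ → 𝔤} {f' : 𝔤} {x : ℝ}
    (h : ∀ z, HasDerivAt (fun p => ⟪f p, z⟫) ⟪f', z⟫ x) : HasDerivAt f f' x := by
  have hsum : ∀ y : 𝔤, y = ∑ i, ⟪stdOrthonormalBasis ℝ 𝔤 i, y⟫ • stdOrthonormalBasis ℝ 𝔤 i :=
    fun y => ((stdOrthonormalBasis ℝ 𝔤).sum_repr' y).symm
  rw [hsum f', show f = _ from funext fun p => hsum (f p)]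
  refine HasDerivAt.fun_sum fun i _ => HasDerivAt.smul_const ?_ _
  simpa only [real_inner_comm (stdOrthonormalBasis ℝ 𝔤 i)] using h (stdOrthonormalBasis ℝ 𝔤 i)

lemma contDiffOn_lie {f g : P → 𝔤} (hf : ContDiffOn ℝ ∞ f U) (hg : ContDiffOn ℝ ∞ g U) :
    ContDiffOn ℝ ∞ (fun p => ⁅f p, g p⁆) U :=
  ((adCLM (𝔤 := 𝔤)).contDiff.comp_contDiffOn hf).clm_apply hg

lemma hasDerivAt_lie {f g : ℝ → 𝔤} {f' g' : 𝔤} {x : ℝ} (hf : HasDerivAt f f' x)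
    (hg : HasDerivAt g g' x) : HasDerivAt (fun x => ⁅f x, g x⁆) (⁅f', g x⁆ + ⁅f x, g'⁆) x :=
  ((adCLM (𝔤 := 𝔤)).hasFDerivAt.comp_hasDerivAt x hf).clm_apply hg

variable {φ : P → 𝔤 ≃ₗ⁅ℝ⁆ 𝔤}

lemma contDiffOn_autCLM (h : ∀ y, ContDiffOn ℝ ∞ (fun p => φ p y) U) :
    ContDiffOn ℝ ∞ (fun p => autCLM (φ p)) U := contDiffOn_clm_apply.2 h

lemma contDiffOn_aut_apply (h : ∀ y, ContDiffOn ℝ ∞ (fun p => φ p y) U) {f : P → 𝔤}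
    (hf : ContDiffOn ℝ ∞ f U) : ContDiffOn ℝ ∞ (fun p => φ p (f p)) U :=
  (contDiffOn_autCLM h).clm_apply hf

lemma contDiffOn_aut_inv (h : ∀ y, ContDiffOn ℝ ∞ (fun p => φ p y) U) (y : 𝔤) :
    ContDiffOn ℝ ∞ (fun p => (φ p)⁻¹ y) U := by
  refine contDiffOn_of_inner fun z => ?_
  simp only [inner_aut_inv_left]
  exact contDiffOn_const.inner ℝ (h z)

lemma hasDerivAt_aut_inv {φ : ℝ → 𝔤 ≃ₗ⁅ℝ⁆ 𝔤} {b : 𝔤} {x : ℝ}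
    (h : ∀ y, HasDerivAt (fun s => φ s y) ⁅-b, φ x y⁆ x) (y : 𝔤) :
    HasDerivAt (fun s => (φ s)⁻¹ y) ((φ x)⁻¹ ⁅b, y⁆) x := by
  refine hasDerivAt_of_inner fun z => ?_
  simp only [inner_aut_inv_left]
  have hinner := (hasDerivAt_const x y).inner ℝ (h z)
  rwa [inner_zero_left, add_zero, neg_lie, inner_neg_right, ← inner_lie_left] at hinner

end Smoothness

open Classical in
/-- A continuous linear map as a Lie algebra automorphism, with junk value `1` if it is not one. -/
noncomputable def autOf (C : 𝔤 →L[ℝ] 𝔤) : 𝔤 ≃ₗ⁅ℝ⁆ 𝔤 :=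
  if h : (∀ y z, C ⁅y, z⁆ = ⁅C y, C z⁆) ∧ Function.Bijective C then
    LieEquiv.ofBijective { (C : 𝔤 →ₗ[ℝ] 𝔤) with map_lie' := fun {y z} => h.1 y z } h.2
  else 1

lemma autOf_apply {C : 𝔤 →L[ℝ] 𝔤} (hinner : ∀ y z, ⟪C y, C z⟫ = ⟪y, z⟫)
    (htriple : ∀ y z w, ⟪⁅C y, C z⁆, C w⟫ = ⟪⁅y, z⁆, w⟫) (y : 𝔤) : autOf C y = C y := by
  have hinj : Function.Injective (C : 𝔤 →ₗ[ℝ] 𝔤) := by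
    rw [injective_iff_map_eq_zero]
    intro y hy
    rw [← inner_self_eq_zero (𝕜 := ℝ), ← hinner, show C y = 0 from hy, inner_zero_left]
  have hsurj : Function.Surjective C := LinearMap.injective_iff_surjective.1 hinj
  have hlie : ∀ y z, C ⁅y, z⁆ = ⁅C y, C z⁆ := by
    intro y z
    refine ext_inner_right ℝ fun v => ?_
    obtain ⟨w, rfl⟩ := hsurj v
    rw [hinner, htriple]
  rw [autOf, dif_pos ⟨hlie, hinj, hsurj⟩]
  rfl

lemma autOf_one : autOf (1 : 𝔤 →L[ℝ] 𝔤) = 1 :=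
  LieEquiv.ext fun y => autOf_apply (by simp) (by simp) y

section LieTransport

variable {T : Type*}

/-- The solution `φ` of `φₓ = ad(b) φ` with `φ(x₀, t) = 1`, as a family of automorphisms. -/
noncomputable def lieTransport (x₀ : ℝ) (b : ℝ × T → 𝔤) (p : ℝ × T) : 𝔤 ≃ₗ⁅ℝ⁆ 𝔤 :=
  autOf (fundamentalSolution x₀ (fun p => adCLM (b p)) p)

lemma lieTransport_base (x₀ : ℝ) (b : ℝ × T → 𝔤) (t : T) : lieTransport x₀ b (x₀, t) = 1 := by
  have : CompleteSpace 𝔤 := FiniteDimensional.complete ℝ 𝔤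
  rw [lieTransport, fundamentalSolution_base, autOf_one]

variable [NormedAddCommGroup T] [NormedSpace ℝ T] [FiniteDimensional ℝ T] {U : Set (ℝ × T)}
  {x₀ : ℝ} {b : ℝ × T → 𝔤}

lemma hasDerivAt_fundamentalSolution_adCLM (hUo : IsOpen U)
    (hU : ∀ t, StarConvex ℝ x₀ {x | (x, t) ∈ U}) (hb : ContDiffOn ℝ ∞ b U) {x : ℝ} {t : T}
    (hp : (x, t) ∈ U) (y : 𝔤) :
    HasDerivAt (fun s => fundamentalSolution x₀ (fun p => adCLM (b p)) (s, t) y)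
      ⁅b (x, t), fundamentalSolution x₀ (fun p => adCLM (b p)) (x, t) y⁆ x := by
  have : CompleteSpace 𝔤 := FiniteDimensional.complete ℝ 𝔤
  simpa using (hasDerivAt_fundamentalSolution hUo hU (a := fun p => adCLM (b p))
    ((adCLM (𝔤 := 𝔤)).contDiff.comp_contDiffOn hb) hp).clm_apply (hasDerivAt_const x y)

lemma lieTransport_apply (hUo : IsOpen U) (hU : ∀ t, StarConvex ℝ x₀ {x | (x, t) ∈ U})
    (hb : ContDiffOn ℝ ∞ b U) {p : ℝ × T} (hp : p ∈ U) (y : 𝔤) :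
    lieTransport x₀ b p y = fundamentalSolution x₀ (fun p => adCLM (b p)) p y := by
  have : CompleteSpace 𝔤 := FiniteDimensional.complete ℝ 𝔤
  obtain ⟨x, t⟩ := p
  set u : ℝ → 𝔤 →L[ℝ] 𝔤 := fun x => fundamentalSolution x₀ (fun p => adCLM (b p)) (x, t)
  have hu₀ : u x₀ = 1 := fundamentalSolution_base x₀ _ t
  have hS : IsOpen {x : ℝ | (x, t) ∈ U} := hUo.preimage (by fun_prop)
  have hx₀ : (x₀, t) ∈ U := by simpa using ray_mem hU hp 0
  have hS' : IsPreconnected {x : ℝ | (x, t) ∈ U} :=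
    ((hU t).isPathConnected hx₀).isConnected.isPreconnected
  have hu : ∀ x ∈ {x : ℝ | (x, t) ∈ U}, ∀ y, HasDerivAt (fun s => u s y) ⁅b (x, t), u x y⁆ x :=
    fun x hx y => hasDerivAt_fundamentalSolution_adCLM hUo hU hb hx y
  refine autOf_apply (C := u x) (fun y z => ?_) (fun y z w => ?_) y
  · have hconst := eq_of_hasDerivAt_zero hS hS' (f := fun x => ⟪u x y, u x z⟫) (fun x hx =>
      ((hu x hx y).inner ℝ (hu x hx z)).congr_deriv (by rw [inner_lie_left]; ring)) hp hx₀
    simpa [hu₀] using hconst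
  · have hconst := eq_of_hasDerivAt_zero hS hS' (f := fun x => ⟪⁅u x y, u x z⁆, u x w⟫)
      (fun x hx => ((hasDerivAt_lie (hu x hx y) (hu x hx z)).inner ℝ (hu x hx w)).congr_deriv
        (by rw [← leibniz_lie, inner_lie_left (b (x, t))]; ring)) hp hx₀
    simpa [hu₀] using hconst

lemma contDiffOn_lieTransport (hUo : IsOpen U) (hU : ∀ t, StarConvex ℝ x₀ {x | (x, t) ∈ U})
    (hb : ContDiffOn ℝ ∞ b U) (y : 𝔤) :
    ContDiffOn ℝ ∞ (fun p => lieTransport x₀ b p y) U := by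
  have : CompleteSpace 𝔤 := FiniteDimensional.complete ℝ 𝔤
  exact ((contDiffOn_fundamentalSolution hUo hU
    ((adCLM (𝔤 := 𝔤)).contDiff.comp_contDiffOn hb)).clm_apply contDiffOn_const).congr
      fun p hp => lieTransport_apply hUo hU hb hp y

lemma hasDerivAt_lieTransport (hUo : IsOpen U) (hU : ∀ t, StarConvex ℝ x₀ {x | (x, t) ∈ U})
    (hb : ContDiffOn ℝ ∞ b U) {x : ℝ} {t : T} (hp : (x, t) ∈ U) (y : 𝔤) :
    HasDerivAt (fun s => lieTransport x₀ b (s, t) y) ⁅b (x, t), lieTransport x₀ b (x, t) y⁆ x := by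
  have hS : IsOpen {x : ℝ | (x, t) ∈ U} := hUo.preimage (by fun_prop)
  rw [lieTransport_apply hUo hU hb hp]
  refine (hasDerivAt_fundamentalSolution_adCLM hUo hU hb hp y).congr_of_eventuallyEq ?_
  filter_upwards [hS.mem_nhds hp] with s hs using lieTransport_apply hUo hU hb hs y

lemma lieTransport_mem_adjointGroup (hUo : IsOpen U)
    (hU : ∀ t, StarConvex ℝ x₀ {x | (x, t) ∈ U}) (hb : ContDiffOn ℝ ∞ b U) {p : ℝ × T}
    (hp : p ∈ U) : lieTransport x₀ b p ∈ adjointGroup 𝔤 := by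
  refine ⟨fun s => lieTransport x₀ b (x₀ + projIcc (0 : ℝ) 1 zero_le_one s * (p.1 - x₀), p.2),
    fun y => ?_, ?_, ?_⟩
  · exact (contDiffOn_lieTransport hUo hU hb y).continuousOn.comp_continuous
      (by fun_prop) fun s => ray_mem hU hp _
  · simp [lieTransport_base]
  · simp

end LieTransport

end Aut

section Frames

variable {𝔤 : Type*} [LieRing 𝔤] [LieAlgebra ℝ 𝔤] [FiniteDimensional ℝ 𝔤] [IsCompactType 𝔤]
  {𝔥 : LieSubalgebra ℝ 𝔤} {𝔪 : Submodule ℝ 𝔤} {A : 𝔤} {I : Set ℝ}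

lemma lie_lie_lie_of_mem_symmetricSpace (hA : IsHermitianSymmetric 𝔥 𝔪 A) {v : 𝔤}
    (hv : v ∈ symmetricSpace A) (y : 𝔤) : ⁅v, ⁅v, ⁅v, y⁆⁆⁆ = -⁅v, y⁆ := by
  obtain ⟨φ, -, rfl⟩ := hv
  obtain ⟨y, rfl⟩ : ∃ z, φ z = y := φ.surjective y
  rw [← LieEquiv.map_lie, ← LieEquiv.map_lie, ← LieEquiv.map_lie, hA.cube, map_neg]

/-- Differentiating `cubic (ad γ) = 0` gives `cubicDeriv (ad γ) (ad γ') = 0`, and `cubicDeriv`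
is injective on the centralizer of `ad γ`. -/
lemma centProj_deriv_eq_zero {γ : ℝ → 𝔤} {γ' : 𝔤} {x : ℝ}
    (hγ : ∀ᶠ s in 𝓝 x, ∀ y : 𝔤, ⁅γ s, ⁅γ s, ⁅γ s, y⁆⁆⁆ = -⁅γ s, y⁆) (h : HasDerivAt γ γ' x) :
    centProj (γ x) γ' = 0 := by
  have hx := hγ.self_of_nhds
  have had : HasDerivAt (fun s => adCLM (γ s)) (adCLM γ') x :=
    (adCLM (𝔤 := 𝔤)).hasFDerivAt.comp_hasDerivAt x h
  have hzero : (fun s => cubic (adCLM (γ s))) =ᶠ[𝓝 x] fun _ => 0 := by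
    filter_upwards [hγ] with s hs using cubic_adCLM_eq_zero hs
  have hcubic : HasDerivAt (fun s => cubic (adCLM (γ s)))
      (cubicDeriv (adCLM (γ x)) (adCLM γ')) x :=
    (((had.fun_mul had).fun_mul had).fun_add had).congr_deriv (by
      simp only [cubicDeriv]; noncomm_ring)
  have hderiv := hcubic.unique ((hasDerivAt_const x 0).congr_of_eventuallyEq hzero)
  have hsplit : γ' = centProj (γ x) γ' + ⁅γ x, -⁅γ x, γ'⁆⁆ := by
    rw [centProj, lie_neg, add_neg_cancel_right]
  have hcomm : Commute (adCLM (γ x)) (adCLM (centProj (γ x) γ')) := by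
    rw [commute_iff_lie_eq, ← adCLM_lie, lie_centProj hx, map_zero]
  rw [hsplit, map_add, cubicDeriv_add, adCLM_lie, cubicDeriv_self_lie, cubic_adCLM_eq_zero hx,
    Ring.lie_def, zero_mul, mul_zero, sub_zero, add_zero] at hderiv
  apply adCLM_injective
  rw [← cubicWeight_mul_cubicDeriv (cubic_adCLM_eq_zero hx) hcomm, hderiv, mul_zero, map_zero]

lemma lie_lie_deriv {γ : ℝ → 𝔤} {γ' : 𝔤} {x : ℝ}
    (hγ : ∀ᶠ s in 𝓝 x, ∀ y : 𝔤, ⁅γ s, ⁅γ s, ⁅γ s, y⁆⁆⁆ = -⁅γ s, y⁆) (h : HasDerivAt γ γ' x) :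
    ⁅⁅γ x, γ'⁆, γ x⁆ = γ' := by
  rw [← lie_skew]
  exact (eq_neg_of_add_eq_zero_left (centProj_deriv_eq_zero hγ h)).symm

lemma apply_eq_of_hasDerivAt_lie_lie (hA : IsHermitianSymmetric 𝔥 𝔪 A) (hI : IsOpen I)
    (hI' : IsPreconnected I) {γ γ' : ℝ → 𝔤} (hγ : ∀ t ∈ I, γ t ∈ symmetricSpace A)
    (hγ' : ∀ t ∈ I, HasDerivAt γ (γ' t) t) {φ : ℝ → 𝔤 ≃ₗ⁅ℝ⁆ 𝔤} {v : 𝔤}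
    (hφ : ∀ t ∈ I, HasDerivAt (fun s => φ s v) ⁅⁅γ t, γ' t⁆, φ t v⁆ t) {t₀ : ℝ} (ht₀ : t₀ ∈ I)
    (hv : φ t₀ v = γ t₀) {t : ℝ} (ht : t ∈ I) : φ t v = γ t := by
  refine eq_of_hasDerivAt_lie hI hI' hφ (fun t ht => ?_) ht₀ hv ht
  refine (hγ' t ht).congr_deriv (lie_lie_deriv ?_ (hγ' t ht)).symm
  filter_upwards [hI.mem_nhds ht] with s hs using lie_lie_lie_of_mem_symmetricSpace hA (hγ s hs)

lemma starConvex_strip (x₀ : ℝ) (I : Set ℝ) (t : ℝ) :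
    StarConvex ℝ x₀ {x | (x, t) ∈ (univ : Set ℝ) ×ˢ I} := fun _ hx _ _ _ _ _ => ⟨mem_univ _, hx.2⟩

lemma exists_smooth_path (hI : IsOpen I) (hI' : I.OrdConnected) {b : ℝ → 𝔤}
    (hb : ContDiffOn ℝ ∞ b I) {t₀ : ℝ} (ht₀ : t₀ ∈ I) :
    ∃ φ : ℝ → 𝔤 ≃ₗ⁅ℝ⁆ 𝔤, IsSmoothPath (adjointGroup 𝔤) I φ ∧ φ t₀ = 1 ∧
      ∀ t ∈ I, ∀ y, HasDerivAt (fun s => φ s y) ⁅b t, φ t y⁆ t := by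
  have hUo : IsOpen (I ×ˢ (univ : Set ℝ)) := hI.prod isOpen_univ
  have hU : ∀ s, StarConvex ℝ t₀ {t | (t, s) ∈ I ×ˢ (univ : Set ℝ)} := fun s => by
    simpa using hI'.convex.starConvex ht₀
  have hb' : ContDiffOn ℝ ∞ (fun p : ℝ × ℝ => b p.1) (I ×ˢ univ) :=
    hb.comp contDiffOn_fst fun p hp => hp.1
  have hmem : ∀ t ∈ I, (t, (0 : ℝ)) ∈ I ×ˢ univ := fun t ht => ⟨ht, mem_univ _⟩
  refine ⟨fun t => lieTransport t₀ (fun p : ℝ × ℝ => b p.1) (t, 0),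
    ⟨fun t ht => lieTransport_mem_adjointGroup hUo hU hb' (hmem t ht), fun y => ?_⟩,
    lieTransport_base _ _ 0, fun t ht y => hasDerivAt_lieTransport hUo hU hb' (hmem t ht) y⟩
  exact (contDiffOn_lieTransport hUo hU hb' y).comp (f := fun t : ℝ => (t, (0 : ℝ)))
    (by fun_prop) hmem

lemma exists_smooth_path_lift (hA : IsHermitianSymmetric 𝔥 𝔪 A) (hI : IsOpen I)
    (hI' : I.OrdConnected) {γ : ℝ → 𝔤} (hγ : ContDiffOn ℝ ∞ γ I)
    (hmem : ∀ t ∈ I, γ t ∈ symmetricSpace A) :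
    ∃ φ, IsSmoothPath (adjointGroup 𝔤) I φ ∧ ∀ t ∈ I, φ t A = γ t := by
  rcases I.eq_empty_or_nonempty with rfl | ⟨t₀, ht₀⟩
  · exact ⟨fun _ => 1, ⟨by simp, by simp⟩, by simp⟩
  have hγ' : ∀ t ∈ I, HasDerivAt γ (deriv γ t) t := fun t ht =>
    ((hγ.differentiableOn (by simp)).differentiableAt (hI.mem_nhds ht)).hasDerivAt
  obtain ⟨φ₀, hφ₀, hφ₀A⟩ := hmem t₀ ht₀
  obtain ⟨φ, ⟨hφG, hφ⟩, hφ1, hφ'⟩ := exists_smooth_path hI hI' (b := fun t => ⁅γ t, deriv γ t⁆)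
    (contDiffOn_lie hγ (hγ.deriv_of_isOpen hI (by simp))) ht₀
  exact ⟨fun t => φ t * φ₀, ⟨fun t ht => mul_mem (hφG t ht) hφ₀, fun y => hφ (φ₀ y)⟩,
    fun t ht => apply_eq_of_hasDerivAt_lie_lie hA hI hI'.isPreconnected hmem hγ'
      (fun t ht => hφ' t ht (φ₀ A)) ht₀ (by rw [hφ1, aut_one_apply, hφ₀A]) ht⟩

lemma exists_frame_of_hasimoto (hI : IsOpen I) {q : ℝ → ℝ → 𝔤}
    (hq : IsSmoothField (𝔪 : Set 𝔤) I q) : ∃ ψ χ, IsParallelFrame 𝔪 A I ψ χ q := by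
  have hUo : IsOpen ((univ : Set ℝ) ×ˢ I) := isOpen_univ.prod hI
  have hU := starConvex_strip 0 I
  let φ : ℝ × ℝ → 𝔤 ≃ₗ⁅ℝ⁆ 𝔤 := lieTransport 0 fun p => -q p.1 p.2
  refine ⟨fun x t => (φ (x, t))⁻¹, fun x t => (φ (x, t))⁻¹ A,
    fun x t ht => inv_mem (lieTransport_mem_adjointGroup hUo hU hq.1.neg ⟨mem_univ _, ht⟩),
    contDiffOn_aut_inv (contDiffOn_lieTransport hUo hU hq.1.neg),
    fun _ _ _ => rfl, hq.2, fun x t ht y => ?_⟩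
  exact (hasDerivAt_aut_inv
    (hasDerivAt_lieTransport hUo hU hq.1.neg ⟨mem_univ _, ht⟩) y).deriv

lemma exists_frame_of_map (hA : IsHermitianSymmetric 𝔥 𝔪 A) (hI : IsOpen I) (hI' : I.OrdConnected)
    {χ : ℝ → ℝ → 𝔤} (hχ : IsSmoothField (symmetricSpace A) I χ) :
    ∃ ψ q, IsParallelFrame 𝔪 A I ψ χ q := by
  have hUo : IsOpen ((univ : Set ℝ) ×ˢ I) := isOpen_univ.prod hI
  have hU := starConvex_strip 0 I
  have hmem : ∀ (x : ℝ), ∀ t ∈ I, (x, t) ∈ (univ : Set ℝ) ×ˢ I := fun x t ht => ⟨mem_univ _, ht⟩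
  set f : ℝ × ℝ → 𝔤 := fun p => χ p.1 p.2
  have hf' : ∀ (x : ℝ), ∀ t ∈ I, HasDerivAt (fun x => χ x t) (fderiv ℝ f (x, t) (1, 0)) x :=
    fun x t ht => hasDerivAt_slice_fst
      ((hχ.1.differentiableOn (by simp)).differentiableAt (hUo.mem_nhds (hmem x t ht)))
  obtain ⟨φ, ⟨hφG, hφ⟩, hφA⟩ := exists_smooth_path_lift hA hI hI' (γ := χ 0)
    (hχ.1.comp (f := fun t : ℝ => ((0 : ℝ), t)) (by fun_prop) (hmem 0)) (hχ.2 0)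
  set b : ℝ × ℝ → 𝔤 := fun p => ⁅f p, fderiv ℝ f p (1, 0)⁆
  have hb : ContDiffOn ℝ ∞ b (univ ×ˢ I) :=
    contDiffOn_lie hχ.1 (contDiffOn_fderiv_apply hUo hχ.1 (1, 0))
  set ψ : ℝ → ℝ → 𝔤 ≃ₗ⁅ℝ⁆ 𝔤 := fun x t => lieTransport 0 b (x, t) * φ t
  have hψ' : ∀ (x : ℝ), ∀ t ∈ I, ∀ y, HasDerivAt (fun s => ψ s t y) ⁅b (x, t), ψ x t y⁆ x :=
    fun x t ht y => hasDerivAt_lieTransport hUo hU hb (hmem x t ht) (φ t y)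
  have hψA : ∀ x, ∀ t ∈ I, ψ x t A = χ x t := fun x t ht =>
    apply_eq_of_hasDerivAt_lie_lie hA isOpen_univ isPreconnected_univ (φ := fun x => ψ x t)
      (γ := fun x => χ x t) (fun x _ => hχ.2 x t ht) (fun x _ => hf' x t ht)
      (fun x _ => hψ' x t ht A) (mem_univ 0)
      (by rw [aut_mul_apply, lieTransport_base, aut_one_apply, hφA t ht]) (mem_univ x)
  refine ⟨ψ, fun x t => (ψ x t)⁻¹ (b (x, t)), fun x t ht => ?_, fun y => ?_,
    fun x t ht => (hψA x t ht).symm, fun x t ht => ?_, fun x t ht y => ?_⟩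
  · exact mul_mem (lieTransport_mem_adjointGroup hUo hU hb (hmem x t ht)) (hφG t ht)
  · exact contDiffOn_aut_apply (contDiffOn_lieTransport hUo hU hb)
      ((hφ y).comp contDiffOn_snd fun p hp => hp.2)
  · have hinv : (ψ x t)⁻¹ (f (x, t)) = A := by
      rw [← aut_inv_apply_apply (ψ x t) A, hψA x t ht]
    rw [LieEquiv.map_lie, hinv]
    exact hA.lie_mem _
  · rw [(hψ' x t ht y).deriv, LieEquiv.map_lie, aut_apply_inv_apply]

end Frames

section Orbit

variable {𝔤 : Type*} [LieRing 𝔤] [LieAlgebra ℝ 𝔤] {𝔥 : LieSubalgebra ℝ 𝔤} {𝔪 : Submodule ℝ 𝔤}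
  {A : 𝔤}

lemma add_mul_self_smul_lie_lie (s : ℝ) (v y : 𝔤) :
    y + (s * s) • ⁅v, ⁅v, y⁆⁆ = centProj (s • v) y := by
  rw [centProj, smul_lie, smul_lie, lie_smul, smul_smul]

lemma exists_mem_apply_eq_of_centProj_eq_zero (hA : IsHermitianSymmetric 𝔥 𝔪 A)
    (φ : 𝔤 ≃ₗ⁅ℝ⁆ 𝔤) {y : 𝔤} (hy : centProj (φ A) y = 0) : ∃ z ∈ 𝔪, φ z = y := by
  refine ⟨φ.symm y, ?_, φ.apply_symm_apply y⟩
  rw [← φ.apply_symm_apply y, centProj_map] at hy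
  have hzero : centProj A (φ.symm y) = 0 := φ.injective (hy.trans (map_zero φ).symm)
  rw [eq_neg_of_add_eq_zero_left hzero]
  exact 𝔪.neg_mem (hA.lie_mem _)

end Orbit

section CurveFrames

variable {𝔤 : Type*} [LieRing 𝔤] [LieAlgebra ℝ 𝔤] [IsCompactType 𝔤]

lemma Hinv_eq {N : Set 𝔤} {c : ℝ} {F P : CurveFun 𝔤} (h : IsHPrimitive N c F P) {γ : ℝ → 𝔤}
    (hγ : γ ∈ smoothCurves N) : Hinv N c F γ = P γ := by
  have hex : ∃ P, IsHPrimitive N c F P := ⟨P, h⟩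
  rw [Hinv, dif_pos hex]
  exact IsHPrimitive.eq h hex.choose_spec (fun _ _ _ => rfl) hγ

lemma hasDerivAt_smoothCurves {N : Set 𝔤} {γ : ℝ → 𝔤} (hγ : γ ∈ smoothCurves N) (x : ℝ) :
    HasDerivAt γ (deriv γ x) x := (hγ.1.differentiable (by simp) x).hasDerivAt

lemma IsSmoothField.slice {N : Set 𝔤} {I : Set ℝ} {f : ℝ → ℝ → 𝔤} (hf : IsSmoothField N I f)
    {t : ℝ} (ht : t ∈ I) : (fun x => f x t) ∈ smoothCurves N := by
  refine ⟨?_, fun x => hf.2 x t ht⟩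
  rw [← contDiffOn_univ]
  exact hf.1.comp (f := fun x : ℝ => (x, t)) (by fun_prop) fun x _ => ⟨mem_univ _, ht⟩

variable [FiniteDimensional ℝ 𝔤] {𝔥 : LieSubalgebra ℝ 𝔤} {𝔪 : Submodule ℝ 𝔤} {A : 𝔤} {I : Set ℝ}

namespace IsParallelFrame

variable {ψ : ℝ → ℝ → 𝔤 ≃ₗ⁅ℝ⁆ 𝔤} {χ q : ℝ → ℝ → 𝔤}

lemma differentiableAt (h : IsParallelFrame 𝔪 A I ψ χ q) (hI : IsOpen I) (x : ℝ) {t : ℝ}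
    (ht : t ∈ I) (y : 𝔤) : DifferentiableAt ℝ (fun p : ℝ × ℝ => ψ p.1 p.2 y) (x, t) :=
  ((h.smooth y).differentiableOn (by simp)).differentiableAt
    ((isOpen_univ.prod hI).mem_nhds ⟨mem_univ _, ht⟩)

lemma hasLogDeriv (h : IsParallelFrame 𝔪 A I ψ χ q) (hI : IsOpen I) {t : ℝ} (ht : t ∈ I) :
    HasLogDeriv (fun x => ψ x t) (fun x => q x t) univ := fun x _ y => by
  rw [← h.deriv_eq x t ht y]
  exact (hasDerivAt_slice_fst (h.differentiableAt hI x ht y)).differentiableAt.hasDerivAt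

lemma isSmoothField_map (h : IsParallelFrame 𝔪 A I ψ χ q) :
    IsSmoothField (symmetricSpace A) I χ :=
  ⟨(h.smooth A).congr fun p hp => h.map_eq p.1 p.2 hp.2,
    fun x t ht => ⟨ψ x t, h.mem x t ht, (h.map_eq x t ht).symm⟩⟩

lemma isSmoothField_hasimoto (hA : IsHermitianSymmetric 𝔥 𝔪 A)
    (h : IsParallelFrame 𝔪 A I ψ χ q) (hI : IsOpen I) : IsSmoothField (𝔪 : Set 𝔤) I q := by
  refine ⟨?_, h.q_mem⟩
  have hderiv : ContDiffOn ℝ ∞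
      (fun p => fderiv ℝ (fun p : ℝ × ℝ => ψ p.1 p.2 A) p (1, 0)) (univ ×ˢ I) :=
    contDiffOn_fderiv_apply (isOpen_univ.prod hI) (h.smooth A) (1, 0)
  refine (contDiffOn_lie contDiffOn_const
    (contDiffOn_aut_apply (contDiffOn_aut_inv h.smooth) hderiv) (f := fun _ => A)).congr ?_
  rintro ⟨x, t⟩ ⟨-, ht : t ∈ I⟩
  have hx : fderiv ℝ (fun p : ℝ × ℝ => ψ p.1 p.2 A) (x, t) (1, 0) = ψ x t ⁅q x t, A⁆ :=
    (hasDerivAt_slice_fst (h.differentiableAt hI x ht A)).unique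
      (h.hasLogDeriv hI ht x (mem_univ x) A)
  simp only [hx, aut_inv_apply_apply]
  rw [← lie_skew (q x t) A, lie_neg, hA.sq _ (h.q_mem x t ht), neg_neg]

end IsParallelFrame

lemma exists_curve_frame (hA : IsHermitianSymmetric 𝔥 𝔪 A) {γ : ℝ → 𝔤}
    (hγ : γ ∈ smoothCurves (symmetricSpace A)) :
    ∃ ψ : ℝ → 𝔤 ≃ₗ⁅ℝ⁆ 𝔤, ∃ q ∈ smoothCurves (𝔪 : Set 𝔤), HasLogDeriv ψ q univ ∧
      ∀ x, γ x = ψ x A := by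
  obtain ⟨ψ, q, h⟩ := exists_frame_of_map hA isOpen_univ ordConnected_univ (χ := fun x _ => γ x)
    ⟨(hγ.1.comp contDiff_fst).contDiffOn, fun x _ _ => hγ.2 x⟩
  exact ⟨fun x => ψ x 0, fun x => q x 0,
    (h.isSmoothField_hasimoto hA isOpen_univ).slice (mem_univ 0),
    h.hasLogDeriv isOpen_univ (mem_univ 0), fun x => h.map_eq x 0 (mem_univ 0)⟩

lemma lax_frame {ψ : ℝ → 𝔤 ≃ₗ⁅ℝ⁆ 𝔤} {γ q : ℝ → 𝔤} (hq : q ∈ smoothCurves (𝔪 : Set 𝔤))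
    (hψ : HasLogDeriv ψ q univ) (hγ : ∀ x, γ x = ψ x A) (n : ℕ) (x : ℝ) :
    lax (fun _ => 0) γ n x = ψ x (lax q (fun _ => A) n x) :=
  lax_gauge hψ (fun x => by rw [sub_self, map_zero]) hγ (differentiable_lax hq) n x

end CurveFrames

section MapHierarchy

variable {𝔤 : Type*} [LieRing 𝔤] [LieAlgebra ℝ 𝔤] [FiniteDimensional ℝ 𝔤] [IsCompactType 𝔤]
  {𝔥 : LieSubalgebra ℝ 𝔤} {𝔪 : Submodule ℝ 𝔤} {A : 𝔤} {γ : ℝ → 𝔤}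

theorem hasDerivAt_lax_curve (hA : IsHermitianSymmetric 𝔥 𝔪 A)
    (hγ : γ ∈ smoothCurves (symmetricSpace A)) (n : ℕ) (x : ℝ) :
    HasDerivAt (lax (fun _ => 0) γ n) ⁅γ x, lax (fun _ => 0) γ (n + 1) x⁆ x := by
  obtain ⟨ψ, q, hq, hψ, hψγ⟩ := exists_curve_frame hA hγ
  have hderiv :=
    hψ.hasDerivAt_apply (mem_univ x) (differentiable_lax (A := A) hq n x).hasDerivAt
  rw [lax_equation hA hq, LieEquiv.map_lie, ← lax_frame hq hψ hψγ, ← hψγ] at hderiv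
  rwa [show lax (fun _ => 0) γ n = _ from funext (lax_frame hq hψ hψγ n)]

lemma lie_lie_eq_zero_of_centProj_eq_zero (hA : IsHermitianSymmetric 𝔥 𝔪 A) {v y z : 𝔤}
    (hv : v ∈ symmetricSpace A) (hy : centProj v y = 0) (hz : centProj v z = 0) :
    ⁅v, ⁅y, z⁆⁆ = 0 := by
  obtain ⟨φ, -, rfl⟩ := hv
  obtain ⟨y', hy', rfl⟩ := exists_mem_apply_eq_of_centProj_eq_zero hA φ hy
  obtain ⟨z', hz', rfl⟩ := exists_mem_apply_eq_of_centProj_eq_zero hA φ hz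
  rw [← LieEquiv.map_lie, ← LieEquiv.map_lie, (hA.centralizer _).2 (hA.lie_m_m y' hy' z' hz'),
    map_zero]

lemma lie_lie_deriv_lie (hA : IsHermitianSymmetric 𝔥 𝔪 A)
    (hγ : γ ∈ smoothCurves (symmetricSpace A)) (y : 𝔤) (x : ℝ) :
    ⁅γ x, ⁅deriv γ x, ⁅γ x, y⁆⁆⁆ = 0 :=
  lie_lie_eq_zero_of_centProj_eq_zero hA (hγ.2 x)
    (centProj_deriv_eq_zero
      (Eventually.of_forall fun s => lie_lie_lie_of_mem_symmetricSpace hA (hγ.2 s))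
      (hasDerivAt_smoothCurves hγ x))
    (centProj_lie (lie_lie_lie_of_mem_symmetricSpace hA (hγ.2 x)) _)

lemma differentiable_centProj_lax_curve (hγ : γ ∈ smoothCurves (symmetricSpace A)) (n : ℕ) :
    Differentiable ℝ fun x => centProj (γ x) (lax (fun _ => 0) γ n x) :=
  (isJet_self.centProj (isJet_lax (isJet_const 0) isJet_self n)).differentiable hγ

lemma centProj_deriv_centProj_lax (hA : IsHermitianSymmetric 𝔥 𝔪 A)
    (hγ : γ ∈ smoothCurves (symmetricSpace A)) (n : ℕ) (x : ℝ) :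
    centProj (γ x) (deriv (fun x => centProj (γ x) (lax (fun _ => 0) γ n x)) x) =
      ⁅deriv γ x, ⁅γ x, lax (fun _ => 0) γ n x⁆⁆ := by
  have hc := lie_lie_lie_of_mem_symmetricSpace hA (hγ.2 x)
  have hγ' := hasDerivAt_smoothCurves hγ x
  have hlax := hasDerivAt_lax_curve hA hγ n x
  have hderiv : deriv (fun x => centProj (γ x) (lax (fun _ => 0) γ n x)) x = _ :=
    (hlax.fun_add (hasDerivAt_lie hγ' (hasDerivAt_lie hγ' hlax))).deriv
  rw [hderiv, centProj_add, centProj_add, centProj_lie hc, centProj_lie hc,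
    centProj_of_lie_eq_zero (lie_lie_deriv_lie hA hγ _ x)]
  abel

lemma lie_deriv_lie_lax_sub (hA : IsHermitianSymmetric 𝔥 𝔪 A)
    (hγ : γ ∈ smoothCurves (symmetricSpace A)) (n : ℕ) (x : ℝ) :
    ⁅γ x, deriv (fun x => ⁅γ x, lax (fun _ => 0) γ n x⁆) x -
      ⁅deriv γ x, centProj (γ x) (lax (fun _ => 0) γ n x)⁆⁆ =
        -⁅γ x, lax (fun _ => 0) γ (n + 1) x⁆ := by
  rw [(hasDerivAt_lie (hasDerivAt_smoothCurves hγ x) (hasDerivAt_lax_curve hA hγ n x)).deriv,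
    centProj, lie_add (deriv γ x), lie_sub, lie_add (γ x), lie_add (γ x),
    lie_lie_deriv_lie hA hγ, lie_lie_lie_of_mem_symmetricSpace hA (hγ.2 x)]
  abel

lemma isHPrimitive_map (hA : IsHermitianSymmetric 𝔥 𝔪 A) {F : CurveFun 𝔤} {n : ℕ}
    (hF : ∀ γ ∈ smoothCurves (symmetricSpace A), ∀ x,
      F γ x = ⁅γ x, lax (fun _ => 0) γ (n + 1) x⁆) :
    IsHPrimitive (symmetricSpace A) 1 (adCurveX F)
      (fun γ x => centProj (γ x) (lax (fun _ => 0) γ (n + 1) x)) := by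
  refine ⟨(isJet_self.centProj (isJet_lax (isJet_const 0) isJet_self (n + 1))).dependsOnJet,
    fun γ hγ => ⟨differentiable_centProj_lax_curve hγ (n + 1), fun x => ⟨?_, ?_⟩⟩,
    fun v _ x => ?_⟩
  · exact lie_centProj (lie_lie_lie_of_mem_symmetricSpace hA (hγ.2 x)) _
  · rw [one_smul, adCurveX, hF γ hγ x]
    exact centProj_deriv_centProj_lax hA hγ (n + 1) x
  · change centProj v (lax (fun _ => 0) (fun _ => v) (n + 1) x) = 0
    rw [lax_const, centProj_zero]

theorem Rmap_iterate (hA : IsHermitianSymmetric 𝔥 𝔪 A) (n : ℕ) :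
    ∀ γ ∈ smoothCurves (symmetricSpace A), ∀ x,
      ((Rmap A)^[n] curveX) γ x = ⁅γ x, lax (fun _ => 0) γ (n + 1) x⁆ := by
  induction n with
  | zero =>
    intro γ hγ x
    rw [← (hasDerivAt_lax_curve hA hγ 0 x).deriv, lax_zero]
    rfl
  | succ n ih =>
    intro γ hγ x
    rw [Function.iterate_succ_apply']
    set F := (Rmap A)^[n] curveX
    have hF : F γ = fun x => ⁅γ x, lax (fun _ => 0) γ (n + 1) x⁆ := funext (ih γ hγ)
    change -⁅γ x, -⁅γ x, ⁅γ x, deriv (F γ) x⁆⁆ -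
      ⁅deriv γ x, Hinv (symmetricSpace A) 1 (adCurveX F) γ x⁆⁆ = _
    rw [Hinv_eq (isHPrimitive_map hA ih) hγ, hF, lie_sub, lie_neg,
      lie_lie_lie_of_mem_symmetricSpace hA (hγ.2 x), neg_neg, ← lie_sub,
      lie_deriv_lie_lax_sub hA hγ, neg_neg]

end MapHierarchy

section SpinHierarchy

variable {𝔤 : Type*} [LieRing 𝔤] [LieAlgebra ℝ 𝔤] [FiniteDimensional ℝ 𝔤] [IsCompactType 𝔤]
  {𝔥 : LieSubalgebra ℝ 𝔤} {𝔪 : Submodule ℝ 𝔤} {A : 𝔤} {T : ℝ → 𝔤}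

lemma normSq_pos (hm : 𝔪 ≠ ⊥) : 0 < normSq 𝔪 :=
  Nat.cast_pos.2 (Submodule.one_le_finrank_iff.2 hm)

lemma sqrt_normSq_ne_zero (hm : 𝔪 ≠ ⊥) : √(normSq 𝔪) ≠ 0 :=
  (Real.sqrt_pos.2 (normSq_pos hm)).ne'

lemma smul_mem_smoothCurves (hT : T ∈ smoothCurves (spinSpace 𝔪 A)) :
    (fun x => √(normSq 𝔪) • T x) ∈ smoothCurves (symmetricSpace A) :=
  ⟨contDiff_const.smul hT.1, hT.2⟩

lemma isHPrimitive_spin (hA : IsHermitianSymmetric 𝔥 𝔪 A) (hm : 𝔪 ≠ ⊥) {F : CurveFun 𝔤} {n : ℕ}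
    {c : ℝ} (hF : ∀ T ∈ smoothCurves (spinSpace 𝔪 A), ∀ x,
      F T x = c • ⁅√(normSq 𝔪) • T x, lax (fun _ => 0) (fun x => √(normSq 𝔪) • T x) (n + 1) x⁆) :
    IsHPrimitive (spinSpace 𝔪 A) (normSq 𝔪) (adCurveX F) (fun T x => (c / √(normSq 𝔪)) •
      centProj (√(normSq 𝔪) • T x) (lax (fun _ => 0) (fun x => √(normSq 𝔪) • T x) (n + 1) x)) := by
  have hs₂ := Real.mul_self_sqrt (normSq_pos hm).le
  have hs := sqrt_normSq_ne_zero hm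
  set s := √(normSq 𝔪) with hs_def
  have hself : IsJet (spinSpace 𝔪 A) (fun T x => s • T x) :=
    isJet_self.comp (g := fun y => s • y) (by fun_prop)
  have hjet : IsJet (spinSpace 𝔪 A) (fun T x => (c / s) •
      centProj (s • T x) (lax (fun _ => 0) (fun x => s • T x) (n + 1) x)) :=
    (hself.centProj (isJet_lax (isJet_const 0) hself (n + 1))).comp
      (g := fun y => (c / s) • y) (by fun_prop)
  refine ⟨hjet.dependsOnJet, fun T hT => ⟨hjet.differentiable hT, fun x => ⟨?_, ?_⟩⟩,
    fun v _ x => ?_⟩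
  · have hlie := lie_centProj
      (lie_lie_lie_of_mem_symmetricSpace hA (v := s • T x) ((smul_mem_smoothCurves hT).2 x))
      (lax (fun _ => 0) (fun x => s • T x) (n + 1) x)
    rw [smul_lie, smul_eq_zero_iff_right hs] at hlie
    rw [lie_smul, hlie, smul_zero]
  · have hproj := centProj_deriv_centProj_lax hA (smul_mem_smoothCurves hT) (n + 1) x
    rw [← hs_def, deriv_fun_const_smul_field] at hproj
    rw [deriv_fun_const_smul_field, lie_smul, lie_smul, smul_comm (normSq 𝔪), ← smul_add, ← hs₂,
      add_mul_self_smul_lie_lie, hproj, adCurveX, hF T hT x, smul_lie s, lie_smul c, smul_smul,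
      div_mul_cancel₀ c hs]
  · change (c / s) • centProj (s • v) (lax (fun _ => 0) (fun _ => s • v) (n + 1) x) = 0
    rw [lax_const, centProj_zero, smul_zero]

theorem Rspin_iterate (hA : IsHermitianSymmetric 𝔥 𝔪 A) (hm : 𝔪 ≠ ⊥) (n : ℕ) :
    ∀ T ∈ smoothCurves (spinSpace 𝔪 A), ∀ x, ((Rspin 𝔪 A)^[n] curveX) T x =
      (√(normSq 𝔪) ^ n / √(normSq 𝔪)) • ⁅√(normSq 𝔪) • T x,
        lax (fun _ => 0) (fun x => √(normSq 𝔪) • T x) (n + 1) x⁆ := by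
  have hs₂ := Real.mul_self_sqrt (normSq_pos hm).le
  have hs := sqrt_normSq_ne_zero hm
  induction n with
  | zero =>
    intro T hT x
    rw [← (hasDerivAt_lax_curve hA (smul_mem_smoothCurves hT) 0 x).deriv, lax_zero,
      deriv_fun_const_smul_field, smul_smul, pow_zero, one_div, inv_mul_cancel₀ hs, one_smul]
    rfl
  | succ n ih =>
    intro T hT x
    rw [Function.iterate_succ_apply']
    have hrec := lie_deriv_lie_lax_sub hA (smul_mem_smoothCurves hT) (n + 1) x
    set F := (Rspin 𝔪 A)^[n] curveX
    set s := √(normSq 𝔪) with hs_def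
    have hF : F T = fun x =>
        (s ^ n / s) • ⁅s • T x, lax (fun _ => 0) (fun x => s • T x) (n + 1) x⁆ := funext (ih T hT)
    change -(normSq 𝔪 • ⁅T x, deriv (F T) x -
      normSq 𝔪 • ⁅deriv T x, Hinv (spinSpace 𝔪 A) (normSq 𝔪) (adCurveX F) T x⁆⁆) = _
    rw [← neg_eq_iff_eq_neg] at hrec
    rw [Hinv_eq (isHPrimitive_spin hA hm ih) hT, hF, ← hrec, ← hs_def, ← hs₂,
      deriv_fun_const_smul_field, deriv_fun_const_smul_field]
    simp only [lie_sub, lie_smul, smul_lie, smul_sub, smul_neg, smul_smul]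
    match_scalars <;> field_simp <;> ring

end SpinHierarchy

section Velocity

variable {𝔤 : Type*} [LieRing 𝔤] [LieAlgebra ℝ 𝔤] [IsCompactType 𝔤]

variable (𝔤) in
lemma isKilling_of_isCompactType : LieAlgebra.IsKilling ℝ 𝔤 := by
  refine ⟨?_⟩
  rw [LieSubmodule.eq_bot_iff]
  intro x hx
  by_contra hne
  rw [LieIdeal.mem_killingCompl] at hx
  exact (IsCompactType.killing_neg x hne).ne (hx x trivial)

variable [FiniteDimensional ℝ 𝔤] {I : Set ℝ} {φ φ' : ℝ → 𝔤 ≃ₗ⁅ℝ⁆ 𝔤}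

lemma adCLM_adAdjoint_of_derivation {C : 𝔤 →L[ℝ] 𝔤} (hC : ∀ y z, C ⁅y, z⁆ = ⁅C y, z⁆ + ⁅y, C z⁆) :
    adCLM (adAdjoint C) = C := by
  have := isKilling_of_isCompactType 𝔤
  let D : LieDerivation ℝ 𝔤 𝔤 :=
    { toLinearMap := (C : 𝔤 →ₗ[ℝ] 𝔤)
      leibniz' := fun y z => by
        change C ⁅y, z⁆ = ⁅y, C z⁆ - ⁅z, C y⁆
        rw [hC, ← lie_skew z (C y)]
        abel }
  obtain ⟨p, hp⟩ := LieDerivation.IsKilling.exists_eq_ad D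
  have hCp : C = adCLM p := by
    ext y
    change D y = ⁅p, y⁆
    rw [← hp, LieDerivation.ad_apply_apply]
  rw [hCp, adAdjoint_adCLM]

/-- The element `φ⁻¹ φₜ` of the Lie algebra, for a smooth path `φ` of automorphisms: `adAdjoint`
recovers it from the derivation `φ⁻¹ φₜ`, which is inner. -/
noncomputable def autVelocity (φ : ℝ → 𝔤 ≃ₗ⁅ℝ⁆ 𝔤) (t : ℝ) : 𝔤 :=
  adAdjoint (autCLM (φ t)⁻¹ * deriv (fun s => autCLM (φ s)) t)

lemma aut_inv_deriv_lie {D : 𝔤 →L[ℝ] 𝔤} {t : ℝ} (hφ : ∀ y, HasDerivAt (fun s => φ s y) (D y) t)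
    (y z : 𝔤) :
    (φ t)⁻¹ (D ⁅y, z⁆) = ⁅(φ t)⁻¹ (D y), z⁆ + ⁅y, (φ t)⁻¹ (D z)⁆ := by
  have hlie := hasDerivAt_lie (hφ y) (hφ z)
  simp only [← LieEquiv.map_lie] at hlie
  rw [(hφ ⁅y, z⁆).unique hlie, map_add, LieEquiv.map_lie, LieEquiv.map_lie, aut_inv_apply_apply,
    aut_inv_apply_apply]

lemma hasDerivAt_autVelocity {t : ℝ} (hφ : DifferentiableAt ℝ (fun s => autCLM (φ s)) t) (y : 𝔤) :
    HasDerivAt (fun s => φ s y) (φ t ⁅autVelocity φ t, y⁆) t := by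
  set D := deriv (fun s => autCLM (φ s)) t
  have hφ' : ∀ y, HasDerivAt (fun s => φ s y) (D y) t := fun y => by
    simpa using hφ.hasDerivAt.clm_apply (hasDerivAt_const t y)
  have hinner : adCLM (autVelocity φ t) = autCLM (φ t)⁻¹ * D :=
    adCLM_adAdjoint_of_derivation (aut_inv_deriv_lie hφ')
  rw [← adCLM_apply, hinner]
  exact (hφ' y).congr_deriv (aut_apply_inv_apply (φ t) (D y)).symm

lemma hasLogDeriv_autVelocity (hI : IsOpen I) (hφ : ∀ y, ContDiffOn ℝ ∞ (fun t => φ t y) I) :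
    HasLogDeriv φ (autVelocity φ) I := fun _ ht =>
  hasDerivAt_autVelocity
    (((contDiffOn_autCLM hφ).contDiffAt (hI.mem_nhds ht)).differentiableAt (by simp))

lemma contDiffOn_autVelocity (hI : IsOpen I) (hφ : ∀ y, ContDiffOn ℝ ∞ (fun t => φ t y) I) :
    ContDiffOn ℝ ∞ (autVelocity φ) I :=
  (adAdjoint (𝔤 := 𝔤)).contDiff.comp_contDiffOn ((contDiffOn_autCLM (contDiffOn_aut_inv hφ)).mul
    ((contDiffOn_autCLM hφ).deriv_of_isOpen hI (by simp)))

lemma lie_autVelocity_eq_zero (hI : IsOpen I) (hφ : ∀ y, ContDiffOn ℝ ∞ (fun t => φ t y) I)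
    {B : 𝔤} (hB : ∀ t ∈ I, φ t B = B) {t : ℝ} (ht : t ∈ I) : ⁅B, autVelocity φ t⁆ = 0 := by
  have hconst : (fun s => φ s B) =ᶠ[𝓝 t] fun _ => B := by
    filter_upwards [hI.mem_nhds ht] with s hs using hB s hs
  have hzero := (hasLogDeriv_autVelocity hI hφ t ht B).unique
    ((hasDerivAt_const t B).congr_of_eventuallyEq hconst)
  rw [← map_zero (φ t), EmbeddingLike.apply_eq_iff_eq] at hzero
  rw [← lie_skew, hzero, neg_zero]

lemma HasLogDeriv.mul {b b' : ℝ → 𝔤} {s : Set ℝ} (h : HasLogDeriv φ b s)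
    (h' : HasLogDeriv φ' b' s) :
    HasLogDeriv (fun t => φ t * φ' t) (fun t => b' t + (φ' t)⁻¹ (b t)) s := by
  intro t ht y
  refine (h.hasDerivAt_apply ht (h' t ht y)).congr_deriv ?_
  rw [aut_mul_apply, add_lie, map_add (φ' t), map_add (φ t),
    LieEquiv.map_lie (φ' t) ((φ' t)⁻¹ (b t)), aut_apply_inv_apply, ← map_add]

lemma exists_inv_hasLogDeriv (hI : IsOpen I) (hI' : I.OrdConnected) {c : ℝ → 𝔤}
    (hc : ContDiffOn ℝ ∞ c I) :
    ∃ φ : ℝ → 𝔤 ≃ₗ⁅ℝ⁆ 𝔤, IsSmoothPath (adjointGroup 𝔤) I φ ∧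
      HasLogDeriv (fun t => (φ t)⁻¹) c I ∧
      ∀ B, (∀ t ∈ I, ⁅c t, B⁆ = 0) → ∀ t ∈ I, φ t B = B := by
  rcases I.eq_empty_or_nonempty with rfl | ⟨t₀, ht₀⟩
  · exact ⟨fun _ => 1, ⟨by simp, by simp⟩, by simp [HasLogDeriv], by simp⟩
  obtain ⟨φ, hφ, hφ₀, hφ'⟩ := exists_smooth_path hI hI' hc.neg ht₀
  have hinv : HasLogDeriv (fun t => (φ t)⁻¹) c I := fun t ht y =>
    hasDerivAt_aut_inv (fun y => hφ' t ht y) y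
  refine ⟨φ, hφ, hinv, fun B hB t ht => ?_⟩
  have hB' : (φ t)⁻¹ B = (φ t₀)⁻¹ B :=
    eq_of_hasDerivAt_zero hI hI'.isPreconnected (f := fun t => (φ t)⁻¹ B)
      (fun s hs => (hinv s hs B).congr_deriv (by rw [hB s hs, map_zero])) ht ht₀
  rw [hφ₀, inv_one, aut_one_apply] at hB'
  rw [← hB', aut_apply_inv_apply, hB']

lemma IsSmoothPath.inv {K : Subgroup (𝔤 ≃ₗ⁅ℝ⁆ 𝔤)} (hφ : IsSmoothPath K I φ) :
    IsSmoothPath K I (fun t => (φ t)⁻¹) :=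
  ⟨fun t ht => inv_mem (hφ.1 t ht), contDiffOn_aut_inv hφ.2⟩

lemma tendsto_zero_of_lie {ι : Type*} {l : Filter ι} {p : ι → 𝔤}
    (h : ∀ y : 𝔤, Tendsto (fun i => ⁅p i, y⁆) l (𝓝 0)) : Tendsto p l (𝓝 0) := by
  let b := Module.finBasis ℝ 𝔤
  let L : 𝔤 →ₗ[ℝ] (Fin (Module.finrank ℝ 𝔤) → 𝔤) :=
    LinearMap.pi fun i => ((adCLM (𝔤 := 𝔤)).flip (b i)).toLinearMap
  have hL : Function.Injective L := fun y z hyz => adCLM_injective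
    (ContinuousLinearMap.coe_injective (b.ext fun i => congrFun hyz i))
  have hL' := (LinearMap.isClosedEmbedding_of_injective (LinearMap.ker_eq_bot.2 hL)).isInducing
  rw [hL'.tendsto_nhds_iff, map_zero, tendsto_pi_nhds]
  exact fun i => h (b i)

end Velocity

section ZeroCurvature

variable {E : Type*} [NormedAddCommGroup E] [NormedSpace ℝ E] {I : Set ℝ}

lemma differentiableAt_strip (hI : IsOpen I) {f : ℝ × ℝ → E} (hf : ContDiffOn ℝ ∞ f (univ ×ˢ I))
    (x : ℝ) {t : ℝ} (ht : t ∈ I) : DifferentiableAt ℝ f (x, t) :=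
  (hf.contDiffAt ((isOpen_univ.prod hI).mem_nhds ⟨mem_univ x, ht⟩)).differentiableAt (by simp)

lemma contDiffOn_slice_snd {f : ℝ × ℝ → E} (hf : ContDiffOn ℝ ∞ f (univ ×ˢ I)) (x : ℝ) :
    ContDiffOn ℝ ∞ (fun t => f (x, t)) I :=
  hf.comp (contDiff_prodMk_right x).contDiffOn fun _ ht => ⟨mem_univ x, ht⟩

variable {𝔤 : Type*} [LieRing 𝔤] [LieAlgebra ℝ 𝔤] [IsCompactType 𝔤]

/-- The zero curvature equation `qₜ = pₓ + [q, p]` of the connection with components `q` in the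
direction of `x` and `p` in the direction of `t`. -/
def ZeroCurvature (I : Set ℝ) (q p : ℝ → ℝ → 𝔤) : Prop :=
  ∀ x, ∀ t ∈ I, DifferentiableAt ℝ (fun x => p x t) x ∧
    HasDerivAt (fun t => q x t) (deriv (fun x => p x t) x + ⁅q x t, p x t⁆) t

lemma IsJet.contDiffOn_field {N : Set 𝔤} {F : (ℝ → 𝔤) → ℝ → E} (h : IsJet N F) (hI : IsOpen I)
    {q : ℝ → ℝ → 𝔤} (hq : IsSmoothField N I q) :
    ContDiffOn ℝ ∞ (fun z : ℝ × ℝ => F (fun x => q x z.2) z.1) (univ ×ˢ I) := by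
  obtain ⟨k, f, hf, hF⟩ := h
  have hiter : ∀ i, ContDiffOn ℝ ∞ (fun z : ℝ × ℝ => iteratedDeriv i (fun x => q x z.2) z.1)
      (univ ×ˢ I) := by
    intro i
    induction i with
    | zero => simpa using hq.1
    | succ i ih =>
      refine (contDiffOn_fderiv_apply (isOpen_univ.prod hI) ih (1, 0)).congr fun z hz => ?_
      rw [iteratedDeriv_succ]
      exact (hasDerivAt_slice_fst (differentiableAt_strip hI ih z.1 hz.2)).deriv
  exact (hf.comp_contDiffOn (contDiffOn_pi.2 fun i : Fin k => hiter i)).congr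
    fun z hz => hF _ (hq.slice hz.2) z.1

variable [FiniteDimensional ℝ 𝔤] {ψ : ℝ → ℝ → 𝔤 ≃ₗ⁅ℝ⁆ 𝔤} {q p : ℝ → ℝ → 𝔤}

lemma contDiffOn_autVelocity_field (hI : IsOpen I)
    (hψ : ∀ y, ContDiffOn ℝ ∞ (fun z : ℝ × ℝ => ψ z.1 z.2 y) (univ ×ˢ I)) :
    ContDiffOn ℝ ∞ (fun z : ℝ × ℝ => autVelocity (ψ z.1) z.2) (univ ×ˢ I) := by
  have hψ' := contDiffOn_autCLM hψ
  refine ((adAdjoint (𝔤 := 𝔤)).contDiff.comp_contDiffOn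
    ((contDiffOn_autCLM (contDiffOn_aut_inv hψ)).mul
      (contDiffOn_fderiv_apply (isOpen_univ.prod hI) hψ' (0, 1)))).congr fun z hz => ?_
  rw [autVelocity, (hasDerivAt_slice_snd (differentiableAt_strip hI hψ' z.1 hz.2)).deriv]
  rfl

/-- Both sides compute the mixed partial derivative of `ψ y`. -/
lemma lie_partial_add_lie_lie (hI : IsOpen I)
    (hψ : ∀ y, ContDiffOn ℝ ∞ (fun z : ℝ × ℝ => ψ z.1 z.2 y) (univ ×ˢ I))
    (hψx : ∀ t ∈ I, HasLogDeriv (fun x => ψ x t) (fun x => q x t) univ)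
    (hψt : ∀ x, HasLogDeriv (ψ x) (p x) I) {x t : ℝ} (ht : t ∈ I) {q' p' : 𝔤}
    (hq : HasDerivAt (fun t => q x t) q' t) (hp : HasDerivAt (fun x => p x t) p' x) (y : 𝔤) :
    ⁅q', y⁆ + ⁅p x t, ⁅q x t, y⁆⁆ = ⁅p', y⁆ + ⁅q x t, ⁅p x t, y⁆⁆ := by
  have hU : IsOpen ((univ : Set ℝ) ×ˢ I) := isOpen_univ.prod hI
  set f : ℝ × ℝ → 𝔤 := fun z => ψ z.1 z.2 y
  have hf : ContDiffOn ℝ ∞ f (univ ×ˢ I) := hψ y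
  have hfx : ∀ x, ∀ t ∈ I, fderiv ℝ f (x, t) (1, 0) = ψ x t ⁅q x t, y⁆ := fun x t ht =>
    (hasDerivAt_slice_fst (differentiableAt_strip hI hf x ht)).unique (hψx t ht x (mem_univ x) y)
  have hft : ∀ x, ∀ t ∈ I, fderiv ℝ f (x, t) (0, 1) = ψ x t ⁅p x t, y⁆ := fun x t ht =>
    (hasDerivAt_slice_snd (differentiableAt_strip hI hf x ht)).unique (hψt x t ht y)
  have hfxt : HasDerivAt (fun s => fderiv ℝ f (x, s) (1, 0))
      (ψ x t (⁅q', y⁆ + ⁅p x t, ⁅q x t, y⁆⁆)) t := by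
    have hlie := (hψt x).hasDerivAt_apply ht (hasDerivAt_lie hq (hasDerivAt_const t y))
    simp only [lie_zero, add_zero] at hlie
    refine hlie.congr_of_eventuallyEq ?_
    filter_upwards [hI.mem_nhds ht] with s hs using hfx x s hs
  have hftx : HasDerivAt (fun s => fderiv ℝ f (s, t) (0, 1))
      (ψ x t (⁅p', y⁆ + ⁅q x t, ⁅p x t, y⁆⁆)) x := by
    have hlie := (hψx t ht).hasDerivAt_apply (mem_univ x)
      (hasDerivAt_lie hp (hasDerivAt_const x y))
    simp only [lie_zero, add_zero] at hlie
    simpa only [hft _ t ht] using hlie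
  have hpartial : ∀ v, DifferentiableAt ℝ (fun z => fderiv ℝ f z v) (x, t) := fun v =>
    differentiableAt_strip hI (contDiffOn_fderiv_apply hU hf v) x ht
  have hcomm := fderiv_fderiv_comm (p := (x, t))
    (hf.contDiffAt (hU.mem_nhds ⟨mem_univ x, ht⟩)) (1, 0) (0, 1)
  rw [(hasDerivAt_slice_snd (hpartial (1, 0))).unique hfxt,
    (hasDerivAt_slice_fst (hpartial (0, 1))).unique hftx] at hcomm
  exact (ψ x t).injective hcomm

lemma zeroCurvature_of_hasLogDeriv (hI : IsOpen I)
    (hψ : ∀ y, ContDiffOn ℝ ∞ (fun z : ℝ × ℝ => ψ z.1 z.2 y) (univ ×ˢ I))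
    (hψx : ∀ t ∈ I, HasLogDeriv (fun x => ψ x t) (fun x => q x t) univ)
    (hψt : ∀ x, HasLogDeriv (ψ x) (p x) I)
    (hq : ContDiffOn ℝ ∞ (fun z : ℝ × ℝ => q z.1 z.2) (univ ×ˢ I))
    (hp : ContDiffOn ℝ ∞ (fun z : ℝ × ℝ => p z.1 z.2) (univ ×ˢ I)) : ZeroCurvature I q p := by
  intro x t ht
  have hq' := hasDerivAt_slice_snd (differentiableAt_strip hI hq x ht)
  have hp' := hasDerivAt_slice_fst (differentiableAt_strip hI hp x ht)
  refine ⟨hp'.differentiableAt, hq'.congr_deriv (adCLM_injective ?_)⟩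
  ext y
  have hmixed := lie_partial_add_lie_lie hI hψ hψx hψt ht hq' hp' y
  rw [adCLM_apply, adCLM_apply, add_lie, lie_lie, hp'.deriv, eq_sub_of_add_eq hmixed]
  abel

variable {𝔪 : Submodule ℝ 𝔤} {A : 𝔤} {χ : ℝ → ℝ → 𝔤}

lemma IsParallelFrame.hasLogDeriv_time (h : IsParallelFrame 𝔪 A I ψ χ q) (hI : IsOpen I) (x : ℝ) :
    HasLogDeriv (ψ x) (autVelocity (ψ x)) I :=
  hasLogDeriv_autVelocity hI fun y => contDiffOn_slice_snd (h.smooth y) x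

lemma IsParallelFrame.zeroCurvature {𝔥 : LieSubalgebra ℝ 𝔤} (hA : IsHermitianSymmetric 𝔥 𝔪 A)
    (h : IsParallelFrame 𝔪 A I ψ χ q) (hI : IsOpen I) :
    ZeroCurvature I q (fun x => autVelocity (ψ x)) :=
  zeroCurvature_of_hasLogDeriv hI h.smooth (fun _ ht => h.hasLogDeriv hI ht)
    (h.hasLogDeriv_time hI) (h.isSmoothField_hasimoto hA hI).1
    (contDiffOn_autVelocity_field hI h.smooth)

end ZeroCurvature

section Flows

lemma forall_mem_preimage_mul {c : ℝ} (hc : c ≠ 0) {I : Set ℝ} {P : ℝ → Prop} :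
    (∀ t ∈ (fun t => c * t) ⁻¹' I, P (c * t)) ↔ ∀ t ∈ I, P t :=
  ((mul_left_surjective₀ hc).forall (p := fun t => t ∈ I → P t)).symm

variable {𝔤 : Type*} [LieRing 𝔤] [LieAlgebra ℝ 𝔤] [IsCompactType 𝔤] {I : Set ℝ}

lemma IsSmoothField.timeScale {N : Set 𝔤} {f : ℝ → ℝ → 𝔤} (hf : IsSmoothField N I f) (c : ℝ) :
    IsSmoothField N ((fun t => c * t) ⁻¹' I) (timeScale c f) :=
  ⟨hf.1.comp (f := fun z : ℝ × ℝ => (z.1, c * z.2)) (by fun_prop) fun _ hz => ⟨mem_univ _, hz.2⟩,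
    fun x _ ht => hf.2 x _ ht⟩

variable {𝔥 : LieSubalgebra ℝ 𝔤} {𝔪 : Submodule ℝ 𝔤} {A : 𝔤}

lemma IsHermitianSymmetric.map_mem (hA : IsHermitianSymmetric 𝔥 𝔪 A) {φ : 𝔤 ≃ₗ⁅ℝ⁆ 𝔤}
    (hφ : φ A = A) {y : 𝔤} (hy : y ∈ 𝔪) : φ y ∈ 𝔪 := by
  have hφy : φ y = -⁅A, ⁅A, φ y⁆⁆ := by
    conv_rhs => rw [← hφ, ← LieEquiv.map_lie, ← LieEquiv.map_lie, hA.sq y hy, map_neg, neg_neg]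
  rw [hφy]
  exact 𝔪.neg_mem (hA.lie_mem _)

variable [FiniteDimensional ℝ 𝔤] {ψ : ℝ → ℝ → 𝔤 ≃ₗ⁅ℝ⁆ 𝔤} {χ q p : ℝ → ℝ → 𝔤} {k : ℝ → 𝔤 ≃ₗ⁅ℝ⁆ 𝔤}
  {c : ℝ → 𝔤} {n : ℕ}

/-- The `n`-th Lax coefficient of the curve `q(·, t)` with initial term `A`, at `x`. -/
noncomputable def laxField (A : 𝔤) (q : ℝ → ℝ → 𝔤) (n : ℕ) (x t : ℝ) : 𝔤 :=
  lax (fun x => q x t) (fun _ => A) n x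

lemma contDiffOn_laxField (hI : IsOpen I) (hq : IsSmoothField (𝔪 : Set 𝔤) I q) (n : ℕ) :
    ContDiffOn ℝ ∞ (fun z : ℝ × ℝ => laxField A q n z.1 z.2) (univ ×ˢ I) :=
  (isJet_lax isJet_self (isJet_const A) n).contDiffOn_field hI hq

lemma lax_map {φ : 𝔤 ≃ₗ⁅ℝ⁆ 𝔤} (hφ : φ A = A) {q : ℝ → 𝔤} (hq : q ∈ smoothCurves (𝔪 : Set 𝔤))
    (n : ℕ) (x : ℝ) : lax (fun x => φ (q x)) (fun _ => A) n x = φ (lax q (fun _ => A) n x) :=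
  lax_gauge (ψ := fun _ => φ) (b := fun _ => 0)
    (fun x _ y => by simpa using hasDerivAt_const x (φ y)) (fun x => by rw [sub_zero])
    (fun _ => hφ.symm) (differentiable_lax hq) n x

lemma isospectralFlow_iff (hA : IsHermitianSymmetric 𝔥 𝔪 A) (hm : 𝔪 ≠ ⊥)
    (hq : IsSmoothField (𝔪 : Set 𝔤) I q) :
    IsospectralFlow 𝔪 A n ((fun t => normSq 𝔪 * t) ⁻¹' I) (timeScale (normSq 𝔪) q) ↔
      ∀ x, ∀ t ∈ I, deriv (q x) t = -⁅A, laxField A q (n + 1) x t⁆ := by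
  have ha := (normSq_pos hm).ne'
  rw [IsospectralFlow, and_iff_right (hq.timeScale _)]
  refine forall_congr' fun x => Iff.trans (forall₂_congr fun t ht => ?_)
    (forall_mem_preimage_mul ha (P := fun t => deriv (q x) t = -⁅A, laxField A q (n + 1) x t⁆))
  have hderiv : (1 / normSq 𝔪) • deriv (fun s => timeScale (normSq 𝔪) q x s) t =
      deriv (q x) (normSq 𝔪 * t) := by
    change (1 / normSq 𝔪) • deriv (fun s => q x (normSq 𝔪 * s)) t = _
    rw [deriv_comp_mul_left, smul_smul, one_div_mul_cancel ha, one_smul]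
  rw [hderiv, Rop_iterate hA n _ ((hq.timeScale _).slice ht)]
  rfl

lemma isospectralFlow_gauge_iff (hA : IsHermitianSymmetric 𝔥 𝔪 A) (hm : 𝔪 ≠ ⊥) (hI : IsOpen I)
    (hq : IsSmoothField (𝔪 : Set 𝔤) I q) (hk : ∀ y, ContDiffOn ℝ ∞ (fun t => k t y) I)
    (hkA : ∀ t ∈ I, k t A = A) (hc : HasLogDeriv k c I) :
    IsospectralFlow 𝔪 A n ((fun t => normSq 𝔪 * t) ⁻¹' I)
        (timeScale (normSq 𝔪) (fun x t => k t (q x t))) ↔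
      ∀ x, ∀ t ∈ I, deriv (q x) t = -⁅A, laxField A q (n + 1) x t⁆ + ⁅q x t, c t⁆ := by
  have hkq : IsSmoothField (𝔪 : Set 𝔤) I (fun x t => k t (q x t)) :=
    ⟨contDiffOn_aut_apply (φ := fun z : ℝ × ℝ => k z.2)
      (fun y => (hk y).comp contDiffOn_snd fun z hz => hz.2) hq.1,
      fun x t ht => hA.map_mem (hkA t ht) (hq.2 x t ht)⟩
  rw [isospectralFlow_iff hA hm hkq]
  refine forall_congr' fun x => forall₂_congr fun t ht => ?_
  have hqt := hasDerivAt_slice_snd (differentiableAt_strip hI hq.1 x ht)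
  have hlax : ⁅A, laxField A (fun x t => k t (q x t)) (n + 1) x t⁆ =
      k t ⁅A, laxField A q (n + 1) x t⁆ := by
    rw [LieEquiv.map_lie, hkA t ht]
    exact congrArg _ (lax_map (hkA t ht) (hq.slice ht) (n + 1) x)
  rw [hlax, (hc.hasDerivAt_apply ht hqt).deriv, ← map_neg, EmbeddingLike.apply_eq_iff_eq,
    hqt.deriv, ← lie_skew (q x t) (c t), ← sub_eq_add_neg, eq_sub_iff_add_eq]

lemma IsParallelFrame.mul_left (h : IsParallelFrame 𝔪 A I ψ χ q) (hI : IsOpen I)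
    (hk : IsSmoothPath (adjointGroup 𝔤) I k) :
    IsParallelFrame 𝔪 A I (fun x t => k t * ψ x t) (fun x t => k t (χ x t)) q where
  mem x t ht := mul_mem (hk.1 t ht) (h.mem x t ht)
  smooth y := contDiffOn_aut_apply (φ := fun z : ℝ × ℝ => k z.2)
    (fun y => (hk.2 y).comp contDiffOn_snd fun z hz => hz.2) (h.smooth y)
  map_eq x t ht := by rw [h.map_eq x t ht, aut_mul_apply]
  q_mem := h.q_mem
  deriv_eq x t ht y := ((autCLM (k t)).hasFDerivAt.comp_hasDerivAt x
    (h.hasLogDeriv hI ht x (mem_univ x) y)).deriv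

lemma IsParallelFrame.mapFlow_iff (hA : IsHermitianSymmetric 𝔥 𝔪 A)
    (h : IsParallelFrame 𝔪 A I ψ χ q) (hI : IsOpen I) (hp : ∀ x, HasLogDeriv (ψ x) (p x) I)
    (n : ℕ) :
    MapFlow A n I χ ↔ ∀ x, ∀ t ∈ I, ⁅A, p x t + laxField A q (n + 1) x t⁆ = 0 := by
  have hχ := h.isSmoothField_map
  rw [MapFlow, and_iff_right hχ]
  refine forall_congr' fun x => forall₂_congr fun t ht => ?_
  have hχt : HasDerivAt (fun s => χ x s) (ψ x t ⁅p x t, A⁆) t :=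
    (hp x t ht A).congr_of_eventuallyEq (by
      filter_upwards [hI.mem_nhds ht] with s hs using h.map_eq x s hs)
  rw [hχt.deriv, Rmap_iterate hA n _ (hχ.slice ht),
    lax_frame ((h.isSmoothField_hasimoto hA hI).slice ht) (h.hasLogDeriv hI ht)
      (fun x => h.map_eq x t ht), h.map_eq x t ht, ← LieEquiv.map_lie,
    EmbeddingLike.apply_eq_iff_eq, ← lie_skew, lie_add, eq_comm, eq_neg_iff_add_eq_zero, add_comm]
  rfl

end Flows

section Evolution

variable {𝔤 : Type*} [LieRing 𝔤] [LieAlgebra ℝ 𝔤] [FiniteDimensional ℝ 𝔤] [IsCompactType 𝔤]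
  {𝔥 : LieSubalgebra ℝ 𝔤} {𝔪 : Submodule ℝ 𝔤} {A : 𝔤} {I : Set ℝ} {q p : ℝ → ℝ → 𝔤} {n : ℕ}

lemma hasDerivAt_add_laxField (hA : IsHermitianSymmetric 𝔥 𝔪 A)
    (hq : IsSmoothField (𝔪 : Set 𝔤) I q) (hqp : ZeroCurvature I q p) (n : ℕ) (x : ℝ) {t : ℝ}
    (ht : t ∈ I) :
    HasDerivAt (fun x => p x t + laxField A q n x t)
      (deriv (q x) t + ⁅A, laxField A q (n + 1) x t⁆ - ⁅q x t, p x t + laxField A q n x t⁆) x := by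
  obtain ⟨hpx, hqt⟩ := hqp x t ht
  have hlax : ⁅A, laxField A q (n + 1) x t⁆ = _ := (lax_equation hA (hq.slice ht) n x).symm
  refine (hpx.hasDerivAt.fun_add
    (differentiable_lax (A := A) (hq.slice ht) n x).hasDerivAt).congr_deriv ?_
  rw [hqt.deriv, hlax, lie_add, laxField]
  abel

lemma deriv_mem (hA : IsHermitianSymmetric 𝔥 𝔪 A) (hI : IsOpen I)
    (hq : IsSmoothField (𝔪 : Set 𝔤) I q) (x : ℝ) {t : ℝ} (ht : t ∈ I) : deriv (q x) t ∈ 𝔪 := by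
  have hqt := (hasDerivAt_slice_snd
    (differentiableAt_strip hI hq.1 x ht)).differentiableAt.hasDerivAt
  have hsq : (fun t => -q x t) =ᶠ[𝓝 t] (adCLM A * adCLM A) ∘ fun t => q x t := by
    filter_upwards [hI.mem_nhds ht] with s hs using (hA.sq _ (hq.2 x s hs)).symm
  have hderiv := hqt.fun_neg.unique
    (((adCLM A * adCLM A).hasFDerivAt.comp_hasDerivAt t hqt).congr_of_eventuallyEq hsq)
  rw [← neg_neg (deriv (q x) t), hderiv]
  exact 𝔪.neg_mem (hA.lie_mem _)

variable {t : ℝ}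

/-- The derivative of `p + Sₙ` lies in `𝔪`, where `ad(A)` is injective. -/
lemma deriv_eq_of_lie_add_laxField_eq_zero (hA : IsHermitianSymmetric 𝔥 𝔪 A) (hI : IsOpen I)
    (hq : IsSmoothField (𝔪 : Set 𝔤) I q) (hqp : ZeroCurvature I q p) (ht : t ∈ I)
    (h : ∀ x, ⁅A, p x t + laxField A q n x t⁆ = 0) (x : ℝ) :
    deriv (q x) t = -⁅A, laxField A q (n + 1) x t⁆ + ⁅q x t, p x t + laxField A q n x t⁆ := by
  set w := deriv (q x) t + ⁅A, laxField A q (n + 1) x t⁆ - ⁅q x t, p x t + laxField A q n x t⁆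
    with hw
  have hAw : ⁅A, w⁆ = 0 :=
    ((adCLM A).hasFDerivAt.comp_hasDerivAt x (hasDerivAt_add_laxField hA hq hqp n x ht)).unique
      ((hasDerivAt_const x (0 : 𝔤)).congr_of_eventuallyEq (Eventually.of_forall h))
  have hwm : w ∈ 𝔪 := 𝔪.sub_mem (𝔪.add_mem (deriv_mem hA hI hq x ht) (hA.lie_mem _))
    (by
      rw [← lie_skew]
      exact 𝔪.neg_mem (hA.lie_h_m _ ((hA.centralizer _).1 (h x)) _ (hq.2 x t ht)))
  have hw₀ : w = 0 := by rw [← neg_eq_zero, ← hA.sq w hwm, hAw, lie_zero]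
  rw [← sub_eq_zero, ← hw₀, hw]
  abel

lemma add_laxField_eq_of_lie_eq_zero (hA : IsHermitianSymmetric 𝔥 𝔪 A) (hI : IsOpen I)
    (hq : IsSmoothField (𝔪 : Set 𝔤) I q) (hqp : ZeroCurvature I q p) (ht : t ∈ I)
    (h : ∀ x, ⁅A, p x t + laxField A q n x t⁆ = 0) (x y : ℝ) :
    p x t + laxField A q n x t = p y t + laxField A q n y t := by
  refine eq_of_forall_hasDerivAt_zero (f := fun x => p x t + laxField A q n x t) (fun x => ?_) x y
  refine (hasDerivAt_add_laxField hA hq hqp n x ht).congr_deriv ?_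
  rw [deriv_eq_of_lie_add_laxField_eq_zero hA hI hq hqp ht h x]
  abel

lemma frame_add_laxField_sub_eq (hA : IsHermitianSymmetric 𝔥 𝔪 A) {ψ : ℝ → ℝ → 𝔤 ≃ₗ⁅ℝ⁆ 𝔤}
    {χ : ℝ → ℝ → 𝔤} (hψ : IsParallelFrame 𝔪 A I ψ χ q) (hI : IsOpen I)
    (hqp : ZeroCurvature I q p) (ht : t ∈ I) {c : 𝔤}
    (h : ∀ x, deriv (q x) t = -⁅A, laxField A q (n + 1) x t⁆ + ⁅q x t, c⁆) (x y : ℝ) :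
    ψ x t (p x t + laxField A q n x t - c) = ψ y t (p y t + laxField A q n y t - c) := by
  have hq := hψ.isSmoothField_hasimoto hA hI
  refine eq_of_forall_hasDerivAt_zero
    (f := fun x => ψ x t (p x t + laxField A q n x t - c)) (fun x => ?_) x y
  refine ((hψ.hasLogDeriv hI ht).hasDerivAt_apply (mem_univ x)
    ((hasDerivAt_add_laxField hA hq hqp n x ht).sub_const c)).congr_deriv ?_
  rw [h x, lie_sub, ← map_zero (ψ x t)]
  congr 1
  abel

end Evolution

section Equivalence

variable {𝔤 : Type*} [LieRing 𝔤] [LieAlgebra ℝ 𝔤] [FiniteDimensional ℝ 𝔤] [IsCompactType 𝔤]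
  {𝔥 : LieSubalgebra ℝ 𝔤} {𝔪 : Submodule ℝ 𝔤} {A : 𝔤} {I : Set ℝ}
  {ψ : ℝ → ℝ → 𝔤 ≃ₗ⁅ℝ⁆ 𝔤} {χ q p : ℝ → ℝ → 𝔤} {n : ℕ}

lemma contDiffOn_add_laxField (hI : IsOpen I) (hq : IsSmoothField (𝔪 : Set 𝔤) I q)
    (hp : ContDiffOn ℝ ∞ (fun z : ℝ × ℝ => p z.1 z.2) (univ ×ˢ I)) (x : ℝ) :
    ContDiffOn ℝ ∞ (fun t => p x t + laxField A q n x t) I :=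
  contDiffOn_slice_snd (hp.add (contDiffOn_laxField hI hq n)) x

namespace IsParallelFrame

lemma exists_isospectralFlow_of_mapFlow (hA : IsHermitianSymmetric 𝔥 𝔪 A) (hm : 𝔪 ≠ ⊥)
    (h : IsParallelFrame 𝔪 A I ψ χ q) (hI : IsOpen I) (hI' : I.OrdConnected)
    (hχ : MapFlow A n I χ) :
    ∃ k, IsSmoothPath (isotropyGroup A) I k ∧
      IsospectralFlow 𝔪 A (n + 1) ((fun t => normSq 𝔪 * t) ⁻¹' I)
        (timeScale (normSq 𝔪) (fun x t => (k t)⁻¹ (q x t))) := by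
  have hq := h.isSmoothField_hasimoto hA hI
  have hqp := h.zeroCurvature hA hI
  have hlie := (h.mapFlow_iff hA hI (h.hasLogDeriv_time hI) n).1 hχ
  obtain ⟨k, hk, hkc, hk_fix⟩ := exists_inv_hasLogDeriv hI hI' <|
    contDiffOn_add_laxField (A := A) (p := fun x => autVelocity (ψ x)) (n := n + 1) hI hq
      (contDiffOn_autVelocity_field hI h.smooth) 0
  have hkA : ∀ t ∈ I, k t A = A :=
    hk_fix A fun t ht => by rw [← lie_skew, hlie 0 t ht, neg_zero]
  have hkH : IsSmoothPath (isotropyGroup A) I k := ⟨fun t ht => ⟨hk.1 t ht, hkA t ht⟩, hk.2⟩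
  refine ⟨k, hkH, (isospectralFlow_gauge_iff hA hm hI hq hk.inv.2
    (fun t ht => (inv_mem (hkH.1 t ht)).2) hkc).2 fun x t ht => ?_⟩
  have hlie_t := fun x => hlie x t ht
  rw [deriv_eq_of_lie_add_laxField_eq_zero hA hI hq hqp ht hlie_t x,
    add_laxField_eq_of_lie_eq_zero hA hI hq hqp ht hlie_t x 0]

lemma exists_mapFlow_of_isospectralFlow (hA : IsHermitianSymmetric 𝔥 𝔪 A) (hm : 𝔪 ≠ ⊥)
    (h : IsParallelFrame 𝔪 A I ψ χ q) (hI : IsOpen I) (hI' : I.OrdConnected)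
    {k : ℝ → 𝔤 ≃ₗ⁅ℝ⁆ 𝔤} (hk : IsSmoothPath (isotropyGroup A) I k)
    (hq' : IsospectralFlow 𝔪 A (n + 1) ((fun t => normSq 𝔪 * t) ⁻¹' I)
      (timeScale (normSq 𝔪) (fun x t => (k t)⁻¹ (q x t)))) :
    ∃ g, IsSmoothPath (adjointGroup 𝔤) I g ∧ MapFlow A n I (fun x t => g t (χ x t)) := by
  have hq := h.isSmoothField_hasimoto hA hI
  set p : ℝ → ℝ → 𝔤 := fun x => autVelocity (ψ x)
  have hp : ∀ x, HasLogDeriv (ψ x) (p x) I := h.hasLogDeriv_time hI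
  have hkA : ∀ t ∈ I, (k t)⁻¹ A = A := fun t ht => (inv_mem (hk.1 t ht)).2
  set c : ℝ → 𝔤 := autVelocity fun t => (k t)⁻¹
  have hcA : ∀ t ∈ I, ⁅A, c t⁆ = 0 := fun _ ht => lie_autVelocity_eq_zero hI hk.inv.2 hkA ht
  have hqt := (isospectralFlow_gauge_iff hA hm hI hq hk.inv.2 hkA
    (hasLogDeriv_autVelocity hI hk.inv.2)).1 hq'
  set d : ℝ → 𝔤 := fun t => ψ 0 t (p 0 t + laxField A q (n + 1) 0 t - c t)
  have hd : ContDiffOn ℝ ∞ d I :=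
    contDiffOn_aut_apply (fun y => contDiffOn_slice_snd (h.smooth y) 0)
      ((contDiffOn_add_laxField hI hq (contDiffOn_autVelocity_field hI h.smooth) 0).sub
        (contDiffOn_autVelocity hI hk.inv.2))
  have hd_pullback : ∀ x, ∀ t ∈ I,
      (ψ x t)⁻¹ (d t) = p x t + laxField A q (n + 1) x t - c t := fun x t ht => by
    rw [← aut_inv_apply_apply (ψ x t) (p x t + laxField A q (n + 1) x t - c t),
      frame_add_laxField_sub_eq hA h hI (h.zeroCurvature hA hI) ht (fun x => hqt x t ht) x 0]
  obtain ⟨g, hg, hgd, -⟩ := exists_inv_hasLogDeriv hI hI' hd.neg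
  refine ⟨fun t => (g t)⁻¹, hg.inv, ((h.mul_left hI hg.inv).mapFlow_iff hA hI
    (fun x => hgd.mul (hp x)) n).2 fun x t ht => ?_⟩
  rw [map_neg, hd_pullback x t ht, ← hcA t ht]
  congr 1
  abel

theorem exists_mapFlow_iff_exists_isospectralFlow (hA : IsHermitianSymmetric 𝔥 𝔪 A) (hm : 𝔪 ≠ ⊥)
    (h : IsParallelFrame 𝔪 A I ψ χ q) (hI : IsOpen I) (hI' : I.OrdConnected) (n : ℕ) :
    (∃ g, IsSmoothPath (adjointGroup 𝔤) I g ∧ MapFlow A n I (fun x t => g t (χ x t))) ↔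
      ∃ k, IsSmoothPath (isotropyGroup A) I k ∧
        IsospectralFlow 𝔪 A (n + 1) ((fun t => normSq 𝔪 * t) ⁻¹' I)
          (timeScale (normSq 𝔪) (fun x t => (k t)⁻¹ (q x t))) :=
  ⟨fun ⟨_, hg, hχ⟩ => (h.mul_left hI hg).exists_isospectralFlow_of_mapFlow hA hm hI hI' hχ,
    fun ⟨_, hk, hq⟩ => h.exists_mapFlow_of_isospectralFlow hA hm hI hI' hk hq⟩

end IsParallelFrame

end Equivalence

section Decay

variable {𝔤 : Type*} [LieRing 𝔤] [LieAlgebra ℝ 𝔤] [FiniteDimensional ℝ 𝔤] [IsCompactType 𝔤]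
  {𝔥 : LieSubalgebra ℝ 𝔤} {𝔪 : Submodule ℝ 𝔤} {A : 𝔤} {I : Set ℝ}
  {ψ : ℝ → ℝ → 𝔤 ≃ₗ⁅ℝ⁆ 𝔤} {χ q : ℝ → ℝ → 𝔤}

lemma tendsto_lax {q : ℝ → 𝔤} (hq : q ∈ smoothCurves (𝔪 : Set 𝔤)) {l : Filter ℝ}
    (hd : ∀ i : ℕ, Tendsto (iteratedDeriv i q) l (𝓝 0)) (n : ℕ) :
    Tendsto (lax q (fun _ => A) (n + 1)) l (𝓝 0) := by
  obtain ⟨k, f, hf, hF⟩ := isJet_lax (N := (𝔪 : Set 𝔤)) isJet_self (isJet_const A) (n + 1)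
  have hzero := hF (fun _ => 0) ⟨contDiff_const, fun _ => 𝔪.zero_mem⟩ 0
  beta_reduce at hzero
  rw [lax_const] at hzero
  rw [hzero]
  refine ((hf.continuous.tendsto _).comp (tendsto_pi_nhds.2 fun i => ?_)).congr
    fun x => (hF q hq x).symm
  simpa using hd i

lemma tendsto_autVelocity {ι : Type*} {l : Filter ι} {φ : ι → ℝ → 𝔤 ≃ₗ⁅ℝ⁆ 𝔤} (hI : IsOpen I)
    (hφ : ∀ i y, ContDiffOn ℝ ∞ (fun t => φ i t y) I) {t : ℝ} (ht : t ∈ I)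
    (hd : ∀ y, Tendsto (fun i => deriv (fun s => φ i s y) t) l (𝓝 0)) :
    Tendsto (fun i => autVelocity (φ i) t) l (𝓝 0) := by
  refine tendsto_zero_of_lie fun y => ?_
  rw [tendsto_zero_iff_norm_tendsto_zero]
  refine (tendsto_zero_iff_norm_tendsto_zero.1 (hd y)).congr fun i => ?_
  rw [(hasLogDeriv_autVelocity hI (hφ i) t ht y).deriv, norm_lieEquiv]

namespace IsParallelFrame

theorem mapFlow_iff_isospectralFlow (hA : IsHermitianSymmetric 𝔥 𝔪 A) (hm : 𝔪 ≠ ⊥)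
    (h : IsParallelFrame 𝔪 A I ψ χ q) (hI : IsOpen I)
    (hd : ∀ t ∈ I, ∀ i : ℕ, Tendsto (iteratedDeriv i (fun x => q x t)) atBot (𝓝 0))
    (hψ : ∀ t ∈ I, ∀ y : 𝔤, Tendsto (fun x => deriv (fun s => ψ x s y) t) atBot (𝓝 0)) (n : ℕ) :
    MapFlow A n I χ ↔ IsospectralFlow 𝔪 A (n + 1) ((fun t => normSq 𝔪 * t) ⁻¹' I)
      (timeScale (normSq 𝔪) q) := by
  have hq := h.isSmoothField_hasimoto hA hI
  have hqp := h.zeroCurvature hA hI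
  have hw : ∀ t ∈ I, Tendsto (fun x => autVelocity (ψ x) t + laxField A q (n + 1) x t) atBot
      (𝓝 (0 + 0)) := fun t ht =>
    (tendsto_autVelocity hI (fun x y => contDiffOn_slice_snd (h.smooth y) x) ht (hψ t ht)).add
      (tendsto_lax (hq.slice ht) (hd t ht) n)
  simp only [add_zero] at hw
  rw [h.mapFlow_iff hA hI (h.hasLogDeriv_time hI), isospectralFlow_iff hA hm hq]
  refine ⟨fun hlie x t ht => ?_, fun hqt x t ht => ?_⟩
  · have hlie_t := fun x => hlie x t ht
    have hw₀ : autVelocity (ψ x) t + laxField A q (n + 1) x t = 0 :=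
      tendsto_nhds_unique (tendsto_const_nhds.congr fun y =>
        add_laxField_eq_of_lie_eq_zero hA hI hq hqp ht hlie_t x y) (hw t ht)
    rw [deriv_eq_of_lie_add_laxField_eq_zero hA hI hq hqp ht hlie_t x, hw₀, lie_zero, add_zero]
  · have hframe := frame_add_laxField_sub_eq hA h hI hqp ht (c := 0)
      (fun x => by rw [hqt x t ht, lie_zero, add_zero]) x
    simp only [sub_zero] at hframe
    have hw₀ : ‖autVelocity (ψ x) t + laxField A q (n + 1) x t‖ = ‖(0 : 𝔤)‖ :=
      tendsto_nhds_unique (tendsto_const_nhds.congr fun y => by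
        rw [← norm_lieEquiv (ψ x t), hframe y, norm_lieEquiv]) (hw t ht).norm
    rw [norm_zero, norm_eq_zero] at hw₀
    rw [hw₀, lie_zero]

end IsParallelFrame

end Decay

section SpinModel

section Scaling

variable {𝔤 : Type*} [LieRing 𝔤] [LieAlgebra ℝ 𝔤] [IsCompactType 𝔤] {I : Set ℝ}

lemma IsSmoothField.smul {N N' : Set 𝔤} {f : ℝ → ℝ → 𝔤} {r : ℝ} (hf : IsSmoothField N I f)
    (hN : ∀ v ∈ N, r • v ∈ N') : IsSmoothField N' I (fun x t => r • f x t) :=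
  ⟨hf.1.const_smul r, fun x t ht => hN _ (hf.2 x t ht)⟩

lemma isSmoothField_timeScale_iff {c : ℝ} (hc : c ≠ 0) {N : Set 𝔤} {f : ℝ → ℝ → 𝔤} :
    IsSmoothField N ((fun t => c * t) ⁻¹' I) (timeScale c f) ↔ IsSmoothField N I f := by
  refine ⟨fun h => ?_, fun h => h.timeScale c⟩
  have hI : (fun t => c⁻¹ * t) ⁻¹' ((fun t => c * t) ⁻¹' I) = I := by
    ext t
    simp only [mem_preimage, mul_inv_cancel_left₀ hc]
  have hf : timeScale c⁻¹ (timeScale c f) = f := by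
    ext x t
    simp only [timeScale, mul_inv_cancel_left₀ hc]
  simpa only [hI, hf] using h.timeScale c⁻¹

end Scaling

variable {𝔤 : Type*} [LieRing 𝔤] [LieAlgebra ℝ 𝔤] [FiniteDimensional ℝ 𝔤] [IsCompactType 𝔤]
  {𝔥 : LieSubalgebra ℝ 𝔤} {𝔪 : Submodule ℝ 𝔤} {A : 𝔤} {I : Set ℝ} {n : ℕ}

/-- `-ad(A)²` is a projection onto `𝔪`, so `-Kill(A, A)` is its trace. -/
lemma norm_hermitian (hA : IsHermitianSymmetric 𝔥 𝔪 A) : ‖A‖ = √(normSq 𝔪) := by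
  have hproj : LinearMap.IsProj 𝔪 ((-(adCLM A * adCLM A) : 𝔤 →L[ℝ] 𝔤) : 𝔤 →ₗ[ℝ] 𝔤) := by
    refine ⟨fun y => 𝔪.neg_mem (hA.lie_mem _), fun y hy => ?_⟩
    change -⁅A, ⁅A, y⁆⁆ = y
    rw [hA.sq y hy, neg_neg]
  have hnorm : ‖A‖ ^ 2 = normSq 𝔪 := by
    rw [← real_inner_self_eq_norm_sq, inner_eq_neg_traceCLM, ← map_neg]
    exact hproj.trace
  rw [← hnorm, Real.sqrt_sq (norm_nonneg A)]

lemma norm_of_mem_spinSpace (hA : IsHermitianSymmetric 𝔥 𝔪 A) (hm : 𝔪 ≠ ⊥) {v : 𝔤}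
    (hv : v ∈ spinSpace 𝔪 A) : ‖v‖ = 1 := by
  obtain ⟨φ, -, hφ⟩ := hv
  refine mul_left_cancel₀ (sqrt_normSq_ne_zero hm) ?_
  calc √(normSq 𝔪) * ‖v‖ = ‖√(normSq 𝔪) • v‖ := by
        rw [norm_smul, Real.norm_of_nonneg (Real.sqrt_nonneg _)]
    _ = √(normSq 𝔪) * 1 := by rw [← hφ, norm_lieEquiv, norm_hermitian hA, mul_one]

lemma isSmoothField_spinSpace_iff (hm : 𝔪 ≠ ⊥) {χ : ℝ → ℝ → 𝔤} :
    IsSmoothField (spinSpace 𝔪 A) I (fun x t => (1 / √(normSq 𝔪)) • χ x t) ↔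
      IsSmoothField (symmetricSpace A) I χ := by
  have hscale : ∀ v : 𝔤, √(normSq 𝔪) • (1 / √(normSq 𝔪)) • v = v := fun v => by
    rw [smul_smul, mul_one_div_cancel (sqrt_normSq_ne_zero hm), one_smul]
  refine ⟨fun h => ?_, fun h => h.smul fun v hv => ?_⟩
  · simpa only [hscale] using h.smul (N' := symmetricSpace A) (r := √(normSq 𝔪)) fun v hv => hv
  · change √(normSq 𝔪) • (1 / √(normSq 𝔪)) • v ∈ symmetricSpace A
    rwa [hscale]

theorem mapFlow_iff_spinFlow (hA : IsHermitianSymmetric 𝔥 𝔪 A) (hm : 𝔪 ≠ ⊥) (n : ℕ)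
    (χ : ℝ → ℝ → 𝔤) :
    MapFlow A n I χ ↔ SpinFlow 𝔪 A n ((fun t => √(normSq 𝔪) ^ n * t) ⁻¹' I)
      (timeScale (√(normSq 𝔪) ^ n) (fun x t => (1 / √(normSq 𝔪)) • χ x t)) := by
  have hr := sqrt_normSq_ne_zero hm
  set r := √(normSq 𝔪) with hr_def
  have hc : r ^ n ≠ 0 := pow_ne_zero n hr
  set T := timeScale (r ^ n) fun x t => (1 / r) • χ x t with hT_def
  have hsmooth : IsSmoothField (spinSpace 𝔪 A) ((fun t => r ^ n * t) ⁻¹' I) T ↔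
      IsSmoothField (symmetricSpace A) I χ :=
    (isSmoothField_timeScale_iff hc).trans (isSmoothField_spinSpace_iff hm)
  rw [MapFlow, SpinFlow, hsmooth]
  refine and_congr_right fun hχ => ?_
  have hT := hsmooth.2 hχ
  rw [and_iff_right fun x t ht => norm_of_mem_spinSpace hA hm (hT.2 x t ht)]
  refine forall_congr' fun x => (forall_mem_preimage_mul hc).symm.trans
    (forall₂_congr fun t ht => ?_)
  have hderiv : deriv (fun s => T x s) t =
      (r ^ n / r) • deriv (fun s => χ x s) (r ^ n * t) := by
    simp only [hT_def, timeScale]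
    rw [deriv_comp_mul_left (r ^ n) (fun s => (1 / r) • χ x s), deriv_fun_const_smul_field,
      smul_smul, mul_one_div]
  have hrT : ∀ y, r • T y t = χ y (r ^ n * t) := fun y => by
    rw [hT_def, timeScale, smul_smul, mul_one_div_cancel hr, one_smul]
  rw [hderiv, Rspin_iterate hA hm n _ (hT.slice ht), Rmap_iterate hA n _ (hχ.slice ht)]
  simp only [← hr_def, hrT, (smul_right_injective 𝔤 (div_ne_zero hc hr)).eq_iff]

end SpinModel

end HermSym

theorem mainTheorem10 {𝔤 : Type*} [LieRing 𝔤] [LieAlgebra ℝ 𝔤] [FiniteDimensional ℝ 𝔤]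
    [IsCompactType 𝔤] (𝔥 : LieSubalgebra ℝ 𝔤) (𝔪 : Submodule ℝ 𝔤) (A : 𝔤)
    (hA : IsHermitianSymmetric 𝔥 𝔪 A) (hm : 𝔪 ≠ ⊥) (n : ℕ)
    (I : Set ℝ) (hI : IsOpen I) (hI' : I.OrdConnected) :
    -- the inverse derivatives in the three hierarchies are well defined
    (∀ k : ℕ,
      (∃ P, IsPrimitive 𝔪 (adq (Jinv A ((Rop 𝔪 A)^[k] (Jq A)))) P ∧
        ∀ P', IsPrimitive 𝔪 (adq (Jinv A ((Rop 𝔪 A)^[k] (Jq A)))) P' →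
          ∀ q ∈ smoothCurves (𝔪 : Set 𝔤), P' q = P q) ∧
      (∃ P, IsHPrimitive (symmetricSpace A) 1 (adCurveX ((Rmap A)^[k] curveX)) P ∧
        ∀ P', IsHPrimitive (symmetricSpace A) 1 (adCurveX ((Rmap A)^[k] curveX)) P' →
          ∀ γ ∈ smoothCurves (symmetricSpace A), P' γ = P γ) ∧
      (∃ P, IsHPrimitive (spinSpace 𝔪 A) (normSq 𝔪) (adCurveX ((Rspin 𝔪 A)^[k] curveX)) P ∧
        ∀ P', IsHPrimitive (spinSpace 𝔪 A) (normSq 𝔪) (adCurveX ((Rspin 𝔪 A)^[k] curveX)) P' →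
          ∀ γ ∈ smoothCurves (spinSpace 𝔪 A), P' γ = P γ)) ∧
    -- every map has a Hasimoto variable, and every `𝔪`-valued `q` is one
    (∀ χ, IsSmoothField (symmetricSpace A) I χ → ∃ ψ q, IsParallelFrame 𝔪 A I ψ χ q) ∧
    (∀ q, IsSmoothField (𝔪 : Set 𝔤) I q → ∃ ψ χ, IsParallelFrame 𝔪 A I ψ χ q) ∧
    -- equivalence of the map equation with the isospectral flow, modulo the freedom
    -- in the correspondence between maps and Hasimoto variables
    (∀ (ψ : ℝ → ℝ → (𝔤 ≃ₗ⁅ℝ⁆ 𝔤)) (χ q : ℝ → ℝ → 𝔤), IsParallelFrame 𝔪 A I ψ χ q →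
      ((∃ g, IsSmoothPath (adjointGroup 𝔤) I g ∧ MapFlow A n I (fun x t => g t (χ x t))) ↔
       (∃ h, IsSmoothPath (isotropyGroup A) I h ∧
          IsospectralFlow 𝔪 A (n + 1) ((fun t => normSq 𝔪 * t) ⁻¹' I)
            (timeScale (normSq 𝔪) (fun x t => (h t)⁻¹ (q x t)))))) ∧
    -- exact equivalence under decay at `x = -∞`
    (∀ (ψ : ℝ → ℝ → (𝔤 ≃ₗ⁅ℝ⁆ 𝔤)) (χ q : ℝ → ℝ → 𝔤), IsParallelFrame 𝔪 A I ψ χ q →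
      (∀ t ∈ I, ∀ i : ℕ, Tendsto (iteratedDeriv i (fun x => q x t)) atBot (𝓝 0)) →
      (∀ t ∈ I, ∀ y : 𝔤, Tendsto (fun x => deriv (fun s => ψ x s y) t) atBot (𝓝 0)) →
      (MapFlow A n I χ ↔
        IsospectralFlow 𝔪 A (n + 1) ((fun t => normSq 𝔪 * t) ⁻¹' I)
          (timeScale (normSq 𝔪) q))) ∧
    -- equivalence of the map equation with the spin model
    (∀ χ : ℝ → ℝ → 𝔤, MapFlow A n I χ ↔
      SpinFlow 𝔪 A n ((fun t => √(normSq 𝔪) ^ n * t) ⁻¹' I)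
        (timeScale (√(normSq 𝔪) ^ n) (fun x t => (1 / √(normSq 𝔪)) • χ x t))) := by
  refine ⟨fun k => ⟨?_, ?_, ?_⟩, fun χ hχ => exists_frame_of_map hA hI hI' hχ,
    fun q hq => exists_frame_of_hasimoto hI hq,
    fun ψ χ q h => h.exists_mapFlow_iff_exists_isospectralFlow hA hm hI hI' n,
    fun ψ χ q h hd hψ => h.mapFlow_iff_isospectralFlow hA hm hI hd hψ n,
    mapFlow_iff_spinFlow hA hm n⟩
  · have h := isPrimitive_lax hA (Rop_iterate hA k)
    exact ⟨_, h, fun P' hP' q hq => h.eq hP' (fun _ _ _ => rfl) hq⟩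
  · have h := isHPrimitive_map hA (Rmap_iterate hA k)
    exact ⟨_, h, fun P' hP' γ hγ => h.eq hP' (fun _ _ _ => rfl) hγ⟩
  · have h := isHPrimitive_spin hA hm (Rspin_iterate hA hm k)
    exact ⟨_, h, fun P' hP' γ hγ => h.eq hP' (fun _ _ _ => rfl) hγ⟩
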